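/- Let $G$ be a connected non-compact simple Lie group (i.e. its Lie algebra $\mathfrak g$ is a simple real Lie algebra) with Killing form $B$, and let $K$ be a maximal compact subgroup of $G$ with Lie algebra $\mathfrak k$. Let $\mathfrak p$ be the $B$-orthogonal complement of $\mathfrak k$, and assume that $\mathfrak g=\mathfrak p\oplus\mathfrak k$ is a Cartan decomposition, i.e. $[\mathfrak k,\mathfrak p]\subset\mathfrak p$, $[\mathfrak p,\mathfrak p]\subset\mathfrak k$, $B$ is positive definite on $\mathfrak p$ and negative definite on $\mathfrak k$ (this is automatic if $G$ has finite centre). Put $Q=B|_{\mathfrak p}-B|_{\mathfrak k}$, an inner product on $\mathfrak g$. Let $\mathfrak k_1,\dots,\mathfrak k_r$ be the simple ideals of $[\mathfrak k,\mathfrak k]$; if the centre of $\mathfrak k$ is non-trivial, put $s=1$ and let $\mathfrak k_{r+1}$ be the centre, otherwise put $s=0$. Thus $\mathfrak k=\mathfrak k_1\oplus\dots\oplus\mathfrak k_{r+s}$. Let $n=\dim\mathfrak p$, $d_i=\dim\mathfrak k_i$, and let $\kappa_i\in\mathbb R$ be the constant such that the Killing form of $\mathfrak k_i$ equals $\kappa_i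 B|_{\mathfrak k_i}$. Left-invariant $(0,2)$-tensor fields on $G$ are identified with bilinear forms on $\mathfrak g$. The group $G\times K$ acts on $G$ by $(x,k)\,y=xyk^{-1}$, with isotropy group $\{(k,k)\mid k\in K\}$ at the identity. Let $\mathcal M_K$ be the set of left-invariant Riemannian metrics $g$ on $G$ that are naturally reductive with respect to $G\times K$ and some decomposition of its Lie algebra. This means that $G\times K$ acts by isometries of $g$ and there is a linear complement $\mathfrak m$ of $\Delta\mathfrak k=\{(X,X)\mid X\in\mathfrak k\}$ in $\mathfrak g\times\mathfrak k$ that is invariant under $\mathrm{Ad}(k,k)$ for all $k\in K$ and satisfies $\langle[u,v]_{\mathfrak m},w\rangle+\langle v,[u,w]_{\mathfrak m}\rangle=0$ for all $u,v,w\in\mathfrak m$. Here $[\cdot,\cdot]_{\mathfrak m}$ is the $\mathfrak m$-component along $\Delta\mathfrak k$, and $\langle\cdot,\cdot\rangle$ is $g$ transported to $\mathfrak m$ by the isomorphism $\mathfrak m\to\mathfrak g$, $(X,Y)\mapsto X-Y$. **Theorem.** Let $$T=-T_{\mathfrak p}\,Q|_{\mathfrak p}+T_1\,Q|_{\mathfrak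 k_1}+\dots+T_{r+s}\,Q|_{\mathfrak k_{r+s}},\qquad T_{\mathfrak p},T_1,\dots,T_{r+s}>0.$$ A metric $g\in\mathcal M_K$ with $\mathrm{Ric}(g)=T$ exists if and only if $4T_i-\kappa_i>0$ for all $i=1,\dots,r$ and $$T_{\mathfrak p}=\sum_{i=1}^{r+s}\frac{2d_i(1-\kappa_i)+d_i\sqrt{(4T_i-\kappa_i)(1-\kappa_i)}}{2n}.$$ There is at most one such $g$ up to scaling: if $g,g'\in\mathcal M_K$ and $\mathrm{Ric}(g)=\mathrm{Ric}(g')=T$, then $g'=cg$ for some $c>0$. -/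

import Mathlib

open scoped Manifold ContDiff

namespace NatRed

noncomputable section

/-! ### Left-invariant metrics and their Ricci curvature

Left-invariant tensor fields on a Lie group are identified with the multilinear maps which they
induce on the Lie algebra, and left-invariant vector fields with elements of the Lie algebra. -/

section Curvature

variable (V : Type*) [LieRing V] [LieAlgebra ℝ V]

/-- A left-invariant Riemannian metric: an inner product on the Lie algebra. -/
structure Metric where
  /-- the inner product -/
  form : LinearMap.BilinForm ℝ V
  symm : ∀ X Y, form X Y = form Y X
  pos : ∀ X, X ≠ 0 → 0 < form X X

variable {V}

theorem Metric.nondegenerate (g : Metric V) : g.form.Nondegenerate := by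
  refine ⟨fun X hX => ?_, fun X hX => ?_⟩ <;>
  · by_contra h
    exact absurd (hX X) (g.pos X h).ne'

variable [FiniteDimensional ℝ V]

/-- The Levi-Civita connection of `g` on left-invariant vector fields, `(X, Y) ↦ ∇_X Y`, given by
the Koszul formula
`2 g(∇_X Y, Z) = g([X, Y], Z) - g([Y, Z], X) + g([Z, X], Y)`
(the derivatives of the constant functions `g(X, Y)`, ... vanish). -/
def leviCivita (g : Metric V) : V →ₗ[ℝ] V →ₗ[ℝ] V :=
  LinearMap.mk₂ ℝ
    (fun X Y => (1 / 2 : ℝ) • (LinearMap.BilinForm.toDual g.form g.nondegenerate).symm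
      (g.form ⁅X, Y⁆ - (g.form.flip X).comp (LieAlgebra.ad ℝ V Y)
        - (g.form.flip Y).comp (LieAlgebra.ad ℝ V X)))
    (by
      intro X X' Y
      rw [← smul_add, ← map_add]
      congr 2
      ext Z
      simp
      ring)
    (by
      intro c X Y
      rw [smul_comm c (1 / 2 : ℝ), ← LinearEquiv.map_smul _ c]
      refine congrArg (fun φ => (1 / 2 : ℝ) •
        (LinearMap.BilinForm.toDual g.form g.nondegenerate).symm φ) ?_
      ext Z
      simp
      ring)
    (by
      intro X Y Y'
      rw [← smul_add, ← map_add]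
      congr 2
      ext Z
      simp
      ring)
    (by
      intro c X Y
      rw [smul_comm c (1 / 2 : ℝ), ← LinearEquiv.map_smul _ c]
      refine congrArg (fun φ => (1 / 2 : ℝ) •
        (LinearMap.BilinForm.toDual g.form g.nondegenerate).symm φ) ?_
      ext Z
      simp
      ring)

theorem koszul (g : Metric V) (X Y Z : V) :
    2 * g.form (leviCivita g X Y) Z
      = g.form ⁅X, Y⁆ Z - g.form ⁅Y, Z⁆ X + g.form ⁅Z, X⁆ Y := by
  have h : ∀ φ : Module.Dual ℝ V,
      g.form ((LinearMap.BilinForm.toDual g.form g.nondegenerate).symm φ) Z = φ Z := by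
    intro φ
    rw [← LinearMap.BilinForm.toDual_def g.nondegenerate, LinearEquiv.apply_symm_apply]
  have h' : g.form ⁅Z, X⁆ Y = -g.form ⁅X, Z⁆ Y := by
    rw [← lie_skew Z X, map_neg, LinearMap.neg_apply]
  rw [h']
  simp only [leviCivita, LinearMap.mk₂_apply, map_smul, LinearMap.smul_apply, h, smul_eq_mul]
  simp
  ring

/-- The Levi-Civita connection is torsion-free. -/
theorem leviCivita_torsion (g : Metric V) (X Y : V) :
    leviCivita g X Y - leviCivita g Y X = ⁅X, Y⁆ := by
  rw [← sub_eq_zero]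
  refine g.nondegenerate.1 _ fun Z => ?_
  have h1 := koszul g X Y Z
  have h2 := koszul g Y X Z
  rw [← lie_skew Y X, ← lie_skew X Z, ← lie_skew Z Y] at h2
  simp only [map_sub, map_neg, LinearMap.sub_apply, LinearMap.neg_apply] at *
  linarith

/-- The Levi-Civita connection is metric. -/
theorem leviCivita_metric (g : Metric V) (X Y Z : V) :
    g.form (leviCivita g X Y) Z + g.form Y (leviCivita g X Z) = 0 := by
  have h1 := koszul g X Y Z
  have h2 := koszul g X Z Y
  rw [g.symm Y]
  rw [← lie_skew Z Y, ← lie_skew Y X, ← lie_skew X Z] at h2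
  simp only [map_neg, LinearMap.neg_apply] at *
  linarith

/-- The curvature tensor `R(X, Y) Z = ∇_X ∇_Y Z - ∇_Y ∇_X Z - ∇_[X, Y] Z`, as the linear map
`X ↦ R(X, Y) Z`. -/
def curvature (g : Metric V) (Y Z : V) : V →ₗ[ℝ] V :=
  (leviCivita g).flip (leviCivita g Y Z) - (leviCivita g Y).comp ((leviCivita g).flip Z)
    + ((leviCivita g).flip Z).comp (LieAlgebra.ad ℝ V Y)

theorem curvature_apply (g : Metric V) (X Y Z : V) :
    curvature g Y Z X = leviCivita g X (leviCivita g Y Z) - leviCivita g Y (leviCivita g X Z)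
      - leviCivita g ⁅X, Y⁆ Z := by
  have h : leviCivita g ⁅X, Y⁆ Z = -leviCivita g ⁅Y, X⁆ Z := by
    rw [← lie_skew X Y, map_neg, LinearMap.neg_apply]
  rw [h, sub_neg_eq_add]
  simp [curvature]

/-- The Ricci curvature `Ric(Y, Z) = tr (X ↦ R(X, Y) Z)`. -/
def ricci (g : Metric V) (Y Z : V) : ℝ := LinearMap.trace ℝ V (curvature g Y Z)

end Curvature

/-! ### Cartan decompositions and the ideals of the maximal compact subalgebra -/

section Cartan

variable {V : Type*} [LieRing V] [LieAlgebra ℝ V]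

/-- The orthogonal complement of a subalgebra with respect to the Killing form `B`. -/
def killingCompl (𝔨 : LieSubalgebra ℝ V) : Submodule ℝ V :=
  (killingForm ℝ V).orthogonal 𝔨.toSubmodule

/-- `V = 𝔭 ⊕ 𝔨`, where `𝔭` is the Killing orthogonal complement of `𝔨`, is a Cartan
decomposition. -/
structure IsCartanDecomposition (𝔨 : LieSubalgebra ℝ V) : Prop where
  isCompl : IsCompl (killingCompl 𝔨) 𝔨.toSubmodule
  lie_k_p : ∀ X ∈ 𝔨, ∀ Y ∈ killingCompl 𝔨, ⁅X, Y⁆ ∈ killingCompl 𝔨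
  lie_p_p : ∀ X ∈ killingCompl 𝔨, ∀ Y ∈ killingCompl 𝔨, ⁅X, Y⁆ ∈ 𝔨
  pos : ∀ X ∈ killingCompl 𝔨, X ≠ 0 → 0 < killingForm ℝ V X X
  neg : ∀ X ∈ 𝔨, X ≠ 0 → killingForm ℝ V X X < 0

/-- The inner product `Q = B|_𝔭 - B|_𝔨`. -/
def IsCartanDecomposition.Q {𝔨 : LieSubalgebra ℝ V} (h : IsCartanDecomposition 𝔨) :
    LinearMap.BilinForm ℝ V :=
  (killingForm ℝ V).compl₁₂ (Submodule.projection _ _ h.isCompl) (Submodule.projection _ _ h.isCompl)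
    - (killingForm ℝ V).compl₁₂ (Submodule.projection _ _ h.isCompl.symm)
      (Submodule.projection _ _ h.isCompl.symm)

/-- The derived algebra `[𝔨, 𝔨]`. -/
def derivedSubmodule (𝔨 : LieSubalgebra ℝ V) : Submodule ℝ V :=
  Submodule.span ℝ {Z | ∃ X ∈ 𝔨, ∃ Y ∈ 𝔨, ⁅X, Y⁆ = Z}

/-- `𝔩` is a simple ideal of `[𝔨, 𝔨]`. -/
def IsSimpleIdealOfDerived (𝔨 𝔩 : LieSubalgebra ℝ V) : Prop :=
  𝔩.toSubmodule ≤ derivedSubmodule 𝔨 ∧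
  (∀ X ∈ derivedSubmodule 𝔨, ∀ Y ∈ 𝔩, ⁅X, Y⁆ ∈ 𝔩) ∧
  LieAlgebra.IsSimple ℝ 𝔩

/-- `X` lies in the centre of `𝔨`. -/
def IsCentral (𝔨 : LieSubalgebra ℝ V) (X : V) : Prop :=
  X ∈ 𝔨 ∧ ∀ Y ∈ 𝔨, ⁅X, Y⁆ = 0

/-- `𝔣` lists the simple ideals of `[𝔨, 𝔨]` (the first `r` entries, without repetition) and,
if the centre of `𝔨` is non-trivial, the centre (the last entry, with `s = 1`); otherwise
`s = 0`. -/
structure IsIdealList (𝔨 : LieSubalgebra ℝ V) (r s : ℕ)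
    (𝔣 : Fin (r + s) → LieSubalgebra ℝ V) : Prop where
  injective : Function.Injective fun i : Fin r => 𝔣 (Fin.castAdd s i)
  simple : ∀ 𝔩 : LieSubalgebra ℝ V,
    IsSimpleIdealOfDerived 𝔨 𝔩 ↔ ∃ i : Fin r, 𝔣 (Fin.castAdd s i) = 𝔩
  card_centre : (s = 0 ∧ ∀ X, IsCentral 𝔨 X → X = 0) ∨ (s = 1 ∧ ∃ X, IsCentral 𝔨 X ∧ X ≠ 0)
  centre : ∀ (j : Fin s) (X : V), X ∈ 𝔣 (Fin.natAdd r j) ↔ IsCentral 𝔨 X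

/-- The constant `κ` such that the Killing form of the subalgebra `𝔩` equals `κ B|_𝔩`. -/
def kappa (𝔩 : LieSubalgebra ℝ V) : ℝ :=
  Classical.epsilon fun c : ℝ =>
    ∀ X Y : 𝔩, killingForm ℝ 𝔩 X Y = c * killingForm ℝ V (X : V) (Y : V)

/-- `T = -T_𝔭 Q|_𝔭 + ∑ᵢ Tᵢ Q|_𝔨ᵢ`, where each `Q|_𝔲` is extended by zero to the remaining
summands of `𝔭 ⊕ 𝔨₁ ⊕ ⋯`. -/
structure IsDiagonalForm {𝔨 : LieSubalgebra ℝ V} (hC : IsCartanDecomposition 𝔨) {m : ℕ}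
    (𝔣 : Fin m → LieSubalgebra ℝ V) (Tp : ℝ) (Tk : Fin m → ℝ)
    (T : LinearMap.BilinForm ℝ V) : Prop where
  on_p : ∀ X ∈ killingCompl 𝔨, ∀ Y ∈ killingCompl 𝔨, T X Y = -Tp * hC.Q X Y
  on_k : ∀ i, ∀ X ∈ 𝔣 i, ∀ Y ∈ 𝔣 i, T X Y = Tk i * hC.Q X Y
  p_k : ∀ X ∈ killingCompl 𝔨, ∀ i, ∀ Y ∈ 𝔣 i, T X Y = 0 ∧ T Y X = 0
  k_k : ∀ i j, i ≠ j → ∀ X ∈ 𝔣 i, ∀ Y ∈ 𝔣 j, T X Y = 0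

end Cartan

/-! ### Lie groups and naturally reductive metrics -/

section Group

instance instLEInftyMinSmoothness : ENat.LEInfty (minSmoothness ℝ 3) :=
  ⟨by rw [minSmoothness_of_isRCLikeNormedField]; exact ENat.LEInfty.out⟩

variable {E : Type*} [NormedAddCommGroup E] [NormedSpace ℝ E]
  {G : Type*} [TopologicalSpace G] [ChartedSpace E G] [Group G]

instance instFiniteDimensionalGroupLieAlgebra [FiniteDimensional ℝ E] :
    FiniteDimensional ℝ (GroupLieAlgebra 𝓘(ℝ, E) G) :=
  inferInstanceAs (FiniteDimensional ℝ E)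

/-- The adjoint action of `x` on the Lie algebra: the derivative at `1` of `y ↦ x y x⁻¹`. -/
def Ad (x : G) : GroupLieAlgebra 𝓘(ℝ, E) G →L[ℝ] GroupLieAlgebra 𝓘(ℝ, E) G :=
  (mfderiv 𝓘(ℝ, E) 𝓘(ℝ, E) (fun y : G => x * y * x⁻¹) 1 : _)

/-- `X` is the velocity at `0` of a smooth one-parameter subgroup of `G` contained in `K`. -/
def IsTangentTo (K : Subgroup G) (X : GroupLieAlgebra 𝓘(ℝ, E) G) : Prop :=
  ∃ γ : ℝ → G, ContMDiff 𝓘(ℝ, ℝ) 𝓘(ℝ, E) ∞ γ ∧ (∀ a b, γ (a + b) = γ a * γ b) ∧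
    (∀ a, γ a ∈ K) ∧ (mfderiv 𝓘(ℝ, ℝ) 𝓘(ℝ, E) γ 0 (1 : ℝ) : E) = X

variable [FiniteDimensional ℝ E] [CompleteSpace E] [LieGroup 𝓘(ℝ, E) ∞ G]

/-- `𝔨` is the Lie algebra of the closed subgroup `K`. -/
def IsLieAlgebraOf (K : Subgroup G) (𝔨 : LieSubalgebra ℝ (GroupLieAlgebra 𝓘(ℝ, E) G)) : Prop :=
  ∀ X, X ∈ 𝔨 ↔ IsTangentTo K X

/-- The Lie algebra `𝔤 × 𝔨` of `G × K`, inside `𝔤 × 𝔤`. -/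
def prodAlgebra (𝔨 : LieSubalgebra ℝ (GroupLieAlgebra 𝓘(ℝ, E) G)) :
    Submodule ℝ (GroupLieAlgebra 𝓘(ℝ, E) G × GroupLieAlgebra 𝓘(ℝ, E) G) :=
  (⊤ : Submodule ℝ (GroupLieAlgebra 𝓘(ℝ, E) G)).prod 𝔨.toSubmodule

/-- The Lie algebra `{(X, X) | X ∈ 𝔨}` of the isotropy group `{(k, k) | k ∈ K}`, at the identity,
of the action `(x, k) y = x y k⁻¹` of `G × K` on `G`. -/
def isotropyAlgebra (𝔨 : LieSubalgebra ℝ (GroupLieAlgebra 𝓘(ℝ, E) G)) :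
    Submodule ℝ (GroupLieAlgebra 𝓘(ℝ, E) G × GroupLieAlgebra 𝓘(ℝ, E) G) :=
  𝔨.toSubmodule.map (LinearMap.prod LinearMap.id LinearMap.id)

/-- The left-invariant metric `g` is naturally reductive with respect to `G × K`, acting on `G` by
`(x, k) y = x y k⁻¹`, and the decomposition `𝔤 × 𝔨 = Δ𝔨 ⊕ 𝔪`. A vector `u ∈ 𝔪` is identified with
the tangent vector `u.1 - u.2` at the identity, its image under the derivative of
`(x, k) ↦ x k⁻¹`. -/
structure IsNaturallyReductiveFor (K : Subgroup G)
    (𝔨 : LieSubalgebra ℝ (GroupLieAlgebra 𝓘(ℝ, E) G))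
    (𝔪 : Submodule ℝ (GroupLieAlgebra 𝓘(ℝ, E) G × GroupLieAlgebra 𝓘(ℝ, E) G))
    (g : Metric (GroupLieAlgebra 𝓘(ℝ, E) G)) : Prop where
  /-- `G × K` acts by isometries. As `g` is left-invariant, this says that right translations by
  elements of `K` are isometries. -/
  isometric : ∀ k ∈ K, ∀ X Y, g.form (Ad k X) (Ad k Y) = g.form X Y
  disjoint : isotropyAlgebra 𝔨 ⊓ 𝔪 = ⊥
  codisjoint : isotropyAlgebra 𝔨 ⊔ 𝔪 = prodAlgebra 𝔨
  /-- `𝔪` is invariant under the adjoint action of the isotropy group. -/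
  invariant : ∀ k ∈ K, ∀ u ∈ 𝔪, (Ad k u.1, Ad k u.2) ∈ 𝔪
  /-- `⟨[u, v]_𝔪, w⟩ + ⟨v, [u, w]_𝔪⟩ = 0`, where `a` and `b` are the `𝔪`-components of `[u, v]`
  and `[u, w]`. -/
  reductive : ∀ u ∈ 𝔪, ∀ v ∈ 𝔪, ∀ w ∈ 𝔪, ∀ a ∈ 𝔪, ∀ b ∈ 𝔪,
    ⁅u, v⁆ - a ∈ isotropyAlgebra 𝔨 → ⁅u, w⁆ - b ∈ isotropyAlgebra 𝔨 →
    g.form (a.1 - a.2) (w.1 - w.2) + g.form (v.1 - v.2) (b.1 - b.2) = 0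

/-- The set `M_K` of left-invariant metrics on `G` that are naturally reductive with respect to
`G × K` and some decomposition of the Lie algebra of `G × K`. -/
def naturallyReductiveMetrics (K : Subgroup G)
    (𝔨 : LieSubalgebra ℝ (GroupLieAlgebra 𝓘(ℝ, E) G)) :
    Set (Metric (GroupLieAlgebra 𝓘(ℝ, E) G)) :=
  {g | ∃ 𝔪, IsNaturallyReductiveFor K 𝔨 𝔪 g}

end Group

end

end NatRed

set_option linter.unusedSectionVars false

/-! A metric in `M_K` is invariant under `Ad K`, hence under `ad 𝔨`, and Schur's lemma then nearly
determines it. Simplicity of `𝔤` makes `𝔭` an irreducible `𝔨`-module (`irreducible_p`) and the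
centre of `𝔨` at most one-dimensional (`exists_smul_of_isCentral`), and an invariant form makes
different summands of `𝔨` orthogonal. So the metric is `β B` on `𝔭` and `-αᵢ B` on `𝔨ᵢ`, up to a
possible mixed term between `𝔨` and `𝔭`. A nonzero mixed term is an intertwiner `𝔨 → 𝔭`; it must be
an isomorphism, `𝔤` is then the complexification of `𝔨`, and the Ricci curvature has a nonzero mixed
part, which `T` excludes (`orthogonal_of_ricci`).

Since `𝔤` is unimodular, `Ric(Y, Z) = -tr(∇Y ∘ ∇Z)`, where `∇Y` is `X ↦ ∇_X Y`. For a diagonal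
metric this yields `(κᵢ + (αᵢ/β)²(1 - κᵢ))/4 · Q` on `𝔨ᵢ` and `-(1/n) ∑ᵢ (1 + αᵢ/2β) dᵢ (1 - κᵢ) ·
Q` on `𝔭`, with no cross terms (`ricci_eq_iff`). As `κᵢ < 1`, the equation on `𝔨ᵢ` has a positive
solution `αᵢ/β` exactly when `4Tᵢ > κᵢ`, and the solution is unique; on the centre `κ = 0` and the
inequality is automatic. Substituting the ratios into the equation on `𝔭` gives the formula for
`T_𝔭`. The ratios determine the metric up to scaling.

For existence the diagonal metric with `β = 1` must lie in `M_K`. The complement `𝔪` is orthogonal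
to `Δ𝔨` for a bi-invariant form on `𝔤 × 𝔨`, and this form restricts to the metric on `𝔪`
(`metric_skew`, `isNaturallyReductiveFor`). It also has to be known that `Ad K` preserves each
simple ideal, without assuming `K` connected (`IsIdealList.Ad_mem`). For every `x ∈ G` the
orthogonal polar factor of `Ad x` is an automorphism preserving `𝔨`, so it permutes the simple
ideals. It cannot jump between permutations along the connected group `G`, it is the identity at
`1`, and for `k ∈ K` it is `Ad k` itself. -/

namespace NatRed

/-! ### The adjoint action by Lie algebra automorphisms -/

section AdjointAction

open VectorField

variable {E : Type*} [NormedAddCommGroup E] [NormedSpace ℝ E]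

section Derivative

variable {M : Type*} [TopologicalSpace M] [ChartedSpace E M]

/-- The derivative of a self-map of a manifold, as an endomorphism of the model space. -/
noncomputable def dE (f : M → M) (x : M) : E →L[ℝ] E := mfderiv 𝓘(ℝ, E) 𝓘(ℝ, E) f x

theorem dE_id (x : M) : dE (E := E) (fun y : M => y) x = ContinuousLinearMap.id ℝ E :=
  mfderiv_id

theorem dE_comp {f g : M → M} {x : M} (hf : MDifferentiableAt 𝓘(ℝ, E) 𝓘(ℝ, E) f (g x))
    (hg : MDifferentiableAt 𝓘(ℝ, E) 𝓘(ℝ, E) g x) :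
    dE (E := E) (fun y => f (g y)) x = (dE f (g x)).comp (dE g x) :=
  mfderiv_comp x hf hg

end Derivative

variable {G : Type*} [TopologicalSpace G] [ChartedSpace E G] [Group G]

/-- The adjoint action as an endomorphism of the model space. -/
noncomputable def adE (x : G) : E →L[ℝ] E := dE (fun y : G => x * y * x⁻¹) 1

theorem adE_one : adE (E := E) (1 : G) = ContinuousLinearMap.id ℝ _ := by
  have : (fun y : G => 1 * y * 1⁻¹) = fun y => y := by ext; simp
  rw [adE, this, dE_id]

variable [LieGroup 𝓘(ℝ, E) ∞ G]

theorem contMDiff_conj (x : G) :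
    ContMDiff 𝓘(ℝ, E) 𝓘(ℝ, E) ∞ (fun y : G => x * y * x⁻¹) :=
  (contMDiff_const.mul contMDiff_id).mul contMDiff_const

theorem mdifferentiableAt_conj (x y : G) :
    MDifferentiableAt 𝓘(ℝ, E) 𝓘(ℝ, E) (fun y : G => x * y * x⁻¹) y :=
  (contMDiff_conj x).mdifferentiable (by simp) y

theorem mdifferentiableAt_left (x y : G) :
    MDifferentiableAt 𝓘(ℝ, E) 𝓘(ℝ, E) (fun y : G => x * y) y :=
  (contMDiff_mul_left (n := ∞)).mdifferentiable (by simp) y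

theorem adE_mul (x y : G) : adE (E := E) (x * y) = (adE x).comp (adE y) := by
  have h : (fun z : G => (x * y) * z * (x * y)⁻¹) = fun z : G => x * (y * z * y⁻¹) * x⁻¹ := by
    ext z; simp [mul_assoc]
  have h1 : y * 1 * y⁻¹ = 1 := by simp
  rw [adE, h, dE_comp (f := fun y : G => x * y * x⁻¹) (mdifferentiableAt_conj _ _)
    (mdifferentiableAt_conj _ _), h1]
  rfl

theorem adE_adE_inv (x : G) (v : E) : adE x (adE x⁻¹ v) = v := by
  rw [← ContinuousLinearMap.comp_apply, ← adE_mul, mul_inv_cancel, adE_one]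
  rfl

/-- Joint smoothness of `(x, y) ↦ x y x⁻¹` makes the derivative in `y` smooth in `x` once it is read
in tangent coordinates. All conjugations fix `1`, so these coordinate changes are identities. -/
theorem contMDiff_adE : ContMDiff 𝓘(ℝ, E) 𝓘(ℝ, E →L[ℝ] E) 1 (adE : G → E →L[ℝ] E) := by
  intro x₀
  have hf : ContMDiffAt (𝓘(ℝ, E).prod 𝓘(ℝ, E)) 𝓘(ℝ, E) ∞
      (Function.uncurry fun x y : G => x * y * x⁻¹) (x₀, 1) :=
    ((contMDiff_fst.mul contMDiff_snd).mul contMDiff_fst.inv).contMDiffAt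
  have : IsManifold 𝓘(ℝ, E) ∞ G := inferInstance
  have key := ContMDiffAt.mfderiv (I := 𝓘(ℝ, E)) (I' := 𝓘(ℝ, E)) (m := 1)
    (fun x y : G => x * y * x⁻¹) (fun _ => 1) hf contMDiffAt_const (by norm_cast)
  refine key.congr_of_eventuallyEq (Filter.Eventually.of_forall fun x => ?_)
  refine Eq.trans ?_ (inTangentCoordinates_eq (I := 𝓘(ℝ, E)) (I' := 𝓘(ℝ, E)) (fun _ : G => (1 : G))
    (fun x : G => x * 1 * x⁻¹) (fun x => adE (E := E) x) (x₀ := x₀) (x := x) (by simp)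
    (by simp)).symm
  ext v
  simp only [ContinuousLinearMap.comp_apply]
  have h1 : x * 1 * x⁻¹ = 1 := by simp
  have h2 : x₀ * 1 * x₀⁻¹ = 1 := by simp
  simp only [h1, h2]
  rw [(tangentBundleCore 𝓘(ℝ, E) G).coordChange_self _ _ (by simp),
    (tangentBundleCore 𝓘(ℝ, E) G).coordChange_self _ _ (by simp)]

theorem continuous_adE : Continuous (adE : G → E →L[ℝ] E) := contMDiff_adE.continuous

theorem inverse_dE_conj (x y : G) :
    (dE (E := E) (fun y : G => x * y * x⁻¹) y).inverse
      = dE (fun y : G => x⁻¹ * y * x⁻¹⁻¹) (x * y * x⁻¹) := by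
  have h1 := dE_comp (f := fun y => x⁻¹ * y * x⁻¹⁻¹) (g := fun y => x * y * x⁻¹)
    (mdifferentiableAt_conj (E := E) x⁻¹ (x * y * x⁻¹)) (mdifferentiableAt_conj (E := E) x y)
  have h2 := dE_comp (f := fun y => x * y * x⁻¹) (g := fun y => x⁻¹ * y * x⁻¹⁻¹)
    (mdifferentiableAt_conj (E := E) x (x⁻¹ * (x * y * x⁻¹) * x⁻¹⁻¹))
    (mdifferentiableAt_conj (E := E) x⁻¹ (x * y * x⁻¹))
  have e1 : (fun y : G => x⁻¹ * (x * y * x⁻¹) * x⁻¹⁻¹) = fun y => y := by ext; simp [mul_assoc]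
  have e2 : (fun y : G => x * (x⁻¹ * y * x⁻¹⁻¹) * x⁻¹) = fun y => y := by ext; simp [mul_assoc]
  have e3 : x⁻¹ * (x * y * x⁻¹) * x⁻¹⁻¹ = y := by simp [mul_assoc]
  rw [e1, dE_id] at h1
  rw [e2, dE_id, e3] at h2
  exact ContinuousLinearMap.inverse_eq h2.symm h1.symm

/-- Conjugation by `x` intertwines left translation by `y` with left translation by `x y x⁻¹`;
differentiating at `1` gives the claim. -/
theorem mpullback_conj (x : G) (X : GroupLieAlgebra 𝓘(ℝ, E) G) :
    mpullback 𝓘(ℝ, E) 𝓘(ℝ, E) (fun y : G => x * y * x⁻¹) (mulInvariantVectorField (Ad x X))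
      = mulInvariantVectorField X := by
  ext y
  have h : (fun z : G => y * z) = (fun z : G => x⁻¹ * (x * y * x⁻¹ * (x * z * x⁻¹)) * x⁻¹⁻¹) := by
    ext z; simp [mul_assoc]
  have h1 : x * 1 * x⁻¹ = 1 := by simp
  have h2 := dE_comp (E := E) (x := (1 : G)) (f := fun y => x⁻¹ * y * x⁻¹⁻¹)
    (g := fun z : G => x * y * x⁻¹ * (x * z * x⁻¹))
    (mdifferentiableAt_conj _ _) ((mdifferentiableAt_left _ _).comp _ (mdifferentiableAt_conj _ _))
  have h3 := dE_comp (E := E) (x := (1 : G)) (f := fun z : G => x * y * x⁻¹ * z)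
    (g := fun z => x * z * x⁻¹) (mdifferentiableAt_left _ _) (mdifferentiableAt_conj _ _)
  rw [← h, h3, h1, mul_one] at h2
  have h4 := inverse_dE_conj (E := E) x y
  rw [← h4] at h2
  exact (DFunLike.congr_fun h2 X).symm

variable [CompleteSpace E]

/-- Naturality of the bracket of vector fields under pullback by a conjugation, applied to
left-invariant fields and evaluated at `1`. -/
theorem Ad_lie (x : G) (X Y : GroupLieAlgebra 𝓘(ℝ, E) G) : Ad x ⁅X, Y⁆ = ⁅Ad x X, Ad x Y⁆ := by
  have h := mpullback_mlieBracket (I := 𝓘(ℝ, E)) (I' := 𝓘(ℝ, E)) (x₀ := (1 : G)) (n := 3)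
    (f := fun y : G => x * y * x⁻¹)
    (V := mulInvariantVectorField (Ad x X)) (W := mulInvariantVectorField (Ad x Y))
    (mdifferentiableAt_mulInvariantVectorField _) (mdifferentiableAt_mulInvariantVectorField _)
    ((contMDiff_conj x).of_le (by norm_cast)).contMDiffAt
    (by rw [minSmoothness_of_isRCLikeNormedField]; norm_num)
  rw [mpullback_conj, mpullback_conj] at h
  have h4 := inverse_dE_conj (E := E) x (1 : G)
  have h1 : x * 1 * x⁻¹ = 1 := by simp
  let F : G → E := mlieBracket 𝓘(ℝ, E) (mulInvariantVectorField (Ad x X))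
    (mulInvariantVectorField (Ad x Y))
  -- The points `x * 1 * x⁻¹` and `1` are equal but not definitionally so; quantifying over `z`
  -- allows the equality to be substituted.
  have h5 : ∀ z, z = (1 : G) → adE x⁻¹ (F 1) = dE (fun y : G => x⁻¹ * y * x⁻¹⁻¹) z (F z) := by
    rintro z rfl; rfl
  have h6 : dE (fun y : G => x⁻¹ * y * x⁻¹⁻¹) (x * 1 * x⁻¹) (F (x * 1 * x⁻¹))
      = (⁅X, Y⁆ : GroupLieAlgebra 𝓘(ℝ, E) G) :=
    (DFunLike.congr_fun h4 _).symm.trans h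
  exact (congrArg (adE (E := E) x) (h6.symm.trans (h5 _ h1).symm)).trans (adE_adE_inv x (F 1))

end AdjointAction
-- The derivative of `Ad` is `ad`
section AdjointDerivative

open VectorField Filter Topology

variable {E : Type*} [NormedAddCommGroup E] [NormedSpace ℝ E]

/-- If `D₁m(a, u) ∘ A(u) = D₂m(u, a)` near `a` and `D₁m(a, a) = id`, `A(a) = id`, then the derivative
of `A` at `a` is the bracket of the vector fields `u ↦ D₂m(u, a) X`. -/
theorem fderiv_eq_lieBracket_of_local_mul {m : E × E → E} {a : E} {A : E → E →L[ℝ] E}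
    (hm : ContDiffAt ℝ 2 m (a, a)) (hA : DifferentiableAt ℝ A a)
    (hAa : A a = ContinuousLinearMap.id ℝ E) (hma : ∀ v, fderiv ℝ m (a, a) (v, 0) = v)
    (h : ∀ Y, ∀ᶠ u in 𝓝 a, fderiv ℝ m (a, u) (A u Y, 0) = fderiv ℝ m (u, a) (0, Y)) (X Y : E) :
    fderiv ℝ A a X Y = fderiv ℝ (fun u => fderiv ℝ m (u, a) (0, Y)) a X
      - fderiv ℝ (fun u => fderiv ℝ m (u, a) (0, X)) a Y := by
  -- Differentiating `h` along `X` gives `D²m((0,X),(Y,0)) + A'(X)Y = D²m((X,0),(0,Y))`. By symmetry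
  -- of `D²m` the first term is the derivative of `u ↦ D₂m(u,a)X` along `Y`.
  have hsymm := hm.isSymmSndFDerivAt (by simp)
  have hd : DifferentiableAt ℝ (fderiv ℝ m) (a, a) :=
    (hm.fderiv_right (m := 1) (by norm_num)).differentiableAt (by simp)
  have hleft : HasFDerivAt (fun u : E => (u, a)) (ContinuousLinearMap.inl ℝ E E) a :=
    hasFDerivAt_prodMk_left a a
  have hright : HasFDerivAt (fun u : E => (a, u)) (ContinuousLinearMap.inr ℝ E E) a :=
    hasFDerivAt_prodMk_right a a
  have h1 : ∀ Y, HasFDerivAt (fun u => fderiv ℝ m (u, a) (0, Y)) _ a := fun Y =>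
    (HasFDerivAt.comp a (f := fun u : E => (u, a)) hd.hasFDerivAt hleft).clm_apply
      (hasFDerivAt_const ((0 : E), Y) a)
  have hAY : HasFDerivAt (fun u => A u Y) _ a := hA.hasFDerivAt.clm_apply (hasFDerivAt_const Y a)
  have h2 : HasFDerivAt (fun u => fderiv ℝ m (a, u) (A u Y, 0)) _ a :=
    (HasFDerivAt.comp a (f := fun u : E => (a, u)) hd.hasFDerivAt hright).clm_apply
      (hAY.prodMk (hasFDerivAt_const (0 : E) a))
  have h3 := (h2.congr_of_eventuallyEq (EventuallyEq.symm (h Y))).unique (h1 Y)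
  have h4 := DFunLike.congr_fun h3 X
  simp [hAa, hma] at h4
  rw [(h1 Y).fderiv, (h1 X).fderiv]
  simp
  rw [← h4, hsymm (Y, 0) (0, X)]
  simp

variable {G : Type*} [TopologicalSpace G] [ChartedSpace E G] [Group G]

/-- The multiplication of `G` in the chart at the identity. -/
noncomputable def chartMul (G : Type*) [TopologicalSpace G] [ChartedSpace E G] [Group G] :
    E × E → E := fun u =>
  extChartAt 𝓘(ℝ, E) (1 : G) ((extChartAt 𝓘(ℝ, E) (1 : G)).symm u.1 *
    (extChartAt 𝓘(ℝ, E) (1 : G)).symm u.2)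

/-- The identity in the chart at the identity. -/
noncomputable def chartOne (E : Type*) [NormedAddCommGroup E] [NormedSpace ℝ E]
    (G : Type*) [TopologicalSpace G] [ChartedSpace E G] [Group G] : E :=
  extChartAt 𝓘(ℝ, E) (1 : G) 1

/-- The inverse of the chart at the identity. -/
noncomputable def chartInv (E : Type*) [NormedAddCommGroup E] [NormedSpace ℝ E]
    (G : Type*) [TopologicalSpace G] [ChartedSpace E G] [Group G] : E → G :=
  (extChartAt 𝓘(ℝ, E) (1 : G)).symm

theorem chartInv_one : chartInv E G (chartOne E G) = 1 := extChartAt_to_inv (I := 𝓘(ℝ, E)) (1 : G)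

theorem eventually_mem_target :
    ∀ᶠ u in 𝓝 (chartOne E G), u ∈ (extChartAt 𝓘(ℝ, E) (1 : G)).target :=
  extChartAt_target_mem_nhds (I := 𝓘(ℝ, E)) (1 : G)

theorem mem_source_of_target {u : E} (hu : u ∈ (extChartAt 𝓘(ℝ, E) (1 : G)).target) :
    chartInv E G u ∈ (chartAt E (1 : G)).source := by
  rw [← extChartAt_source 𝓘(ℝ, E)]
  exact (extChartAt 𝓘(ℝ, E) (1 : G)).map_target hu

variable [LieGroup 𝓘(ℝ, E) ∞ G]

theorem contMDiffAt_chartInv :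
    ContMDiffAt 𝓘(ℝ, E) 𝓘(ℝ, E) ∞ (chartInv E G) (chartOne E G) := by
  have := contMDiffWithinAt_extChartAt_symm_range (I := 𝓘(ℝ, E)) (n := ∞) (1 : G)
    (mem_extChartAt_target (I := 𝓘(ℝ, E)) (1 : G))
  rw [ModelWithCorners.range_eq_univ] at this
  exact this

theorem contDiffAt_chartMul :
    ContDiffAt ℝ ∞ (chartMul (E := E) G) (chartOne E G, chartOne E G) := by
  rw [← contMDiffAt_iff_contDiffAt]
  have h1 : ContMDiffAt 𝓘(ℝ, E × E) 𝓘(ℝ, E) ∞ (fun u : E × E => chartInv E G u.1 * chartInv E G u.2)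
      (chartOne E G, chartOne E G) := by
    refine ContMDiffAt.mul ?_ ?_
    · exact ContMDiffAt.comp (I' := 𝓘(ℝ, E)) (g := chartInv E G) (f := Prod.fst) _
        contMDiffAt_chartInv (contDiff_fst.contMDiff.contMDiffAt)
    · exact ContMDiffAt.comp (I' := 𝓘(ℝ, E)) (g := chartInv E G) (f := Prod.snd) _
        contMDiffAt_chartInv (contDiff_snd.contMDiff.contMDiffAt)
  refine ContMDiffAt.comp (I' := 𝓘(ℝ, E)) (g := extChartAt 𝓘(ℝ, E) (1 : G)) _ ?_ h1
  have h2 : chartInv E G (chartOne E G) * chartInv E G (chartOne E G) = 1 := by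
    rw [chartInv_one, mul_one]
  have h3 : ∀ z, z = (1 : G) → ContMDiffAt 𝓘(ℝ, E) 𝓘(ℝ, E) ∞ (extChartAt 𝓘(ℝ, E) (1 : G)) z := by
    rintro z rfl
    exact contMDiffAt_extChartAt
  exact h3 _ h2

/-- The derivative of the chart at the identity, as an endomorphism of the model space. -/
noncomputable def dChart (E : Type*) [NormedAddCommGroup E] [NormedSpace ℝ E]
    {G : Type*} [TopologicalSpace G] [ChartedSpace E G] [Group G] (x : G) : E →L[ℝ] E :=
  mfderiv 𝓘(ℝ, E) 𝓘(ℝ, E) (extChartAt 𝓘(ℝ, E) (1 : G)) x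

theorem dChart_one : dChart E (1 : G) = ContinuousLinearMap.id ℝ E :=
  mfderiv_extChartAt_self (I := 𝓘(ℝ, E)) (x := (1 : G))

theorem mpullbackWithin_chart {u : E} (hu : u ∈ (extChartAt 𝓘(ℝ, E) (1 : G)).target)
    (V : ∀ x : G, TangentSpace 𝓘(ℝ, E) x) :
    (mpullbackWithin 𝓘(ℝ, E) 𝓘(ℝ, E) (extChartAt 𝓘(ℝ, E) (1 : G)).symm V
      (Set.range 𝓘(ℝ, E)) u : E) = dChart E (chartInv E G u) (V (chartInv E G u) : _) := by
  have h := ContinuousLinearMap.inverse_eq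
    (mfderivWithin_extChartAt_symm_comp_mfderiv_extChartAt (I := 𝓘(ℝ, E)) hu)
    (mfderiv_extChartAt_comp_mfderivWithin_extChartAt_symm (I := 𝓘(ℝ, E)) hu)
  exact DFunLike.congr_fun h _

theorem dChart_comp_dE {f : G → G} {F : E → E} (hf : MDifferentiableAt 𝓘(ℝ, E) 𝓘(ℝ, E) f 1)
    (hx : f 1 ∈ (chartAt E (1 : G)).source)
    (hF : ∀ v, F v = extChartAt 𝓘(ℝ, E) (1 : G) (f (chartInv E G v))) (Y : E) :
    dChart E (f 1) (dE f 1 Y) = fderiv ℝ F (chartOne E G) Y := by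
  have h1 := mdifferentiableAt_extChartAt (I := 𝓘(ℝ, E)) hx
  have h2 := mfderiv_comp (1 : G) h1 hf
  have h3 := (h1.comp (1 : G) hf).mfderiv
  rw [ModelWithCorners.range_eq_univ, fderivWithin_univ] at h3
  have h4 : F = writtenInExtChartAt 𝓘(ℝ, E) 𝓘(ℝ, E) (1 : G) (extChartAt 𝓘(ℝ, E) (1 : G) ∘ f) := by
    ext v
    rw [hF]
    rfl
  rw [h4]
  exact DFunLike.congr_fun (h2.symm.trans h3) Y

theorem dChart_left {u : E} (hu : u ∈ (extChartAt 𝓘(ℝ, E) (1 : G)).target)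
    (hm : DifferentiableAt ℝ (chartMul (E := E) G) (u, chartOne E G)) (Y : E) :
    dChart E (chartInv E G u) (dE (fun z : G => chartInv E G u * z) 1 Y)
      = fderiv ℝ (chartMul (E := E) G) (u, chartOne E G) (0, Y) := by
  have h := dChart_comp_dE (E := E) (f := fun z : G => chartInv E G u * z)
    (F := fun v => chartMul G (u, v)) (mdifferentiableAt_left _ _)
    (by rw [mul_one]; exact mem_source_of_target hu) (fun v => rfl) Y
  rw [mul_one] at h
  rw [h]
  have h1 : HasFDerivAt (fun v => chartMul (E := E) G (u, v)) _ (chartOne E G) :=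
    hm.hasFDerivAt.comp (chartOne E G) (hasFDerivAt_prodMk_right u (chartOne E G))
  rw [h1.fderiv]
  simp

theorem mdifferentiableAt_right (x y : G) :
    MDifferentiableAt 𝓘(ℝ, E) 𝓘(ℝ, E) (fun y : G => y * x) y :=
  (contMDiff_mul_right (n := ∞)).mdifferentiable (by simp) y

theorem dChart_right {u : E} (hu : u ∈ (extChartAt 𝓘(ℝ, E) (1 : G)).target)
    (hm : DifferentiableAt ℝ (chartMul (E := E) G) (chartOne E G, u)) (Y : E) :
    dChart E (chartInv E G u) (dE (fun z : G => z * chartInv E G u) 1 Y)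
      = fderiv ℝ (chartMul (E := E) G) (chartOne E G, u) (Y, 0) := by
  have h := dChart_comp_dE (E := E) (f := fun z : G => z * chartInv E G u)
    (F := fun v => chartMul G (v, u)) (mdifferentiableAt_right _ _)
    (by rw [one_mul]; exact mem_source_of_target hu) (fun v => rfl) Y
  rw [one_mul] at h
  rw [h]
  have h1 : HasFDerivAt (fun v => chartMul (E := E) G (v, u)) _ (chartOne E G) :=
    HasFDerivAt.comp (chartOne E G) (g := chartMul (E := E) G) (f := fun v => (v, u))
      hm.hasFDerivAt (hasFDerivAt_prodMk_left (chartOne E G) u)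
  rw [h1.fderiv]
  simp

/-- Conjugation by `x` followed by right translation by `x` is left translation. In the chart this
is the relation `D₁m(e,u) ∘ Ad = D₂m(u,e)` required by `fderiv_eq_lieBracket_of_local_mul`. -/
theorem dE_right_adE (x : G) (Y : E) :
    dE (fun z : G => z * x) 1 (adE x Y) = dE (E := E) (fun z : G => x * z) 1 Y := by
  have h := dE_comp (E := E) (x := (1 : G)) (f := fun z : G => z * x)
    (g := fun z => x * z * x⁻¹) (mdifferentiableAt_right _ _) (mdifferentiableAt_conj _ _)
  have h1 : (fun z : G => x * z * x⁻¹ * x) = fun z => x * z := by ext; simp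
  have h2 : x * 1 * x⁻¹ = 1 := by simp
  rw [h1, h2] at h
  rw [h]
  rfl

theorem eventually_differentiableAt_chartMul :
    (∀ᶠ u in 𝓝 (chartOne E G), DifferentiableAt ℝ (chartMul (E := E) G) (u, chartOne E G)) ∧
    (∀ᶠ u in 𝓝 (chartOne E G), DifferentiableAt ℝ (chartMul (E := E) G) (chartOne E G, u)) := by
  have h := (contDiffAt_chartMul (E := E) (G := G)).of_le (m := 1) (by norm_cast)
  have h1 := h.eventually (by simp)
  have h2 := h1.mono fun u hu => hu.differentiableAt (by simp)
  exact ⟨(Continuous.prodMk_left (chartOne E G)).continuousAt.eventually h2,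
    (Continuous.prodMk_right (chartOne E G)).continuousAt.eventually h2⟩

theorem differentiableAt_adE_chartInv :
    DifferentiableAt ℝ (fun u => adE (E := E) (chartInv E G u)) (chartOne E G) := by
  have h := ContMDiffAt.comp (I' := 𝓘(ℝ, E)) (n := 1) (g := (adE : G → E →L[ℝ] E))
    (f := chartInv E G) (chartOne E G) (contMDiff_adE.contMDiffAt)
    (contMDiffAt_chartInv.of_le (by norm_cast))
  rw [contMDiffAt_iff_contDiffAt] at h
  exact h.differentiableAt (by simp)

theorem hasDerivAt_chart_comp {γ : ℝ → G} {X : E}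
    (hγ : ContMDiff 𝓘(ℝ, ℝ) 𝓘(ℝ, E) ∞ γ) (h0 : γ 0 = 1)
    (hX : (mfderiv 𝓘(ℝ, ℝ) 𝓘(ℝ, E) γ 0 (1 : ℝ) : E) = X) :
    HasDerivAt (fun t => extChartAt 𝓘(ℝ, E) (1 : G) (γ t)) X 0 := by
  have h1 : MDifferentiableAt 𝓘(ℝ, ℝ) 𝓘(ℝ, E) γ 0 := hγ.mdifferentiable (by simp) 0
  have h2 : MDifferentiableAt 𝓘(ℝ, E) 𝓘(ℝ, E) (extChartAt 𝓘(ℝ, E) (1 : G)) (γ 0) :=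
    mdifferentiableAt_extChartAt (by rw [h0]; exact mem_chart_source E (1 : G))
  have h3 := mfderiv_comp_apply (0 : ℝ) h2 h1 (1 : ℝ)
  have h4 := (h2.comp (0 : ℝ) h1).differentiableAt.hasDerivAt
  have h5 : dChart E (γ 0) = ContinuousLinearMap.id ℝ E := by rw [h0, dChart_one]
  rw [mfderiv_eq_fderiv] at h3
  have h6 : deriv (extChartAt 𝓘(ℝ, E) (1 : G) ∘ γ) 0 = X :=
    (fderiv_apply_one_eq_deriv).symm.trans (h3.trans ((DFunLike.congr_fun h5 _).trans hX))
  rw [h6] at h4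
  exact h4

theorem hasDerivAt_adE {γ : ℝ → G} {X : E}
    (hγ : ContMDiff 𝓘(ℝ, ℝ) 𝓘(ℝ, E) ∞ γ) (h0 : γ 0 = 1)
    (hX : (mfderiv 𝓘(ℝ, ℝ) 𝓘(ℝ, E) γ 0 (1 : ℝ) : E) = X) (Y : E) :
    HasDerivAt (fun t => adE (E := E) (γ t) Y)
      (fderiv ℝ (fun u => adE (E := E) (chartInv E G u)) (chartOne E G) X Y) 0 := by
  have h1 := hasDerivAt_chart_comp hγ h0 hX
  have h2 := (differentiableAt_adE_chartInv (E := E) (G := G)).hasFDerivAt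
  have h3 : HasDerivAt (fun t => adE (E := E) (chartInv E G (extChartAt 𝓘(ℝ, E) (1 : G) (γ t))))
      (fderiv ℝ (fun u => adE (E := E) (chartInv E G u)) (chartOne E G) X) 0 := by
    refine HasFDerivAt.comp_hasDerivAt (l := fun u => adE (E := E) (chartInv E G u)) 0 ?_ h1
    rw [h0]
    exact h2
  have h4 := h3.clm_apply (hasDerivAt_const (0 : ℝ) Y)
  rw [map_zero, add_zero] at h4
  refine h4.congr_of_eventuallyEq ?_
  have h5 : ∀ᶠ t in 𝓝 (0 : ℝ), γ t ∈ (extChartAt 𝓘(ℝ, E) (1 : G)).source := by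
    refine hγ.continuous.continuousAt.eventually ?_
    rw [h0]
    exact extChartAt_source_mem_nhds (I := 𝓘(ℝ, E)) (1 : G)
  filter_upwards [h5] with t ht
  have : chartInv E G (extChartAt 𝓘(ℝ, E) (1 : G) (γ t)) = γ t :=
    (extChartAt 𝓘(ℝ, E) (1 : G)).left_inv ht
  rw [this]

/-- In the chart at `1` the left-invariant field of `Y` is `u ↦ D₂m(u,e)Y`. The chart has identity
derivative at `1`, so the bracket on the group is the flat bracket of these coordinate fields. -/
theorem lie_eq_fderiv_chartMul (X Y : GroupLieAlgebra 𝓘(ℝ, E) G) :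
    (⁅X, Y⁆ : GroupLieAlgebra 𝓘(ℝ, E) G)
      = (fderiv ℝ (fun u => fderiv ℝ (chartMul (E := E) G) (u, chartOne E G) (0, (Y : E)))
          (chartOne E G) (X : E)
        - fderiv ℝ (fun u => fderiv ℝ (chartMul (E := E) G) (u, chartOne E G) (0, (X : E)))
          (chartOne E G) (Y : E) : E) := by
  have hev : ∀ Y : GroupLieAlgebra 𝓘(ℝ, E) G,
      (mpullbackWithin 𝓘(ℝ, E) 𝓘(ℝ, E) (extChartAt 𝓘(ℝ, E) (1 : G)).symm
        (mulInvariantVectorField Y) (Set.range 𝓘(ℝ, E)) : E → E) =ᶠ[𝓝 (chartOne E G)]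
      fun u => fderiv ℝ (chartMul (E := E) G) (u, chartOne E G) (0, (Y : E)) := by
    intro Y
    filter_upwards [eventually_mem_target (E := E) (G := G),
      (eventually_differentiableAt_chartMul (E := E) (G := G)).1] with u h1 h2
    exact (mpullbackWithin_chart h1 _).trans (dChart_left h1 h2 Y)
  have hval : ∀ Y : E,
      fderiv ℝ (chartMul (E := E) G) (chartOne E G, chartOne E G) (0, Y) = Y := by
    intro Y
    have h := dChart_left (E := E) (G := G) (eventually_mem_target (E := E) (G := G)).self_of_nhds
      (eventually_differentiableAt_chartMul (E := E) (G := G)).1.self_of_nhds Y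
    rw [chartInv_one, dChart_one] at h
    simp only [one_mul, dE_id] at h
    exact h.symm
  have h1 := mlieBracketWithin_apply (I := 𝓘(ℝ, E)) (V := mulInvariantVectorField X)
    (W := mulInvariantVectorField Y) (s := Set.univ) (x₀ := (1 : G))
  have h2 : (dChart E (1 : G)).inverse = ContinuousLinearMap.id ℝ E := by
    rw [dChart_one, ContinuousLinearMap.inverse_id]
  have h3 : (Set.range (𝓘(ℝ, E) : E → E)) = Set.univ := ModelWithCorners.range_eq_univ _
  have h5 : ∀ (V W : E → E) (s : Set E), s = Set.univ →
      lieBracketWithin ℝ V W s (chartOne E G) = lieBracket ℝ V W (chartOne E G) := by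
    rintro V W s rfl
    rw [lieBracketWithin_univ]
  refine h1.trans ((DFunLike.congr_fun h2 _).trans ((h5 _ _ _ (by simp)).trans ?_))
  refine ((hev X).lieBracket_vectorField_eq (𝕜 := ℝ) (hev Y)).trans ?_
  exact congrArg₂ (fun v w : E =>
    fderiv ℝ (fun u => fderiv ℝ (chartMul (E := E) G) (u, chartOne E G) (0, (Y : E)))
      (chartOne E G) v
    - fderiv ℝ (fun u => fderiv ℝ (chartMul (E := E) G) (u, chartOne E G) (0, (X : E)))
      (chartOne E G) w) (hval X) (hval Y)

theorem fderiv_adE_chartInv (X Y : GroupLieAlgebra 𝓘(ℝ, E) G) :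
    fderiv ℝ (fun u => adE (E := E) (chartInv E G u)) (chartOne E G) (X : E) (Y : E)
      = (⁅X, Y⁆ : GroupLieAlgebra 𝓘(ℝ, E) G) := by
  have h1 : ∀ v : E,
      fderiv ℝ (chartMul (E := E) G) (chartOne E G, chartOne E G) (v, 0) = v := by
    intro Y
    have h := dChart_right (E := E) (G := G) (eventually_mem_target (E := E) (G := G)).self_of_nhds
      (eventually_differentiableAt_chartMul (E := E) (G := G)).2.self_of_nhds Y
    rw [chartInv_one, dChart_one] at h
    simp only [mul_one, dE_id] at h
    exact h.symm
  refine (fderiv_eq_lieBracket_of_local_mul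
    (contDiffAt_chartMul.of_le (by norm_cast)) differentiableAt_adE_chartInv
    (by rw [chartInv_one, adE_one]) h1 (fun Y => ?_) _ _).trans (lie_eq_fderiv_chartMul X Y).symm
  filter_upwards [eventually_mem_target (E := E) (G := G),
    (eventually_differentiableAt_chartMul (E := E) (G := G)).1,
    (eventually_differentiableAt_chartMul (E := E) (G := G)).2] with u h2 h3 h4
  rw [← dChart_left h2 h3, ← dChart_right h2 h4, dE_right_adE]

/-- The derivative of the adjoint action along a curve through the identity with velocity `X` is
the bracket with `X`. -/
theorem hasDerivAt_Ad {γ : ℝ → G} {X : GroupLieAlgebra 𝓘(ℝ, E) G}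
    (hγ : ContMDiff 𝓘(ℝ, ℝ) 𝓘(ℝ, E) ∞ γ) (h0 : γ 0 = 1)
    (hX : (mfderiv 𝓘(ℝ, ℝ) 𝓘(ℝ, E) γ 0 (1 : ℝ) : E) = X) (Y : GroupLieAlgebra 𝓘(ℝ, E) G) :
    HasDerivAt (F := E) (fun t => adE (E := E) (γ t) (Y : E))
      (⁅X, Y⁆ : GroupLieAlgebra 𝓘(ℝ, E) G) 0 :=
  (hasDerivAt_adE hγ h0 hX Y).congr_deriv (fderiv_adE_chartInv X Y)

end AdjointDerivative
-- Subgroups and their one-parameter subgroups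
section ClosedSubgroup

open Filter Topology

theorem map_zero_of_map_add {G : Type*} [Group G] {γ : ℝ → G} (h : ∀ a b, γ (a + b) = γ a * γ b) :
    γ 0 = 1 := by
  have := h 0 0
  simpa using this

variable {E : Type*} [NormedAddCommGroup E] [NormedSpace ℝ E] [FiniteDimensional ℝ E]
  [CompleteSpace E]
  {G : Type*} [TopologicalSpace G] [ChartedSpace E G] [Group G] [LieGroup 𝓘(ℝ, E) ∞ G]

/-- The adjoint action as an automorphism of the Lie algebra. -/
noncomputable def AdEquiv (x : G) :
    GroupLieAlgebra 𝓘(ℝ, E) G ≃ₗ⁅ℝ⁆ GroupLieAlgebra 𝓘(ℝ, E) G where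
  toFun := Ad x
  map_add' := map_add _
  map_smul' := map_smul _
  map_lie' := Ad_lie x _ _
  invFun := Ad x⁻¹
  left_inv X := by
    have := adE_adE_inv (E := E) x⁻¹ X
    rw [inv_inv] at this
    exact this
  right_inv X := adE_adE_inv (E := E) x X

/-- Along a one-parameter group in `K` with velocity `X`, the function `t ↦ b(Ad γ(t) Y, Ad γ(t) Z)`
is constant; its derivative at `0` is the left-hand side. -/
theorem lie_invariant_of_Ad_invariant {K : Subgroup G}
    {b : LinearMap.BilinForm ℝ (GroupLieAlgebra 𝓘(ℝ, E) G)}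
    (hb : ∀ k ∈ K, ∀ X Y, b (Ad k X) (Ad k Y) = b X Y) {X : GroupLieAlgebra 𝓘(ℝ, E) G}
    (hX : IsTangentTo K X) (Y Z : GroupLieAlgebra 𝓘(ℝ, E) G) :
    b ⁅X, Y⁆ Z + b Y ⁅X, Z⁆ = 0 := by
  obtain ⟨γ, hγ, hadd, hK, hv⟩ := hX
  have h0 := map_zero_of_map_add hadd
  let bE : E →ₗ[ℝ] E →ₗ[ℝ] ℝ := b
  have h1 := hasDerivAt_Ad hγ h0 hv Y
  have h2 := hasDerivAt_Ad hγ h0 hv Z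
  let bC : E →L[ℝ] E →L[ℝ] ℝ := LinearMap.toContinuousBilinearMap bE
  have h3 := (bC.hasFDerivAt.comp_hasDerivAt (0 : ℝ) h1).clm_apply h2
  have h4 : (fun t => bC (adE (E := E) (γ t) (Y : E)) (adE (E := E) (γ t) (Z : E)))
      = fun _ => b Y Z := by
    ext t
    exact hb (γ t) (hK t) Y Z
  have h5 := h3.unique (h4 ▸ hasDerivAt_const (0 : ℝ) (b Y Z))
  have h6 : adE (E := E) (γ 0) = ContinuousLinearMap.id ℝ E := by rw [h0, adE_one]
  simp [h6] at h5
  exact h5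

theorem isTangentTo_Ad {K : Subgroup G} {k : G} (hk : k ∈ K) {X : GroupLieAlgebra 𝓘(ℝ, E) G}
    (hX : IsTangentTo K X) : IsTangentTo K (Ad k X) := by
  obtain ⟨γ, hγ, hadd, hK, hv⟩ := hX
  have h0 := map_zero_of_map_add hadd
  refine ⟨fun t => k * γ t * k⁻¹, (contMDiff_conj k).comp hγ, fun a b => by simp [hadd],
    fun a => K.mul_mem (K.mul_mem hk (hK a)) (K.inv_mem hk), ?_⟩
  have h1 := mfderiv_comp_apply (0 : ℝ) (mdifferentiableAt_conj (E := E) k (γ 0))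
    (hγ.mdifferentiable (by simp) 0) (1 : ℝ)
  have h2 : dE (E := E) (fun y : G => k * y * k⁻¹) (γ 0) = adE k := by rw [h0]; rfl
  exact h1.trans ((DFunLike.congr_fun h2 _).trans (congrArg (adE (E := E) k) hv))

theorem contMDiff_list_prod {E' : Type*} [NormedAddCommGroup E'] [NormedSpace ℝ E']
    (l : List (E' → G)) (hl : ∀ f ∈ l, ContMDiff 𝓘(ℝ, E') 𝓘(ℝ, E) ∞ f) :
    ContMDiff 𝓘(ℝ, E') 𝓘(ℝ, E) ∞ (fun t => (l.map fun f => f t).prod) := by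
  induction l with
  | nil => simpa using contMDiff_const
  | cons f l ih =>
    simp only [List.map_cons, List.prod_cons]
    exact (hl f (by simp)).mul (ih fun f hf => hl f (by simp [hf]))

/-- A subgroup that contains a one-parameter group in every direction is a neighbourhood of the
identity. -/
theorem mem_nhds_one_of_isTangentTo {K : Subgroup G}
    (hK : ∀ X : GroupLieAlgebra 𝓘(ℝ, E) G, IsTangentTo K X) : (K : Set G) ∈ 𝓝 (1 : G) := by
  let b := Module.finBasis ℝ E
  choose γ hγ hadd hmem hv using fun i => hK (b i : E)
  let l : List (Fin (Module.finrank ℝ E)) := List.finRange _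
  -- Coordinates of the second kind: in the chart, the derivative of `Ψ` at `0` sends the standard
  -- basis to `b`, so it is onto and `Ψ` is open at `0`. Its values lie in `K`.
  let Ψ : (Fin (Module.finrank ℝ E) → ℝ) → G := fun t => (l.map fun i => γ i (t i)).prod
  have hΨ : ContMDiff 𝓘(ℝ, Fin (Module.finrank ℝ E) → ℝ) 𝓘(ℝ, E) ∞ Ψ := by
    have := contMDiff_list_prod (E := E) (G := G)
      (l.map fun i => fun t : Fin (Module.finrank ℝ E) → ℝ => γ i (t i)) (by
        intro f hf
        obtain ⟨i, -, rfl⟩ := List.mem_map.1 hf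
        exact (hγ i).comp (contDiff_apply ℝ ℝ i).contMDiff)
    simpa [Ψ, Function.comp_def] using this
  have hΨ0 : Ψ 0 = 1 := by
    apply List.prod_eq_one
    intro x hx
    obtain ⟨i, -, rfl⟩ := List.mem_map.1 hx
    exact map_zero_of_map_add (hadd i)
  have hsingle : ∀ i s, Ψ (Pi.single i s) = γ i s := by
    intro i s
    have h := List.prod_map_eq_pow_single (l := l) i (fun j => γ j ((Pi.single i s : _ → ℝ) j))
      (fun j hj _ => by
        rw [Pi.single_eq_of_ne hj]
        exact map_zero_of_map_add (hadd j))
    rw [List.count_eq_one_of_mem (List.nodup_finRange _) (List.mem_finRange i), pow_one,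
      Pi.single_eq_same] at h
    exact h
  let F : (Fin (Module.finrank ℝ E) → ℝ) → E := fun t => extChartAt 𝓘(ℝ, E) (1 : G) (Ψ t)
  have hF : ContDiffAt ℝ 1 F 0 := by
    rw [← contMDiffAt_iff_contDiffAt]
    have h3 : ∀ z, z = (1 : G) →
        ContMDiffAt 𝓘(ℝ, E) 𝓘(ℝ, E) 1 (extChartAt 𝓘(ℝ, E) (1 : G)) z := by
      rintro z rfl
      exact contMDiffAt_extChartAt
    exact (h3 _ hΨ0).comp (0 : Fin (Module.finrank ℝ E) → ℝ) (hΨ.of_le (by norm_cast)).contMDiffAt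
  have hF' := hF.hasStrictFDerivAt (by simp)
  have hderiv : ∀ i, fderiv ℝ F 0 (Pi.single i 1) = b i := by
    intro i
    have h1 := hasDerivAt_chart_comp (hγ i) (map_zero_of_map_add (hadd i)) (hv i)
    have h2 : HasDerivAt (fun s : ℝ => F (Pi.single i s)) (fderiv ℝ F 0 (Pi.single i 1)) 0 := by
      refine HasFDerivAt.comp_hasDerivAt (l := F) 0 ?_ (hasDerivAt_single i 0)
      simpa using hF'.hasFDerivAt
    refine h2.unique ?_
    simpa only [F, hsingle] using h1
  have hsurj : (fderiv ℝ F 0).range = ⊤ := by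
    rw [eq_top_iff, ← b.span_eq, Submodule.span_le]
    rintro _ ⟨i, rfl⟩
    exact ⟨Pi.single i 1, hderiv i⟩
  have hmap := hF'.map_nhds_eq_of_surj hsurj
  have hrange : ∀ t, Ψ t ∈ K := fun t => by
    apply Subgroup.list_prod_mem
    intro x hx
    obtain ⟨i, -, rfl⟩ := List.mem_map.1 hx
    exact hmem i _
  have hF0 : F 0 = extChartAt 𝓘(ℝ, E) (1 : G) 1 := by simp only [F, hΨ0]
  have hsrc : Ψ ⁻¹' (extChartAt 𝓘(ℝ, E) (1 : G)).source ∈ 𝓝 0 := by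
    refine hΨ.continuous.continuousAt ?_
    rw [hΨ0]
    exact extChartAt_source_mem_nhds (I := 𝓘(ℝ, E)) (1 : G)
  have himg : F '' (Ψ ⁻¹' (extChartAt 𝓘(ℝ, E) (1 : G)).source) ∈ 𝓝 (F 0) := by
    rw [← hmap]
    exact image_mem_map hsrc
  rw [hF0] at himg
  have hpre := (continuousAt_extChartAt (I := 𝓘(ℝ, E)) (1 : G)) himg
  filter_upwards [hpre, extChartAt_source_mem_nhds (I := 𝓘(ℝ, E)) (1 : G)] with x hx hxs
  obtain ⟨t, ht, htx⟩ := hx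
  have := (extChartAt 𝓘(ℝ, E) (1 : G)).injOn ht hxs htx
  rw [← this]
  exact hrange t

/-- In a connected non-compact group, the Lie algebra of a compact subgroup is proper. -/
theorem ne_top_of_isLieAlgebraOf [ConnectedSpace G] [NoncompactSpace G] {K : Subgroup G}
    (hK : IsCompact (K : Set G)) {𝔨 : LieSubalgebra ℝ (GroupLieAlgebra 𝓘(ℝ, E) G)}
    (h𝔨 : IsLieAlgebraOf K 𝔨) : ∃ X, X ∉ 𝔨 := by
  by_contra! h
  have h1 := mem_nhds_one_of_isTangentTo fun X => (h𝔨 X).1 (h X)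
  have : IsTopologicalGroup G := topologicalGroup_of_lieGroup 𝓘(ℝ, E) ∞
  -- An open subgroup is closed, so connectedness makes it all of `G`, and compactness of `K`
  -- becomes compactness of `G`.
  have h2 : IsOpen (K : Set G) := K.isOpen_of_mem_nhds h1
  have h3 : IsClosed (K : Set G) := Subgroup.isClosed_of_isOpen K h2
  have h4 := IsClopen.eq_univ ⟨h3, h2⟩ ⟨1, K.one_mem⟩
  rw [h4] at hK
  exact noncompact_univ G hK

end ClosedSubgroup
-- Spectral theorem for an abstract inner product
section Spectral

variable {W : Type*} [AddCommGroup W] [Module ℝ W] [FiniteDimensional ℝ W]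

/-- The spectral theorem for an operator which is symmetric with respect to an inner product. -/
theorem exists_orthonormal_eigenbasis {q : LinearMap.BilinForm ℝ W}
    (hs : ∀ X Y, q X Y = q Y X) (hp : ∀ X, X ≠ 0 → 0 < q X X) {H : W →ₗ[ℝ] W}
    (hH : ∀ X Y, q (H X) Y = q X (H Y)) :
    ∃ (b : Module.Basis (Fin (Module.finrank ℝ W)) ℝ W) (μ : Fin (Module.finrank ℝ W) → ℝ),
      (∀ i, H (b i) = μ i • b i) ∧ ∀ i j, q (b i) (b j) = if i = j then 1 else 0 := by
  let core : InnerProductSpace.Core ℝ W :=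
    { inner := fun X Y => q X Y
      conj_inner_symm := fun X Y => by simp [hs X Y]
      re_inner_nonneg := fun X => by
        rcases eq_or_ne X 0 with rfl | h
        · simp
        · simpa using (hp X h).le
      add_left := fun X Y Z => by simp
      smul_left := fun X Y r => by simp
      definite := fun X h => by
        by_contra h0
        exact (hp X h0).ne' h }
  let _ : NormedAddCommGroup W := core.toNormedAddCommGroup
  let _ : InnerProductSpace ℝ W := InnerProductSpace.ofCore core.toCore
  have hT : H.IsSymmetric := fun X Y => hH X Y
  refine ⟨(hT.eigenvectorBasis rfl).toBasis, hT.eigenvalues rfl, fun i => ?_, fun i j => ?_⟩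
  · simp
  · have := orthonormal_iff_ite.1 (hT.eigenvectorBasis rfl).orthonormal i j
    rw [OrthonormalBasis.coe_toBasis]
    exact this

/-- A symmetric form has an eigenvector with respect to an inner product. -/
theorem exists_eigenvector_form [Nontrivial W] {q f : LinearMap.BilinForm ℝ W}
    (hs : ∀ X Y, q X Y = q Y X) (hp : ∀ X, X ≠ 0 → 0 < q X X) (hf : ∀ X Y, f X Y = f Y X) :
    ∃ (c : ℝ) (v : W), v ≠ 0 ∧ ∀ w, f v w = c * q v w := by
  have hnd : q.Nondegenerate := by
    refine ⟨fun X hX => ?_, fun X hX => ?_⟩ <;>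
    · by_contra h
      exact absurd (hX X) (hp X h).ne'
  let H : W →ₗ[ℝ] W := (LinearMap.BilinForm.toDual q hnd).symm.toLinearMap ∘ₗ f
  have hH : ∀ X Y, q (H X) Y = f X Y := by
    intro X Y
    simp only [H, LinearMap.comp_apply, LinearEquiv.coe_coe]
    rw [← LinearMap.BilinForm.toDual_def hnd, LinearEquiv.apply_symm_apply]
  obtain ⟨b, μ, hb, -⟩ := exists_orthonormal_eigenbasis hs hp (H := H)
    (fun X Y => by rw [hH, hs X, hH, hf])
  have i : Fin (Module.finrank ℝ W) := ⟨0, Module.finrank_pos⟩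
  refine ⟨μ i, b i, b.ne_zero i, fun w => ?_⟩
  rw [← hH, hb]
  simp

end Spectral

/-! ### Polar decomposition and its compatibility with Lie brackets -/

section Polar

variable {W : Type*} [AddCommGroup W] [Module ℝ W]

/-- `U` is the orthogonal factor of a polar decomposition `A = U P`: `U` is orthogonal and
`P = U⁻¹ A` is symmetric and positive semidefinite. -/
structure IsPolarFactor (q : LinearMap.BilinForm ℝ W) (A U : W →ₗ[ℝ] W) : Prop where
  isometry : ∀ X Y, q (U X) (U Y) = q X Y
  symm : ∀ X Y, q (A X) (U Y) = q (U X) (A Y)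
  nonneg : ∀ X, 0 ≤ q (A X) (U X)

variable [FiniteDimensional ℝ W] {q : LinearMap.BilinForm ℝ W}

theorem IsPolarFactor.exists_symm (hp : ∀ X, X ≠ 0 → 0 < q X X)
    {A U : W →ₗ[ℝ] W} (h : IsPolarFactor q A U) :
    ∃ P : W →ₗ[ℝ] W, (∀ X, U (P X) = A X) ∧ (∀ X Y, q (P X) Y = q X (P Y)) ∧
      ∀ X, 0 ≤ q (P X) X := by
  have hinj : Function.Injective U := by
    rw [injective_iff_map_eq_zero]
    intro X hX
    by_contra h0
    have := hp X h0
    rw [← h.isometry, hX] at this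
    simp at this
  let e := LinearEquiv.ofInjectiveEndo U hinj
  have he : ∀ X, U (e.symm X) = X := fun X => e.apply_symm_apply X
  refine ⟨e.symm.toLinearMap ∘ₗ A, fun X => he _, fun X Y => ?_, fun X => ?_⟩
  · rw [← h.isometry, ← h.isometry X]
    simp only [LinearMap.comp_apply, LinearEquiv.coe_coe, he]
    exact h.symm X Y
  · rw [← h.isometry]
    simp only [LinearMap.comp_apply, LinearEquiv.coe_coe, he]
    exact h.nonneg X

/-- If `A = UP = U'P'`, then `P² = P'²`, both being `AᵀA`. For an eigenvector `b` of `P'` with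
eigenvalue `μ > 0`, the vector `Pb - μb` satisfies `P(Pb - μb) = -μ(Pb - μb)`, so `P ≥ 0` forces it
to vanish. Hence `P = P'`, and `P` is onto since `A` is injective. -/
theorem IsPolarFactor.unique (hs : ∀ X Y, q X Y = q Y X) (hp : ∀ X, X ≠ 0 → 0 < q X X)
    {A U U' : W →ₗ[ℝ] W} (hA : Function.Bijective A) (h : IsPolarFactor q A U)
    (h' : IsPolarFactor q A U') : U = U' := by
  obtain ⟨P, hP, hPs, hPn⟩ := h.exists_symm hp
  obtain ⟨P', hPU, hPs', hPn'⟩ := h'.exists_symm hp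
  have hsq : ∀ X, P (P X) = P' (P' X) := by
    intro X
    rw [← sub_eq_zero]
    by_contra h0
    have := hp _ h0
    have h1 : ∀ Y, q (P (P X) - P' (P' X)) Y = 0 := by
      intro Y
      rw [map_sub, LinearMap.sub_apply, hPs, hPs', ← h.isometry (P X), ← h'.isometry (P' X)]
      simp only [hP, hPU, sub_self]
    rw [h1] at this
    exact lt_irrefl _ this
  obtain ⟨b, μ, hb, hq⟩ := exists_orthonormal_eigenbasis hs hp hPs'
  have hμ : ∀ i, 0 < μ i := by
    intro i
    have h1 : 0 ≤ μ i := by simpa [hb, hq] using hPn' (b i)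
    refine lt_of_le_of_ne h1 fun h0 => b.ne_zero i (hA.1 ?_)
    rw [← hPU, hb, ← h0]
    simp
  have hPP : P = P' := by
    refine b.ext fun i => ?_
    rw [hb, ← sub_eq_zero]
    by_contra h0
    have h1 : P (P (b i) - μ i • b i) = -(μ i • (P (b i) - μ i • b i)) := by
      rw [map_sub, hsq, map_smul, hb, map_smul, hb, smul_sub]
      abel
    have h2 := hPn (P (b i) - μ i • b i)
    rw [h1] at h2
    have h3 := hp _ h0
    simp only [map_neg, map_smul, LinearMap.neg_apply, LinearMap.smul_apply, smul_eq_mul] at h2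
    nlinarith [hμ i]
  have hPsurj : Function.Surjective P := by
    refine LinearMap.injective_iff_surjective.1 fun X Y hXY => hA.1 ?_
    rw [← hP, ← hP, hXY]
  ext Y
  obtain ⟨X, rfl⟩ := hPsurj Y
  rw [hP]
  conv_rhs => rw [hPP, hPU]

/-- The orthogonal polar factor of an automorphism `A` of a Lie algebra such that `Aᵀ A` is again an
automorphism is an automorphism. -/
theorem exists_polarFactor_lie {V : Type*} [LieRing V] [LieAlgebra ℝ V] [FiniteDimensional ℝ V]
    {q : LinearMap.BilinForm ℝ V} (hs : ∀ X Y, q X Y = q Y X) (hp : ∀ X, X ≠ 0 → 0 < q X X)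
    {A : V →ₗ[ℝ] V} (hA : Function.Injective A) (hAl : ∀ X Y, A ⁅X, Y⁆ = ⁅A X, A Y⁆)
    {H : V →ₗ[ℝ] V} (hHl : ∀ X Y, H ⁅X, Y⁆ = ⁅H X, H Y⁆) (hHA : ∀ X Y, q (H X) Y = q (A X) (A Y)) :
    ∃ U : V →ₗ[ℝ] V, IsPolarFactor q A U ∧ ∀ X Y, U ⁅X, Y⁆ = ⁅U X, U Y⁆ := by
  have hHs : ∀ X Y, q (H X) Y = q X (H Y) := fun X Y => by
    rw [hHA, hs X, hHA, hs (A X)]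
  obtain ⟨b, μ, hb, hq⟩ := exists_orthonormal_eigenbasis hs hp hHs
  have hμ : ∀ i, 0 < μ i := by
    intro i
    have h1 : A (b i) ≠ 0 := fun h0 => b.ne_zero i (hA (by rw [h0, map_zero]))
    have h2 := hp _ h1
    rw [← hHA, hb] at h2
    simpa [hq] using h2
  -- The operator `H^(-1/2)`, so that `A ∘ R` is the orthogonal factor.
  let R : V →ₗ[ℝ] V := b.constr ℝ fun i => (√(μ i))⁻¹ • b i
  have hR : ∀ i, R (b i) = (√(μ i))⁻¹ • b i := fun i => b.constr_basis ℝ _ i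
  -- Needed for every eigenvector and not only for the `b i`: the bracket of two basis vectors is in
  -- general a combination of several basis vectors.
  have hReig : ∀ c v, H v = c • v → R v = (√c)⁻¹ • v := by
    intro c v hv
    refine b.ext_elem fun i => ?_
    have h1 : ∀ v i, b.repr (H v) i = μ i * b.repr v i := by
      intro v i
      have : b.coord i ∘ₗ H = μ i • b.coord i := by
        refine b.ext fun j => ?_
        by_cases hij : j = i
        · subst hij; simp [hb]
        · simp [hb, hij]
      exact DFunLike.congr_fun this v
    have h2 : ∀ v i, b.repr (R v) i = (√(μ i))⁻¹ * b.repr v i := by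
      intro v i
      have : b.coord i ∘ₗ R = (√(μ i))⁻¹ • b.coord i := by
        refine b.ext fun j => ?_
        by_cases hij : j = i
        · subst hij; simp [hR]
        · simp [hR, hij]
      exact DFunLike.congr_fun this v
    have h3 := h1 v i
    rw [hv] at h3
    simp only [map_smul, Finsupp.smul_apply, smul_eq_mul] at h3
    rw [h2]
    simp only [map_smul, Finsupp.smul_apply, smul_eq_mul]
    by_cases h0 : b.repr v i = 0
    · simp [h0]
    · rw [mul_right_cancel₀ h0 h3]
  -- Since `H` is an automorphism, `⁅b i, b j⁆` has eigenvalue `μ i * μ j`, and `c ↦ (√c)⁻¹` is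
  -- multiplicative on nonnegative reals.
  have hRl : ∀ X Y, R ⁅X, Y⁆ = ⁅R X, R Y⁆ := by
    let f₁ : V →ₗ[ℝ] V →ₗ[ℝ] V := (LieModule.toEnd ℝ V V : V →ₗ[ℝ] V →ₗ[ℝ] V).compr₂ R
    let f₂ : V →ₗ[ℝ] V →ₗ[ℝ] V := (LieModule.toEnd ℝ V V : V →ₗ[ℝ] V →ₗ[ℝ] V).compl₁₂ R R
    have : f₁ = f₂ := by
      refine b.ext fun i => b.ext fun j => ?_
      change R ⁅b i, b j⁆ = ⁅R (b i), R (b j)⁆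
      rw [hReig (μ i * μ j) _ (by rw [hHl, hb, hb, smul_lie, lie_smul, smul_smul]), hR, hR,
        smul_lie, lie_smul, smul_smul, Real.sqrt_mul (hμ i).le, mul_inv]
    intro X Y
    exact DFunLike.congr_fun (DFunLike.congr_fun this X) Y
  have hsqrt : ∀ i, 0 < √(μ i) := fun i => Real.sqrt_pos.2 (hμ i)
  have hsq : ∀ i, μ i = √(μ i) * √(μ i) := fun i => (Real.mul_self_sqrt (hμ i).le).symm
  refine ⟨A ∘ₗ R, ⟨fun X Y => ?_, fun X Y => ?_, fun X => ?_⟩, fun X Y => ?_⟩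
  · have : (q.compl₁₂ (H ∘ₗ R) R) = q := by
      refine b.ext fun i => b.ext fun j => ?_
      simp only [LinearMap.compl₁₂_apply, LinearMap.comp_apply, hR, map_smul, hb,
        LinearMap.smul_apply, hq, smul_eq_mul]
      split_ifs with hij
      · subst hij
        have := (hsqrt i).ne'
        rw [hsq i, Real.sqrt_mul_self (hsqrt i).le]
        field_simp
      · simp
    rw [LinearMap.comp_apply, LinearMap.comp_apply, ← hHA]
    exact DFunLike.congr_fun (DFunLike.congr_fun this X) Y
  · have : (q.compl₁₂ H R) = (q.compl₁₂ R H) := by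
      refine b.ext fun i => b.ext fun j => ?_
      simp only [LinearMap.compl₁₂_apply, hR, map_smul, hb,
        LinearMap.smul_apply, hq, smul_eq_mul]
      split_ifs with hij
      · subst hij
        ring
      · simp
    rw [LinearMap.comp_apply, LinearMap.comp_apply, ← hHA, hs (A (R X)), ← hHA, hs (H Y)]
    exact DFunLike.congr_fun (DFunLike.congr_fun this X) Y
  · rw [LinearMap.comp_apply, ← hHA]
    have hexp : q (H X) (R X) = ∑ i, √(μ i) * (b.repr X i) ^ 2 := by
      conv_lhs => rw [← b.sum_repr X]
      simp only [map_sum, map_smul, hb, hR, LinearMap.sum_apply, LinearMap.smul_apply, hq,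
        smul_eq_mul]
      refine Finset.sum_congr rfl fun i _ => ?_
      rw [Finset.sum_eq_single i]
      · have := (hsqrt i).ne'
        simp only [if_true]
        rw [hsq i, Real.sqrt_mul_self (hsqrt i).le]
        field_simp
      · intro j _ hj
        simp [hj]
      · simp
    rw [hexp]
    exact Finset.sum_nonneg fun i _ => by positivity
  · simp only [LinearMap.comp_apply, hRl, hAl]

end Polar
-- Polar factors along a connected family
section PolarConnected

open Filter Topology

variable {E : Type*} [NormedAddCommGroup E] [NormedSpace ℝ E] [FiniteDimensional ℝ E]

theorem continuous_bilin (q : LinearMap.BilinForm ℝ E) : Continuous fun p : E × E => q p.1 p.2 := by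
  let qC : E →L[ℝ] E →L[ℝ] ℝ := LinearMap.toContinuousBilinearMap q
  have : Continuous fun p : E × E => qC p.1 p.2 := by fun_prop
  exact this

/-- On the unit sphere `q` attains a positive minimum and a maximum, so it is comparable with the
squared norm. This bounds the norm of every isometry, and being an isometry is a closed condition.
-/
theorem isCompact_isometries {q : LinearMap.BilinForm ℝ E} (hp : ∀ X, X ≠ 0 → 0 < q X X) :
    IsCompact {U : E →L[ℝ] E | ∀ X Y, q (U X) (U Y) = q X Y} := by
  have : ProperSpace E := FiniteDimensional.proper ℝ E
  have : ProperSpace (E →L[ℝ] E) := FiniteDimensional.proper ℝ _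
  refine Metric.isCompact_of_isClosed_isBounded ?_ ?_
  · simp only [Set.ofPred_forall]
    refine isClosed_iInter fun X => isClosed_iInter fun Y => isClosed_eq ?_ continuous_const
    exact (continuous_bilin q).comp (by fun_prop : Continuous fun U : E →L[ℝ] E => (U X, U Y))
  · have hcont : Continuous fun X : E => q X X :=
      (continuous_bilin q).comp (by fun_prop : Continuous fun X : E => (X, X))
    rcases subsingleton_or_nontrivial E with hE | hE
    · refine (Metric.isBounded_closedBall (x := (0 : E →L[ℝ] E)) (r := 0)).subset fun U _ => ?_
      rw [Subsingleton.elim U 0]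
      simp
    have hsph : (Metric.sphere (0 : E) 1).Nonempty := NormedSpace.sphere_nonempty.2 zero_le_one
    obtain ⟨v, hv, hmin⟩ := (isCompact_sphere (0 : E) 1).exists_isMinOn hsph hcont.continuousOn
    obtain ⟨w, hw, hmax⟩ := (isCompact_sphere (0 : E) 1).exists_isMaxOn hsph hcont.continuousOn
    have hv0 : 0 < q v v := hp v (by rintro rfl; simp at hv)
    have hscale : ∀ X : E, X ≠ 0 → q (‖X‖⁻¹ • X) (‖X‖⁻¹ • X) * ‖X‖ ^ 2 = q X X := by
      intro X hX
      have : ‖X‖ ≠ 0 := norm_ne_zero_iff.2 hX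
      simp only [map_smul, LinearMap.smul_apply, smul_eq_mul]
      field_simp
    have hunit : ∀ X : E, X ≠ 0 → ‖X‖⁻¹ • X ∈ Metric.sphere (0 : E) 1 := by
      intro X hX
      have : ‖X‖ ≠ 0 := norm_ne_zero_iff.2 hX
      simp [norm_smul, this]
    have hlow : ∀ X : E, q v v * ‖X‖ ^ 2 ≤ q X X := by
      intro X
      rcases eq_or_ne X 0 with rfl | hX
      · simp
      rw [← hscale X hX]
      exact mul_le_mul_of_nonneg_right (hmin (hunit X hX)) (by positivity)
    have hupp : ∀ X : E, q X X ≤ q w w * ‖X‖ ^ 2 := by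
      intro X
      rcases eq_or_ne X 0 with rfl | hX
      · simp
      rw [← hscale X hX]
      exact mul_le_mul_of_nonneg_right (hmax (hunit X hX)) (by positivity)
    refine (Metric.isBounded_closedBall (x := (0 : E →L[ℝ] E))
      (r := √(q w w / q v v))).subset fun U hU => ?_
    rw [mem_closedBall_zero_iff]
    refine U.opNorm_le_bound (Real.sqrt_nonneg _) fun X => ?_
    have h1 := (hlow (U X)).trans ((hU X X).le.trans (hupp X))
    have h2 : ‖U X‖ ^ 2 ≤ q w w / q v v * ‖X‖ ^ 2 := by
      rw [div_mul_eq_mul_div, le_div_iff₀ hv0]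
      linarith
    have h3 := Real.sqrt_le_sqrt h2
    rwa [Real.sqrt_sq (norm_nonneg _), Real.sqrt_mul' _ (by positivity),
      Real.sqrt_sq (norm_nonneg _)] at h3

/-- Along a connected family of invertible operators, the orthogonal polar factor cannot pass from
one closed set to another, disjoint, one. -/
theorem polarFactor_mem_of_connected {q : LinearMap.BilinForm ℝ E}
    (hs : ∀ X Y, q X Y = q Y X) (hp : ∀ X, X ≠ 0 → 0 < q X X)
    {S : Type*} [TopologicalSpace S] [PreconnectedSpace S] {Φ : S → E →L[ℝ] E} (hΦ : Continuous Φ)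
    (hbij : ∀ x, Function.Bijective (Φ x)) {C C' : Set (E →L[ℝ] E)}
    (hC : IsClosed C) (hC' : IsClosed C')
    (hdisj : ∀ U ∈ C, U ∈ C' → (∀ X Y, q (U X) (U Y) = q X Y) → False)
    (hcover : ∀ x, ∃ U ∈ C ∪ C', IsPolarFactor q (Φ x).toLinearMap (U : E →L[ℝ] E).toLinearMap)
    {x₀ : S} {U₀ : E →L[ℝ] E} (hU₀ : U₀ ∈ C)
    (hx₀ : IsPolarFactor q (Φ x₀).toLinearMap U₀.toLinearMap)
    {x : S} {U : E →L[ℝ] E} (hU : IsPolarFactor q (Φ x).toLinearMap U.toLinearMap) : U ∈ C := by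
  let O : Set (E →L[ℝ] E) := {U | ∀ X Y, q (U X) (U Y) = q X Y}
  have hO : IsCompact O := isCompact_isometries hp
  have hpol : IsClosed {p : S × (E →L[ℝ] E) |
      IsPolarFactor q (Φ p.1).toLinearMap p.2.toLinearMap} := by
    have heq : {p : S × (E →L[ℝ] E) | IsPolarFactor q (Φ p.1).toLinearMap p.2.toLinearMap}
      = {p | ∀ X Y, q (p.2 X) (p.2 Y) = q X Y} ∩ {p | ∀ X Y, q (Φ p.1 X) (p.2 Y)
        = q (p.2 X) (Φ p.1 Y)} ∩ {p | ∀ X, 0 ≤ q (Φ p.1 X) (p.2 X)} := by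
      ext p
      exact ⟨fun h => ⟨⟨h.1, h.2⟩, h.3⟩, fun h => ⟨h.1.1, h.1.2, h.2⟩⟩
    have hq : ∀ {f g : S × (E →L[ℝ] E) → E}, Continuous f → Continuous g →
        Continuous fun p => q (f p) (g p) := fun hf hg => (continuous_bilin q).comp (hf.prodMk hg)
    have hc2 : ∀ X : E, Continuous fun p : S × (E →L[ℝ] E) => p.2 X := fun X =>
      continuous_snd.clm_apply continuous_const
    have hc1 : ∀ X : E, Continuous fun p : S × (E →L[ℝ] E) => Φ p.1 X := fun X =>
      (hΦ.comp continuous_fst).clm_apply continuous_const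
    rw [heq]
    simp only [Set.ofPred_forall]
    refine ((isClosed_iInter fun X => isClosed_iInter fun Y => ?_).inter
      (isClosed_iInter fun X => isClosed_iInter fun Y => ?_)).inter (isClosed_iInter fun X => ?_)
    · exact isClosed_eq (hq (hc2 X) (hc2 Y)) continuous_const
    · exact isClosed_eq (hq (hc1 X) (hc2 Y)) (hq (hc2 X) (hc1 Y))
    · exact isClosed_le continuous_const (hq (hc1 X) (hc2 X))
  -- The parameters whose polar factor lies in `D` are the projection of a closed set along the
  -- compact set of isometries. With `D = C` and `D = C'` this gives two closed sets covering the
  -- connected space `S`; a common point is excluded by uniqueness and `hdisj`.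
  have hclosed : ∀ D : Set (E →L[ℝ] E), IsClosed D →
      IsClosed {x | ∃ U ∈ D, IsPolarFactor q (Φ x).toLinearMap (U : E →L[ℝ] E).toLinearMap} := by
    intro D hD
    have hcomp : CompactSpace O := isCompact_iff_compactSpace.1 hO
    have hcl : IsClosed {p : S × O | (p.2 : E →L[ℝ] E) ∈ D ∧
        IsPolarFactor q (Φ p.1).toLinearMap (p.2 : E →L[ℝ] E).toLinearMap} :=
      (hD.preimage (continuous_subtype_val.comp continuous_snd)).inter
        (hpol.preimage (continuous_fst.prodMk (continuous_subtype_val.comp continuous_snd)))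
    have := isClosedMap_fst_of_compactSpace _ hcl
    convert this using 1
    ext x
    constructor
    · rintro ⟨U, hUD, hU⟩
      exact ⟨(x, ⟨U, hU.isometry⟩), ⟨hUD, hU⟩, rfl⟩
    · rintro ⟨p, ⟨h1, h2⟩, rfl⟩
      exact ⟨p.2, h1, h2⟩
  have huniq : ∀ x (U U' : E →L[ℝ] E), IsPolarFactor q (Φ x).toLinearMap U.toLinearMap →
      IsPolarFactor q (Φ x).toLinearMap U'.toLinearMap → U = U' := by
    intro x U U' h h'
    exact ContinuousLinearMap.coe_injective (IsPolarFactor.unique hs hp (hbij x) h h')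
  by_contra hUC
  have hUC' : ∃ U ∈ C', IsPolarFactor q (Φ x).toLinearMap (U : E →L[ℝ] E).toLinearMap := by
    obtain ⟨U', hU', hp'⟩ := hcover x
    have := huniq x U U' hU hp'
    subst this
    exact ⟨U, hU'.resolve_left hUC, hU⟩
  have hpre := isPreconnected_closed_iff.1 (isPreconnected_univ (α := S)) _ _ (hclosed C hC)
    (hclosed C' hC') (by
      intro y _
      obtain ⟨U', hU', hp'⟩ := hcover y
      rcases hU' with h | h
      · exact Or.inl ⟨U', h, hp'⟩
      · exact Or.inr ⟨U', h, hp'⟩) ⟨x₀, trivial, U₀, hU₀, hx₀⟩ ⟨x, trivial, hUC'⟩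
  obtain ⟨y, -, ⟨U₁, h1, h1'⟩, ⟨U₂, h2, h2'⟩⟩ := hpre
  have := huniq y U₁ U₂ h1' h2'
  subst this
  exact hdisj U₁ h1 h2 h1'.isometry

end PolarConnected
-- Schur's lemma and irreducibility of `𝔭`
section CartanAlgebra

variable {V : Type*} [LieRing V] [LieAlgebra ℝ V]

theorem killing_symm (X Y : V) : killingForm ℝ V X Y = killingForm ℝ V Y X :=
  LieModule.traceForm_comm ℝ V V X Y

theorem killing_lie (X Y Z : V) : killingForm ℝ V ⁅X, Y⁆ Z = killingForm ℝ V X ⁅Y, Z⁆ :=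
  LieModule.traceForm_apply_lie_apply ℝ V V X Y Z

theorem killing_lie_skew (X Y Z : V) :
    killingForm ℝ V ⁅X, Y⁆ Z + killingForm ℝ V Y ⁅X, Z⁆ = 0 := by
  rw [← lie_skew X Y, map_neg, LinearMap.neg_apply, killing_lie, neg_add_cancel]

theorem mem_killingCompl {𝔨 : LieSubalgebra ℝ V} {X : V} :
    X ∈ killingCompl 𝔨 ↔ ∀ Y ∈ 𝔨, killingForm ℝ V Y X = 0 := Iff.rfl

/-- A nonzero subspace that is stable under all brackets is everything, in a simple Lie algebra. -/
theorem eq_univ_of_simple (hS : LieAlgebra.IsSimple ℝ V) {W : Submodule ℝ V}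
    (hW : ∀ Z X : V, X ∈ W → ⁅Z, X⁆ ∈ W) (hne : ∃ X ∈ W, X ≠ 0) (X : V) : X ∈ W := by
  let I : LieIdeal ℝ V := { W with lie_mem := fun {Z X} h => hW Z X h }
  obtain ⟨Y, hY, hY0⟩ := hne
  rcases hS.eq_bot_or_eq_top I with h | h
  · have : Y ∈ I := hY
    rw [h] at this
    exact absurd ((LieSubmodule.mem_bot Y).1 this) hY0
  · have : X ∈ I := by rw [h]; exact LieSubmodule.mem_top X
    exact this

variable [FiniteDimensional ℝ V]

/-- Orthogonal decomposition with respect to a symmetric form that is anisotropic on `W`. -/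
theorem exists_add_orthogonal {b : LinearMap.BilinForm ℝ V} (hb : ∀ X Y, b X Y = b Y X)
    {W : Submodule ℝ V} (hW : ∀ X ∈ W, X ≠ 0 → b X X ≠ 0) :
    IsCompl W (b.orthogonal W) := by
  refine LinearMap.BilinForm.isCompl_orthogonal_of_restrict_nondegenerate
    (fun X Y h => by rw [hb, h]) ?_
  refine ⟨fun X hX => ?_, fun X hX => ?_⟩ <;>
  · by_contra h
    exact hW X X.2 (fun h0 => h (Subtype.ext h0)) (hX X)

/-- Schur lemma for invariant symmetric forms on an irreducible module. -/
theorem schur_form {W : Submodule ℝ V} {𝔨 : LieSubalgebra ℝ V} (hne : ∃ X ∈ W, X ≠ 0)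
    (hirr : ∀ U ≤ W, (∀ K ∈ 𝔨, ∀ X ∈ U, ⁅K, X⁆ ∈ U) → (∃ X ∈ U, X ≠ 0) → W ≤ U)
    (hst : ∀ K ∈ 𝔨, ∀ X ∈ W, ⁅K, X⁆ ∈ W) {q f : LinearMap.BilinForm ℝ V}
    (hs : ∀ X ∈ W, ∀ Y ∈ W, q X Y = q Y X) (hp : ∀ X ∈ W, X ≠ 0 → 0 < q X X)
    (hq : ∀ K ∈ 𝔨, ∀ X ∈ W, ∀ Y ∈ W, q ⁅K, X⁆ Y + q X ⁅K, Y⁆ = 0)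
    (hfs : ∀ X ∈ W, ∀ Y ∈ W, f X Y = f Y X)
    (hf : ∀ K ∈ 𝔨, ∀ X ∈ W, ∀ Y ∈ W, f ⁅K, X⁆ Y + f X ⁅K, Y⁆ = 0) :
    ∃ c : ℝ, ∀ X ∈ W, ∀ Y ∈ W, f X Y = c * q X Y := by
  obtain ⟨X₀, hX₀, hX₀'⟩ := hne
  have : Nontrivial W := ⟨⟨X₀, hX₀⟩, 0, fun h => hX₀' (congrArg Subtype.val h)⟩
  obtain ⟨c, v, hv, hc⟩ := exists_eigenvector_form (W := W) (q := q.restrict W) (f := f.restrict W)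
    (fun X Y => hs X X.2 Y Y.2) (fun X hX => hp X X.2 fun h => hX (Subtype.ext h))
    (fun X Y => hfs X X.2 Y Y.2)
  -- The eigenspace of `f` relative to `q` for the eigenvalue `c`. Invariance of both forms makes it
  -- `𝔨`-stable, so by irreducibility it is all of `W`.
  let U : Submodule ℝ V :=
    { carrier := {X | X ∈ W ∧ ∀ Y ∈ W, f X Y = c * q X Y}
      add_mem' := by
        rintro X X' ⟨h1, h2⟩ ⟨h1', h2'⟩
        refine ⟨W.add_mem h1 h1', fun Y hY => ?_⟩
        simp only [map_add, LinearMap.add_apply, h2 Y hY, h2' Y hY]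
        ring
      zero_mem' := ⟨W.zero_mem, fun Y _ => by simp⟩
      smul_mem' := by
        rintro r X ⟨h1, h2⟩
        refine ⟨W.smul_mem r h1, fun Y hY => ?_⟩
        simp only [map_smul, LinearMap.smul_apply, h2 Y hY, smul_eq_mul]
        ring }
  have hWU : W ≤ U := by
    refine hirr U (fun X hX => hX.1) (fun K hK X hX => ⟨hst K hK X hX.1, fun Y hY => ?_⟩)
      ⟨v, ⟨v.2, fun Y hY => hc ⟨Y, hY⟩⟩, fun h => hv (Subtype.ext h)⟩
    have h1 := hf K hK X hX.1 Y hY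
    have h2 := hq K hK X hX.1 Y hY
    rw [hX.2 _ (hst K hK Y hY)] at h1
    linear_combination h1 - c * h2
  exact ⟨c, fun X hX Y hY => (hWU hX).2 Y hY⟩

variable {𝔨 : LieSubalgebra ℝ V}

theorem IsCartanDecomposition.exists_add (hC : IsCartanDecomposition 𝔨) (X : V) :
    ∃ P ∈ killingCompl 𝔨, ∃ K ∈ 𝔨, P + K = X :=
  ⟨_, Submodule.projection_apply_mem hC.isCompl X, _,
    Submodule.projection_apply_mem hC.isCompl.symm X,
    Submodule.projection_add_projection_eq_self hC.isCompl X⟩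

theorem killing_k_p {X Y : V} (hX : X ∈ 𝔨) (hY : Y ∈ killingCompl 𝔨) : killingForm ℝ V X Y = 0 :=
  hY X hX

theorem killing_p_k {X Y : V} (hX : X ∈ 𝔨) (hY : Y ∈ killingCompl 𝔨) : killingForm ℝ V Y X = 0 := by
  rw [killing_symm]; exact hY X hX

theorem IsCartanDecomposition.lie_p_k (hC : IsCartanDecomposition 𝔨) {X Y : V}
    (hX : X ∈ killingCompl 𝔨) (hY : Y ∈ 𝔨) : ⁅X, Y⁆ ∈ killingCompl 𝔨 := by
  rw [← lie_skew]
  exact Submodule.neg_mem _ (hC.lie_k_p Y hY X hX)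

/-- In a simple Lie algebra, `𝔭` is an irreducible `𝔨`-module. -/
theorem IsCartanDecomposition.irreducible_p (hC : IsCartanDecomposition 𝔨)
    (hS : LieAlgebra.IsSimple ℝ V) {W : Submodule ℝ V} (hW : W ≤ killingCompl 𝔨)
    (hst : ∀ K ∈ 𝔨, ∀ X ∈ W, ⁅K, X⁆ ∈ W) (hne : ∃ X ∈ W, X ≠ 0) : killingCompl 𝔨 ≤ W := by
  have hcompl := exists_add_orthogonal (b := killingForm ℝ V) killing_symm (W := W)
    fun X hX h0 => (hC.pos X (hW hX) h0).ne'
  -- For `w' ∈ 𝔭` orthogonal to `W` put `k = ⁅w', w⁆ ∈ 𝔨`. Then `B(k, k) = B(w', ⁅w, k⁆) = 0`,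
  -- because `⁅k, w⁆ ∈ W`, and `B` is negative definite on `𝔨`.
  have hcomm : ∀ w ∈ W, ∀ w' ∈ killingCompl 𝔨, (∀ u ∈ W, killingForm ℝ V u w' = 0) →
      ⁅w', w⁆ = 0 := by
    intro w hw w' hw' horth
    have hk := hC.lie_p_p w' hw' w (hW hw)
    by_contra h0
    refine (hC.neg _ hk h0).ne ?_
    rw [killing_lie, killing_symm, ← lie_skew, map_neg, LinearMap.neg_apply,
      horth _ (hst _ hk w hw), neg_zero]
  -- `W + ⁅W, W⁆` is an ideal of the whole algebra, the complement of `W` in `𝔭` acting on it by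
  -- zero. By simplicity it is everything, and its `𝔭`-part is `W`.
  let D : Submodule ℝ V := Submodule.span ℝ {Z | ∃ X ∈ W, ∃ Y ∈ W, ⁅X, Y⁆ = Z}
  have hDk : D ≤ 𝔨.toSubmodule := by
    rw [Submodule.span_le]
    rintro _ ⟨X, hX, Y, hY, rfl⟩
    exact hC.lie_p_p X (hW hX) Y (hW hY)
  have hall : ∀ X, X ∈ W ⊔ D := by
    refine eq_univ_of_simple hS ?_ (by
      obtain ⟨X, hX, h0⟩ := hne
      exact ⟨X, Submodule.mem_sup_left hX, h0⟩)
    have hk : ∀ K ∈ 𝔨, ∀ X ∈ W ⊔ D, ⁅K, X⁆ ∈ W ⊔ D := by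
      intro K hK X hX
      obtain ⟨w, hw, d, hd, rfl⟩ := Submodule.mem_sup.1 hX
      rw [lie_add]
      refine Submodule.add_mem_sup (hst K hK w hw) ?_
      clear hX
      induction hd using Submodule.span_induction with
      | mem x h =>
        obtain ⟨X, hX, Y, hY, rfl⟩ := h
        rw [leibniz_lie]
        exact D.add_mem (Submodule.subset_span ⟨_, hst K hK X hX, Y, hY, rfl⟩)
          (Submodule.subset_span ⟨X, hX, _, hst K hK Y hY, rfl⟩)
      | zero => simp
      | add x y hx hy h1 h2 =>
        rw [lie_add]
        exact D.add_mem h1 h2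
      | smul a x hx h =>
        rw [lie_smul]
        exact D.smul_mem _ h
    have hw : ∀ w ∈ W, ∀ X ∈ W ⊔ D, ⁅w, X⁆ ∈ W ⊔ D := by
      intro w hw X hX
      obtain ⟨w', hw', d, hd, rfl⟩ := Submodule.mem_sup.1 hX
      rw [lie_add]
      refine Submodule.add_mem _
        (Submodule.mem_sup_right (Submodule.subset_span ⟨w, hw, w', hw', rfl⟩))
        (Submodule.mem_sup_left ?_)
      rw [← lie_skew]
      exact W.neg_mem (hst d (hDk hd) w hw)
    have hw' : ∀ w' ∈ killingCompl 𝔨, (∀ u ∈ W, killingForm ℝ V u w' = 0) →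
        ∀ X ∈ W ⊔ D, ⁅w', X⁆ = 0 := by
      intro w' hw' horth X hX
      obtain ⟨w, hw, d, hd, rfl⟩ := Submodule.mem_sup.1 hX
      rw [lie_add, hcomm w hw w' hw' horth, zero_add]
      clear hX
      induction hd using Submodule.span_induction with
      | mem x h =>
        obtain ⟨X, hX, Y, hY, rfl⟩ := h
        rw [leibniz_lie, hcomm X hX w' hw' horth, hcomm Y hY w' hw' horth]
        simp
      | zero => simp
      | add x y hx hy h1 h2 => rw [lie_add, h1, h2, add_zero]
      | smul a x hx h => rw [lie_smul, h, smul_zero]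
    intro Z X hX
    obtain ⟨P, hP, K, hK, rfl⟩ := hC.exists_add Z
    obtain ⟨w, hw1, u, hu, rfl⟩ := Submodule.mem_sup.1
      (hcompl.sup_eq_top ▸ Submodule.mem_top : P ∈ W ⊔ (killingForm ℝ V).orthogonal W)
    have hup : u ∈ killingCompl 𝔨 := by
      have := Submodule.sub_mem _ hP (hW hw1)
      simpa using this
    rw [add_lie, add_lie, hw' u hup hu X hX, add_zero]
    exact Submodule.add_mem _ (hw w hw1 X hX) (hk K hK X hX)
  intro X hX
  obtain ⟨w, hw, d, hd, rfl⟩ := Submodule.mem_sup.1 (hall X)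
  have hd0 : d = 0 := by
    have h1 : d ∈ killingCompl 𝔨 := by
      have := Submodule.sub_mem _ hX (hW hw)
      simpa using this
    exact (Submodule.disjoint_def.1 hC.isCompl.disjoint) d h1 (hDk hd)
  rw [hd0, add_zero]
  exact hw

/-- An ideal of `𝔨` that acts trivially on `𝔭 ≠ 0` vanishes, in a simple Lie algebra. -/
theorem IsCartanDecomposition.eq_zero_of_trivial_on_p (hC : IsCartanDecomposition 𝔨)
    (hS : LieAlgebra.IsSimple ℝ V) (hp : ∃ X, X ∉ 𝔨) {W : Submodule ℝ V}
    (hW : W ≤ 𝔨.toSubmodule)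
    (hst : ∀ K ∈ 𝔨, ∀ X ∈ W, ⁅K, X⁆ ∈ W) (htriv : ∀ X ∈ W, ∀ P ∈ killingCompl 𝔨, ⁅P, X⁆ = 0)
    {X : V} (hX : X ∈ W) : X = 0 := by
  by_contra h0
  obtain ⟨Y, hY⟩ := hp
  -- A `𝔨`-stable subspace killed by `𝔭` is an ideal of the simple algebra, so if it were nonzero it
  -- would be everything, contrary to lying in `𝔨 ≠ 𝔤`.
  refine hY (hW (eq_univ_of_simple hS (fun Z X hX => ?_) ⟨X, hX, h0⟩ Y))
  obtain ⟨P, hP, K, hK, rfl⟩ := hC.exists_add Z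
  rw [add_lie, htriv X hX P hP, zero_add]
  exact hst K hK X hX

end CartanAlgebra
-- Ideals of `𝔨`
section IdealStructure

variable {V : Type*} [LieRing V] [LieAlgebra ℝ V]

theorem exists_ne_zero_of_simple {𝔩 : LieSubalgebra ℝ V} (h : LieAlgebra.IsSimple ℝ 𝔩) :
    ∃ X ∈ 𝔩, ∃ Y ∈ 𝔩, ⁅X, Y⁆ ≠ 0 := by
  by_contra! h0
  exact h.non_abelian ⟨fun X Y => Subtype.ext (h0 X X.2 Y Y.2)⟩

theorem le_of_stable_of_simple {𝔩 : LieSubalgebra ℝ V} (h : LieAlgebra.IsSimple ℝ 𝔩)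
    {U : Submodule ℝ V} (hst : ∀ X ∈ 𝔩, ∀ Y ∈ U, Y ∈ 𝔩 → ⁅X, Y⁆ ∈ U)
    (hne : ∃ X ∈ U, X ∈ 𝔩 ∧ X ≠ 0) : 𝔩.toSubmodule ≤ U := by
  obtain ⟨X, hX, hXl, h0⟩ := hne
  have := eq_univ_of_simple h (W := U.comap 𝔩.toSubmodule.subtype)
    (fun Z X hX => hst Z Z.2 X hX X.2) ⟨⟨X, hXl⟩, hX, fun h => h0 (congrArg Subtype.val h)⟩
  exact fun Y hY => this ⟨Y, hY⟩

theorem mem_span_lie_of_simple {𝔩 : LieSubalgebra ℝ V} (h : LieAlgebra.IsSimple ℝ 𝔩) :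
    𝔩.toSubmodule ≤ Submodule.span ℝ {Z | ∃ X ∈ 𝔩, ∃ Y ∈ 𝔩, ⁅X, Y⁆ = Z} := by
  obtain ⟨X, hX, Y, hY, h0⟩ := exists_ne_zero_of_simple h
  exact le_of_stable_of_simple h (fun X hX Y _ hY => Submodule.subset_span ⟨X, hX, Y, hY, rfl⟩)
    ⟨_, Submodule.subset_span ⟨X, hX, Y, hY, rfl⟩, 𝔩.lie_mem hX hY, h0⟩

variable {𝔨 𝔩 𝔩' : LieSubalgebra ℝ V}

theorem derivedSubmodule_le : derivedSubmodule 𝔨 ≤ 𝔨.toSubmodule := by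
  rw [derivedSubmodule, Submodule.span_le]
  rintro _ ⟨X, hX, Y, hY, rfl⟩
  exact 𝔨.lie_mem hX hY

theorem lie_mem_derivedSubmodule {X Y : V} (hX : X ∈ 𝔨) (hY : Y ∈ 𝔨) :
    ⁅X, Y⁆ ∈ derivedSubmodule 𝔨 := Submodule.subset_span ⟨X, hX, Y, hY, rfl⟩

theorem IsSimpleIdealOfDerived.le (h : IsSimpleIdealOfDerived 𝔨 𝔩) {X : V} (hX : X ∈ 𝔩) : X ∈ 𝔨 :=
  derivedSubmodule_le (h.1 hX)

/-- A simple algebra is spanned by its brackets, and `⁅X, ⁅A, B⁆⁆` expands by the Jacobi identity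
into brackets of `𝔩` with `⁅X, A⁆` and `⁅X, B⁆`, which lie in `[𝔨, 𝔨]`. So an ideal of `[𝔨, 𝔨]`
becomes an ideal of `𝔨`. -/
theorem IsSimpleIdealOfDerived.lie_mem (h : IsSimpleIdealOfDerived 𝔨 𝔩) {X Y : V} (hX : X ∈ 𝔨)
    (hY : Y ∈ 𝔩) : ⁅X, Y⁆ ∈ 𝔩 := by
  have := mem_span_lie_of_simple h.2.2 hY
  clear hY
  induction this using Submodule.span_induction with
  | mem x hx =>
    obtain ⟨A, hA, B, hB, rfl⟩ := hx
    rw [leibniz_lie]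
    refine 𝔩.add_mem (h.2.1 _ (lie_mem_derivedSubmodule hX (h.le hA)) B hB) ?_
    rw [← lie_skew]
    exact 𝔩.neg_mem (h.2.1 _ (lie_mem_derivedSubmodule hX (h.le hB)) A hA)
  | zero => simp
  | add x y _ _ h1 h2 => rw [lie_add]; exact 𝔩.add_mem h1 h2
  | smul a x _ h1 => rw [lie_smul]; exact 𝔩.smul_mem a h1

/-- The bracket lies in both ideals. A nonzero common element would, by simplicity, generate each of
them inside the other. -/
theorem IsSimpleIdealOfDerived.lie_eq_zero (h : IsSimpleIdealOfDerived 𝔨 𝔩)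
    (h' : IsSimpleIdealOfDerived 𝔨 𝔩') (hne : 𝔩 ≠ 𝔩') {X Y : V} (hX : X ∈ 𝔩) (hY : Y ∈ 𝔩') :
    ⁅X, Y⁆ = 0 := by
  by_contra h0
  have h1 : ⁅X, Y⁆ ∈ 𝔩 := by
    rw [← lie_skew]
    exact 𝔩.neg_mem (h.lie_mem (h'.le hY) hX)
  have h2 : ⁅X, Y⁆ ∈ 𝔩' := h'.lie_mem (h.le hX) hY
  refine hne (le_antisymm ?_ ?_)
  · exact le_of_stable_of_simple h.2.2 (U := 𝔩'.toSubmodule)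
      (fun X hX Y hY _ => h'.lie_mem (h.le hX) hY) ⟨_, h2, h1, h0⟩
  · exact le_of_stable_of_simple h'.2.2 (U := 𝔩.toSubmodule)
      (fun X hX Y hY _ => h.lie_mem (h'.le hX) hY) ⟨_, h1, h2, h0⟩

/-- On generators, `B(⁅A, B⁆, Y) = B(A, ⁅B, Y⁆) = 0`. -/
theorem killing_eq_zero_of_simple (h : LieAlgebra.IsSimple ℝ 𝔩) {Y : V}
    (hc : ∀ X ∈ 𝔩, ⁅X, Y⁆ = 0) {X : V} (hX : X ∈ 𝔩) : killingForm ℝ V X Y = 0 := by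
  have := mem_span_lie_of_simple h hX
  clear hX
  induction this using Submodule.span_induction with
  | mem x hx =>
    obtain ⟨A, hA, B, hB, rfl⟩ := hx
    rw [killing_lie, hc B hB, map_zero]
  | zero => simp
  | add x y _ _ h1 h2 => rw [map_add, LinearMap.add_apply, h1, h2, add_zero]
  | smul a x _ h1 => rw [map_smul, LinearMap.smul_apply, h1, smul_zero]

variable [FiniteDimensional ℝ V]

theorem exists_minimal_stable {U : Submodule ℝ V} (hst : ∀ K ∈ 𝔨, ∀ X ∈ U, ⁅K, X⁆ ∈ U)
    (hne : ∃ X ∈ U, X ≠ 0) : ∃ M ≤ U, (∀ K ∈ 𝔨, ∀ X ∈ M, ⁅K, X⁆ ∈ M) ∧ (∃ X ∈ M, X ≠ 0) ∧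
      ∀ N ≤ M, (∀ K ∈ 𝔨, ∀ X ∈ N, ⁅K, X⁆ ∈ N) → (∃ X ∈ N, X ≠ 0) → M ≤ N := by
  let S : Set (Submodule ℝ V) :=
    {M | M ≤ U ∧ (∀ K ∈ 𝔨, ∀ X ∈ M, ⁅K, X⁆ ∈ M) ∧ ∃ X ∈ M, X ≠ 0}
  obtain ⟨M, ⟨hM1, hM2, hM3⟩, hmin⟩ :=
    WellFounded.has_min (wellFounded_lt (α := Submodule ℝ V)) S ⟨U, le_rfl, hst, hne⟩
  refine ⟨M, hM1, hM2, hM3, fun N hN h1 h2 => ?_⟩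
  by_contra hle
  exact hmin N ⟨hN.trans hM1, h1, h2⟩ (lt_of_le_not_ge hN hle)

/-- A nonzero ideal of `𝔨` contains a nonzero central element or a simple ideal of `[𝔨, 𝔨]`. -/
theorem IsCartanDecomposition.exists_central_or_simple (hC : IsCartanDecomposition 𝔨)
    {U : Submodule ℝ V} (hU : U ≤ 𝔨.toSubmodule) (hst : ∀ K ∈ 𝔨, ∀ X ∈ U, ⁅K, X⁆ ∈ U)
    (hne : ∃ X ∈ U, X ≠ 0) :
    (∃ X ∈ U, IsCentral 𝔨 X ∧ X ≠ 0) ∨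
      ∃ 𝔩 : LieSubalgebra ℝ V, IsSimpleIdealOfDerived 𝔨 𝔩 ∧ 𝔩.toSubmodule ≤ U := by
  obtain ⟨M, hMU, hMst, ⟨X₀, hX₀, hX₀'⟩, hmin⟩ := exists_minimal_stable hst hne
  have hMk : ∀ {X}, X ∈ M → X ∈ 𝔨 := fun h => hU (hMU h)
  have hcompl := exists_add_orthogonal (b := killingForm ℝ V) killing_symm (W := M)
    fun X hX h0 => (hC.neg X (hMk hX) h0).ne
  -- The orthogonal complement of `M` in `𝔨` centralises `M`, by the same sign argument as for `𝔭`.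
  -- So `𝔨` acts on `M` through `M` itself: if `M` is abelian it is central, and otherwise it is a
  -- simple algebra.
  have hdec : ∀ K ∈ 𝔨, ∃ u ∈ M, ∃ v, v + u = K ∧ ∀ X ∈ M, ⁅v, X⁆ = 0 := by
    intro K hK
    obtain ⟨u, hu, v, hv, rfl⟩ := Submodule.mem_sup.1
      (hcompl.sup_eq_top ▸ Submodule.mem_top : K ∈ M ⊔ (killingForm ℝ V).orthogonal M)
    refine ⟨u, hu, v, add_comm _ _, fun X hX => ?_⟩
    have hvk : v ∈ 𝔨 := by
      have := 𝔨.sub_mem hK (hMk hu)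
      simpa using this
    have h1 := hMst v hvk X hX
    by_contra h0
    refine (hC.neg _ (hMk h1) h0).ne ?_
    rw [killing_lie, killing_symm]
    exact hv _ (hMst X (hMk hX) _ h1)
  by_cases hab : ∀ X ∈ M, ∀ Y ∈ M, ⁅X, Y⁆ = 0
  · refine Or.inl ⟨X₀, hMU hX₀, ⟨hMk hX₀, fun K hK => ?_⟩, hX₀'⟩
    obtain ⟨u, hu, v, rfl, hv⟩ := hdec K hK
    rw [lie_add, hab X₀ hX₀ u hu, add_zero, ← lie_skew, hv X₀ hX₀, neg_zero]
  · push Not at hab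
    obtain ⟨X₁, hX₁, Y₁, hY₁, h01⟩ := hab
    let 𝔩 : LieSubalgebra ℝ V := { M with lie_mem' := fun {X Y} hX hY => hMst X (hMk hX) Y hY }
    refine Or.inr ⟨𝔩, ⟨?_, ?_, ?_⟩, hMU⟩
    -- By minimality `M = ⁅M, M⁆`, which places `M` inside `[𝔨, 𝔨]`.
    · refine le_trans (hmin (Submodule.span ℝ {Z | ∃ X ∈ M, ∃ Y ∈ M, ⁅X, Y⁆ = Z}) ?_ ?_ ?_)
        (Submodule.span_mono ?_)
      · rw [Submodule.span_le]
        rintro _ ⟨X, hX, Y, hY, rfl⟩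
        exact hMst X (hMk hX) Y hY
      · intro K hK X hX
        induction hX using Submodule.span_induction with
        | mem x hx =>
          obtain ⟨A, hA, B, hB, rfl⟩ := hx
          rw [leibniz_lie]
          exact Submodule.add_mem _ (Submodule.subset_span ⟨_, hMst K hK A hA, B, hB, rfl⟩)
            (Submodule.subset_span ⟨A, hA, _, hMst K hK B hB, rfl⟩)
        | zero => simp
        | add x y _ _ h1 h2 => rw [lie_add]; exact Submodule.add_mem _ h1 h2
        | smul a x _ h1 => rw [lie_smul]; exact Submodule.smul_mem _ a h1
      · exact ⟨_, Submodule.subset_span ⟨X₁, hX₁, Y₁, hY₁, rfl⟩, h01⟩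
      · rintro _ ⟨X, hX, Y, hY, rfl⟩
        exact ⟨X, hMk hX, Y, hMk hY, rfl⟩
    · exact fun X hX Y hY => hMst X (derivedSubmodule_le hX) Y hY
    · refine ⟨fun I => ?_, fun h => h01 (congrArg Subtype.val (h.trivial ⟨X₁, hX₁⟩ ⟨Y₁, hY₁⟩))⟩
      rw [or_iff_not_imp_left]
      intro hI
      obtain ⟨x, hx, hx0⟩ := Submodule.exists_mem_ne_zero_of_ne_bot
        (p := I.toSubmodule) (fun h => hI ((LieSubmodule.toSubmodule_eq_bot _).1 h))
      -- By `hdec` an ideal of `M` is `𝔨`-stable, so minimality applies to it.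
      have hle := hmin (I.toSubmodule.map 𝔩.toSubmodule.subtype) (by
        rintro _ ⟨y, -, rfl⟩
        exact y.2) (by
        rintro K hK _ ⟨y, hy, rfl⟩
        obtain ⟨u, hu, v, rfl, hv⟩ := hdec K hK
        refine ⟨⁅(⟨u, hu⟩ : 𝔩), y⁆, I.lie_mem hy, ?_⟩
        change ⁅u, (y : V)⁆ = ⁅v + u, (y : V)⁆
        rw [add_lie, hv _ y.2, zero_add]) ⟨x, ⟨x, hx, rfl⟩, fun h => hx0 (Subtype.ext h)⟩
      rw [eq_top_iff]
      intro y _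
      obtain ⟨z, hz, hzy⟩ := hle y.2
      rwa [← Subtype.ext hzy]

theorem isCentral_lie_p {Z : V} (hZ : IsCentral 𝔨 Z) {K P : V}
    (hK : K ∈ 𝔨) : ⁅K, ⁅Z, P⁆⁆ = ⁅Z, ⁅K, P⁆⁆ := by
  rw [leibniz_lie K Z P, ← lie_skew K Z, hZ.2 K hK, neg_zero, zero_lie, zero_add]

/-- In a simple Lie algebra, the centre of `𝔨` is at most one-dimensional. -/
theorem IsCartanDecomposition.exists_smul_of_isCentral (hC : IsCartanDecomposition 𝔨)
    (hS : LieAlgebra.IsSimple ℝ V) (hp : ∃ X, X ∉ 𝔨) {X Y : V} (hX : IsCentral 𝔨 X) (h0 : X ≠ 0)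
    (hY : IsCentral 𝔨 Y) : ∃ c : ℝ, Y = c • X := by
  have hpne : ∃ P ∈ killingCompl 𝔨, ⁅X, P⁆ ≠ 0 := by
    by_contra! h
    refine h0 (hC.eq_zero_of_trivial_on_p hS hp (W := Submodule.span ℝ {X}) ?_ ?_ ?_
      (Submodule.mem_span_singleton_self X))
    · rw [Submodule.span_singleton_le_iff_mem]
      exact hX.1
    · intro K hK Z hZ
      obtain ⟨a, rfl⟩ := Submodule.mem_span_singleton.1 hZ
      rw [lie_smul, ← lie_skew, hX.2 K hK]
      simp
    · intro Z hZ P hP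
      obtain ⟨a, rfl⟩ := Submodule.mem_span_singleton.1 hZ
      rw [lie_smul, ← lie_skew, h P hP]
      simp
  obtain ⟨P₀, hP₀, hXP₀⟩ := hpne
  have hXp : ∀ P ∈ killingCompl 𝔨, ⁅X, P⁆ ∈ killingCompl 𝔨 := hC.lie_k_p X hX.1
  -- `ad X` commutes with `𝔨` on `𝔭`, so its image there is a nonzero submodule, hence all of `𝔭`.
  have hsurj : killingCompl 𝔨 ≤ (killingCompl 𝔨).map (LieAlgebra.ad ℝ V X) := by
    refine hC.irreducible_p hS ?_ ?_ ⟨_, ⟨P₀, hP₀, rfl⟩, hXP₀⟩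
    · rintro _ ⟨P, hP, rfl⟩
      exact hXp P hP
    · rintro K hK _ ⟨P, hP, rfl⟩
      refine ⟨⁅K, P⁆, hC.lie_k_p K hK P hP, ?_⟩
      exact (isCentral_lie_p hX hK).symm
  -- Commuting of `ad X` and `ad Y` makes `B(⁅X, P⁆, ⁅Y, P'⁆)` symmetric in `P` and `P'`; centrality
  -- makes it invariant, so Schur's lemma applies.
  have hform : ∀ Y, IsCentral 𝔨 Y → ∃ c : ℝ, ∀ P ∈ killingCompl 𝔨, ∀ P' ∈ killingCompl 𝔨,
      killingForm ℝ V ⁅X, P⁆ ⁅Y, P'⁆ = c * killingForm ℝ V P P' := by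
    intro Y hY
    have hcomm : ∀ P, ⁅X, ⁅Y, P⁆⁆ = ⁅Y, ⁅X, P⁆⁆ := fun P => isCentral_lie_p hY hX.1
    refine schur_form (f := (killingForm ℝ V).compl₁₂ (LieAlgebra.ad ℝ V X) (LieAlgebra.ad ℝ V Y))
      (𝔨 := 𝔨) ⟨P₀, hP₀, fun h => hXP₀ (by rw [h, lie_zero])⟩
      (fun U hU h1 h2 => hC.irreducible_p hS hU h1 h2) hC.lie_k_p
      (fun X _ Y _ => killing_symm X Y) hC.pos (fun K _ X _ Y _ => killing_lie_skew K X Y) ?_ ?_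
    · intro P _ P' _
      have h1 := killing_lie_skew X P ⁅Y, P'⁆
      have h2 := killing_lie_skew Y P ⁅X, P'⁆
      rw [hcomm] at h1
      simp only [LinearMap.compl₁₂_apply, LieAlgebra.ad_apply]
      rw [killing_symm ⁅X, P'⁆]
      linarith
    · intro K hK P _ P' _
      simp only [LinearMap.compl₁₂_apply, LieAlgebra.ad_apply]
      rw [← isCentral_lie_p hX hK, ← isCentral_lie_p hY hK]
      exact killing_lie_skew K _ _
  obtain ⟨a, ha⟩ := hform X hX
  obtain ⟨c, hc⟩ := hform Y hY
  have ha0 : a ≠ 0 := by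
    rintro rfl
    have := hC.pos _ (hXp P₀ hP₀) hXP₀
    rw [ha P₀ hP₀ P₀ hP₀, zero_mul] at this
    exact lt_irrefl _ this
  -- With this coefficient `⁅Y - (c/a)X, P⁆` is orthogonal to `⁅X, 𝔭⁆ = 𝔭`, so the central element
  -- `Y - (c/a)X` annihilates `𝔭` and must vanish.
  refine ⟨c / a, ?_⟩
  rw [← sub_eq_zero]
  have hZ : IsCentral 𝔨 (Y - (c / a) • X) := by
    refine ⟨𝔨.sub_mem hY.1 (𝔨.smul_mem _ hX.1), fun K hK => ?_⟩
    rw [sub_lie, smul_lie, hY.2 K hK, hX.2 K hK]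
    simp
  refine hC.eq_zero_of_trivial_on_p hS hp (W := Submodule.span ℝ {Y - (c / a) • X}) ?_ ?_ ?_
    (Submodule.mem_span_singleton_self _)
  · rw [Submodule.span_singleton_le_iff_mem]
    exact hZ.1
  · intro K hK Z hZ'
    obtain ⟨a, rfl⟩ := Submodule.mem_span_singleton.1 hZ'
    rw [lie_smul, ← lie_skew, hZ.2 K hK]
    simp
  · intro Z hZ' P hP
    obtain ⟨t, rfl⟩ := Submodule.mem_span_singleton.1 hZ'
    rw [lie_smul, ← lie_skew]
    have hmem := hC.lie_k_p _ hZ.1 P hP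
    have h1 : ⁅Y - (c / a) • X, P⁆ = 0 := by
      by_contra hne
      refine (hC.pos _ hmem hne).ne' ?_
      obtain ⟨P', hP', hPP'⟩ := hsurj hmem
      have h2 : ∀ Q, killingForm ℝ V ⁅Y - (c / a) • X, P⁆ Q = killingForm ℝ V ⁅X, P'⁆ Q := by
        rw [← hPP']; exact fun _ => rfl
      rw [h2, sub_lie, smul_lie, map_sub, map_smul, hc P' hP' P hP,
        ha P' hP' P hP, smul_eq_mul]
      field_simp
      ring
    rw [h1]
    simp

end IdealStructure
-- The decomposition of `𝔨` and the constants `κᵢ`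
section IdealData

variable {V : Type*} [LieRing V] [LieAlgebra ℝ V] [FiniteDimensional ℝ V]

/-- The projection to `𝔭` along `𝔨`. -/
noncomputable def IsCartanDecomposition.projP {𝔨 : LieSubalgebra ℝ V}
    (hC : IsCartanDecomposition 𝔨) : V →ₗ[ℝ] V := Submodule.projection _ _ hC.isCompl

/-- The projection to `𝔨` along `𝔭`. -/
noncomputable def IsCartanDecomposition.projK {𝔨 : LieSubalgebra ℝ V}
    (hC : IsCartanDecomposition 𝔨) : V →ₗ[ℝ] V := Submodule.projection _ _ hC.isCompl.symm

section Projections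

variable {𝔨 : LieSubalgebra ℝ V} (hC : IsCartanDecomposition 𝔨)

theorem IsCartanDecomposition.projP_mem (X : V) : hC.projP X ∈ killingCompl 𝔨 :=
  Submodule.projection_apply_mem hC.isCompl X

theorem IsCartanDecomposition.projK_mem (X : V) : hC.projK X ∈ 𝔨 :=
  Submodule.projection_apply_mem hC.isCompl.symm X

theorem IsCartanDecomposition.projP_p {X : V} (hX : X ∈ killingCompl 𝔨) : hC.projP X = X :=
  Submodule.projection_apply_of_mem_left hC.isCompl hX

theorem IsCartanDecomposition.projP_k {X : V} (hX : X ∈ 𝔨) : hC.projP X = 0 :=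
  (Submodule.projection_apply_eq_zero_iff hC.isCompl).2 hX

theorem IsCartanDecomposition.projK_k {X : V} (hX : X ∈ 𝔨) : hC.projK X = X :=
  Submodule.projection_apply_of_mem_left hC.isCompl.symm hX

theorem IsCartanDecomposition.projK_p {X : V} (hX : X ∈ killingCompl 𝔨) : hC.projK X = 0 :=
  (Submodule.projection_apply_eq_zero_iff hC.isCompl.symm).2 hX

theorem IsCartanDecomposition.projP_add_projK (X : V) : hC.projP X + hC.projK X = X :=
  Submodule.projection_add_projection_eq_self hC.isCompl X

theorem IsCartanDecomposition.projK_lie {K : V} (hK : K ∈ 𝔨) (X : V) :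
    hC.projK ⁅K, X⁆ = ⁅K, hC.projK X⁆ := by
  conv_lhs => rw [← hC.projP_add_projK X, lie_add, map_add,
    hC.projK_p (hC.lie_k_p K hK _ (hC.projP_mem X)), zero_add,
    hC.projK_k (𝔨.lie_mem hK (hC.projK_mem X))]

theorem IsCartanDecomposition.projP_lie {K : V} (hK : K ∈ 𝔨) (X : V) :
    hC.projP ⁅K, X⁆ = ⁅K, hC.projP X⁆ := by
  conv_lhs => rw [← hC.projP_add_projK X, lie_add, map_add,
    hC.projP_p (hC.lie_k_p K hK _ (hC.projP_mem X)),
    hC.projP_k (𝔨.lie_mem hK (hC.projK_mem X)), add_zero]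

theorem IsCartanDecomposition.Q_apply (X Y : V) :
    hC.Q X Y = killingForm ℝ V (hC.projP X) (hC.projP Y)
      - killingForm ℝ V (hC.projK X) (hC.projK Y) := rfl

end Projections

/-- Trace of a composition with an orthogonal projection. -/
theorem exists_trace_comp_proj {W : Submodule ℝ V} {q : LinearMap.BilinForm ℝ V}
    (hs : ∀ X ∈ W, ∀ Y ∈ W, q X Y = q Y X) (hp : ∀ X ∈ W, X ≠ 0 → 0 < q X X) {P : V →ₗ[ℝ] V}
    (hPW : ∀ X, P X ∈ W) (hPq : ∀ X, ∀ Y ∈ W, q (P X) Y = q X Y) :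
    ∃ b : Fin (Module.finrank ℝ W) → V, (∀ i, b i ∈ W) ∧
      (∀ i j, q (b i) (b j) = if i = j then 1 else 0) ∧
      (∀ X ∈ W, X = ∑ i, q X (b i) • b i) ∧
      ∀ T : V →ₗ[ℝ] V, LinearMap.trace ℝ V (T ∘ₗ P) = ∑ i, q (T (b i)) (b i) := by
  obtain ⟨b, μ, -, hb⟩ := exists_orthonormal_eigenbasis (W := W) (q := q.restrict W)
    (fun X Y => hs X X.2 Y Y.2) (fun X hX => hp X X.2 fun h => hX (Subtype.ext h))
    (H := LinearMap.id) (fun X Y => rfl)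
  have hrepr : ∀ (X : W) i, b.repr X i = q X (b i) := by
    intro X i
    have : b.coord i = (q.restrict W).flip (b i) := by
      refine b.ext fun j => ?_
      change _ = q.restrict W (b j) (b i)
      rw [hb]
      simp [Finsupp.single_apply]
    exact DFunLike.congr_fun this X
  refine ⟨fun i => b i, fun i => (b i).2, hb, fun X hX => ?_, fun T => ?_⟩
  · have := congrArg Subtype.val (b.sum_repr ⟨X, hX⟩)
    simp only [hrepr, Submodule.coe_sum, Submodule.coe_smul] at this
    exact this.symm
  -- `T ∘ P` has the trace of `P ∘ T`, whose range lies in `W`, so the trace can be computed on `W`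
  -- alone.
  rw [LinearMap.trace_comp_comm', ← LinearMap.trace_restrict_eq_of_forall_mem W (P ∘ₗ T)
    (fun X => hPW _) (fun X _ => hPW _), LinearMap.trace_eq_matrix_trace ℝ b, Matrix.trace]
  refine Finset.sum_congr rfl fun i _ => ?_
  rw [Matrix.diag_apply, LinearMap.toMatrix_apply, hrepr]
  exact hPq _ _ (b i).2

/-- The properties of the decomposition of `𝔨` into its simple ideals and its centre that the
curvature computation uses. -/
structure IdealData {𝔨 : LieSubalgebra ℝ V} (hC : IsCartanDecomposition 𝔨) {m : ℕ}
    (𝔣 : Fin m → LieSubalgebra ℝ V) (κ : Fin m → ℝ) : Prop where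
  ne_top : ∃ X, X ∉ 𝔨
  simple : LieAlgebra.IsSimple ℝ V
  le : ∀ i, ∀ X ∈ 𝔣 i, X ∈ 𝔨
  ne_bot : ∀ i, ∃ X ∈ 𝔣 i, X ≠ 0
  lie_mem : ∀ i, ∀ K ∈ 𝔨, ∀ X ∈ 𝔣 i, ⁅K, X⁆ ∈ 𝔣 i
  lie_eq_zero : ∀ i j, i ≠ j → ∀ X ∈ 𝔣 i, ∀ Y ∈ 𝔣 j, ⁅X, Y⁆ = 0
  orth : ∀ i j, i ≠ j → ∀ X ∈ 𝔣 i, ∀ Y ∈ 𝔣 j, killingForm ℝ V X Y = 0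
  simple_or : ∀ i j, i ≠ j → LieAlgebra.IsSimple ℝ (𝔣 i) ∨ LieAlgebra.IsSimple ℝ (𝔣 j)
  span : 𝔨.toSubmodule ≤ ⨆ i, (𝔣 i).toSubmodule
  irreducible : ∀ i, ∀ U ≤ (𝔣 i).toSubmodule, (∀ K ∈ 𝔨, ∀ X ∈ U, ⁅K, X⁆ ∈ U) →
    (∃ X ∈ U, X ≠ 0) → (𝔣 i).toSubmodule ≤ U
  trace_k : ∀ i, ∀ X ∈ 𝔣 i, ∀ Y ∈ 𝔣 i,
    LinearMap.trace ℝ V (LieAlgebra.ad ℝ V X ∘ₗ LieAlgebra.ad ℝ V Y ∘ₗ hC.projK)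
      = κ i * killingForm ℝ V X Y
  kappa_lt : ∀ i, κ i < 1

section Construction

variable {𝔨 : LieSubalgebra ℝ V} {r s : ℕ} {𝔣 : Fin (r + s) → LieSubalgebra ℝ V}

theorem IsIdealList.cases (h : IsIdealList 𝔨 r s 𝔣) (i : Fin (r + s)) :
    IsSimpleIdealOfDerived 𝔨 (𝔣 i) ∨
      ((∀ X, X ∈ 𝔣 i ↔ IsCentral 𝔨 X) ∧ ∃ X ∈ 𝔣 i, X ≠ 0) := by
  refine Fin.addCases (fun j => ?_) (fun j => ?_) i
  · exact Or.inl ((h.simple _).2 ⟨j, rfl⟩)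
  · refine Or.inr ⟨h.centre j, ?_⟩
    rcases h.card_centre with ⟨h1, -⟩ | ⟨-, X, hX, h0⟩
    · subst h1
      exact j.elim0
    · exact ⟨X, (h.centre j X).2 hX, h0⟩

theorem IsIdealList.cases_ne (h : IsIdealList 𝔨 r s 𝔣) {i j : Fin (r + s)} (hij : i ≠ j) :
    (IsSimpleIdealOfDerived 𝔨 (𝔣 i) ∧ IsSimpleIdealOfDerived 𝔨 (𝔣 j) ∧ 𝔣 i ≠ 𝔣 j) ∨
    (IsSimpleIdealOfDerived 𝔨 (𝔣 i) ∧ ∀ X ∈ 𝔣 j, IsCentral 𝔨 X) ∨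
    (IsSimpleIdealOfDerived 𝔨 (𝔣 j) ∧ ∀ X ∈ 𝔣 i, IsCentral 𝔨 X) := by
  revert hij
  refine Fin.addCases (fun a => ?_) (fun a => ?_) i <;>
  refine Fin.addCases (fun b => ?_) (fun b => ?_) j <;> intro hij
  · refine Or.inl ⟨(h.simple _).2 ⟨a, rfl⟩, (h.simple _).2 ⟨b, rfl⟩, fun he => hij ?_⟩
    rw [h.injective he]
  · exact Or.inr (Or.inl ⟨(h.simple _).2 ⟨a, rfl⟩, fun X => (h.centre b X).1⟩)
  · exact Or.inr (Or.inr ⟨(h.simple _).2 ⟨b, rfl⟩, fun X => (h.centre a X).1⟩)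
  · exfalso
    apply hij
    congr 1
    rcases h.card_centre with ⟨rfl, -⟩ | ⟨rfl, -⟩
    · exact a.elim0
    · exact Subsingleton.elim a b

theorem IsIdealList.le (h : IsIdealList 𝔨 r s 𝔣) (i : Fin (r + s)) {X : V} (hX : X ∈ 𝔣 i) :
    X ∈ 𝔨 := by
  rcases h.cases i with h1 | ⟨h1, -⟩
  · exact h1.le hX
  · exact ((h1 X).1 hX).1

theorem IsIdealList.lie_mem (h : IsIdealList 𝔨 r s 𝔣) (i : Fin (r + s)) {K X : V} (hK : K ∈ 𝔨)
    (hX : X ∈ 𝔣 i) : ⁅K, X⁆ ∈ 𝔣 i := by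
  rcases h.cases i with h1 | ⟨h1, -⟩
  · exact h1.lie_mem hK hX
  · rw [← lie_skew, ((h1 X).1 hX).2 K hK, neg_zero]
    exact (𝔣 i).zero_mem

theorem IsIdealList.lie_eq_zero (h : IsIdealList 𝔨 r s 𝔣) {i j : Fin (r + s)} (hij : i ≠ j)
    {X Y : V} (hX : X ∈ 𝔣 i) (hY : Y ∈ 𝔣 j) : ⁅X, Y⁆ = 0 := by
  rcases h.cases_ne hij with ⟨h1, h2, h3⟩ | ⟨h1, h2⟩ | ⟨h1, h2⟩
  · exact h1.lie_eq_zero h2 h3 hX hY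
  · rw [← lie_skew, (h2 Y hY).2 X (h1.le hX), neg_zero]
  · exact (h2 X hX).2 Y (h1.le hY)

theorem IsIdealList.orth (h : IsIdealList 𝔨 r s 𝔣) {i j : Fin (r + s)} (hij : i ≠ j)
    {X Y : V} (hX : X ∈ 𝔣 i) (hY : Y ∈ 𝔣 j) : killingForm ℝ V X Y = 0 := by
  have key : ∀ {i j}, i ≠ j → IsSimpleIdealOfDerived 𝔨 (𝔣 i) → ∀ {X Y}, X ∈ 𝔣 i → Y ∈ 𝔣 j →
      killingForm ℝ V X Y = 0 := fun hij hi X Y hX hY =>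
    killing_eq_zero_of_simple hi.2.2 (fun X hX => h.lie_eq_zero hij hX hY) hX
  rcases h.cases_ne hij with ⟨h1, -, -⟩ | ⟨h1, -⟩ | ⟨h1, -⟩
  · exact key hij h1 hX hY
  · exact key hij h1 hX hY
  · rw [killing_symm]
    exact key hij.symm h1 hY hX

/-- The orthogonal complement in `𝔨` of the sum `M` of the listed ideals is `𝔨`-stable. If nonzero,
it would contain a central element or a simple ideal, both already in `M`, whereas `B` is definite
on `M`. -/
theorem IsIdealList.span_eq (h : IsIdealList 𝔨 r s 𝔣) (hC : IsCartanDecomposition 𝔨) :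
    𝔨.toSubmodule ≤ ⨆ i, (𝔣 i).toSubmodule := by
  set M : Submodule ℝ V := ⨆ i, (𝔣 i).toSubmodule with hM
  have hle : ∀ i, (𝔣 i).toSubmodule ≤ M := fun i => le_iSup (fun i => (𝔣 i).toSubmodule) i
  have hMk : M ≤ 𝔨.toSubmodule := iSup_le fun i X hX => h.le i hX
  have hMst : ∀ K ∈ 𝔨, ∀ X ∈ M, ⁅K, X⁆ ∈ M := by
    intro K hK X hX
    refine Submodule.iSup_induction (fun i => (𝔣 i).toSubmodule) (motive := fun X => ⁅K, X⁆ ∈ M) hX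
      (fun i X hX => hle i (h.lie_mem i hK hX)) (by simp) fun X Y h1 h2 => ?_
    rw [lie_add]
    exact M.add_mem h1 h2
  have hcompl := exists_add_orthogonal (b := killingForm ℝ V) killing_symm (W := M)
    fun X hX h0 => (hC.neg X (hMk hX) h0).ne
  have hself : ∀ X ∈ M, X ∈ (killingForm ℝ V).orthogonal M → X = 0 := fun X h1 h2 =>
    (Submodule.disjoint_def.1 hcompl.disjoint) X h1 h2
  have hzero : ∀ X ∈ 𝔨, X ∈ (killingForm ℝ V).orthogonal M → X = 0 := by
    by_contra! hne
    obtain ⟨X, hX, hXo, h0⟩ := hne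
    rcases hC.exists_central_or_simple (U := 𝔨.toSubmodule ⊓ (killingForm ℝ V).orthogonal M)
      inf_le_left (by
        rintro K hK Y ⟨hY, hYo⟩
        refine ⟨𝔨.lie_mem hK hY, fun Z hZ => ?_⟩
        have h1 := killing_lie_skew K Z Y
        have h2 : killingForm ℝ V ⁅K, Z⁆ Y = 0 := hYo _ (hMst K hK Z hZ)
        have h3 : killingForm ℝ V Z ⁅K, Y⁆ = 0 := by linarith
        exact h3) ⟨X, ⟨hX, hXo⟩, h0⟩ with ⟨Z, hZ, hZc, hZ0⟩ | ⟨𝔩, h𝔩, hle'⟩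
    · rcases h.card_centre with ⟨-, h1⟩ | ⟨rfl, -⟩
      · exact hZ0 (h1 Z hZc)
      · exact hZ0 (hself Z (hle _ ((h.centre 0 Z).2 hZc)) hZ.2)
    · obtain ⟨i, rfl⟩ := (h.simple 𝔩).1 h𝔩
      obtain ⟨A, hA, B, hB, hAB⟩ := exists_ne_zero_of_simple h𝔩.2.2
      have hmem := (𝔣 (Fin.castAdd s i)).lie_mem hA hB
      exact hAB (hself _ (hle _ hmem) (hle' hmem).2)
  intro X hX
  obtain ⟨u, hu, v, hv, rfl⟩ := Submodule.mem_sup.1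
    (hcompl.sup_eq_top ▸ Submodule.mem_top : X ∈ M ⊔ (killingForm ℝ V).orthogonal M)
  have hvk : v ∈ 𝔨 := by
    have := 𝔨.sub_mem hX (hMk hu)
    simpa using this
  rw [hzero v hvk hv, add_zero]
  exact hu

/-- For a simple ideal this is simplicity; for the centre it is the fact that the centre is a line.
-/
theorem IsIdealList.irreducible (h : IsIdealList 𝔨 r s 𝔣) (hC : IsCartanDecomposition 𝔨)
    (hS : LieAlgebra.IsSimple ℝ V) (hp : ∃ X, X ∉ 𝔨) (i : Fin (r + s)) {U : Submodule ℝ V}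
    (hU : U ≤ (𝔣 i).toSubmodule) (hst : ∀ K ∈ 𝔨, ∀ X ∈ U, ⁅K, X⁆ ∈ U) (hne : ∃ X ∈ U, X ≠ 0) :
    (𝔣 i).toSubmodule ≤ U := by
  obtain ⟨X, hX, h0⟩ := hne
  rcases h.cases i with h1 | ⟨h1, -⟩
  · exact le_of_stable_of_simple h1.2.2 (fun K hK X hX _ => hst K (h.le i hK) X hX)
      ⟨X, hX, hU hX, h0⟩
  · intro Y hY
    obtain ⟨c, rfl⟩ := hC.exists_smul_of_isCentral hS hp ((h1 X).1 (hU hX)) h0 ((h1 Y).1 hY)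
    exact U.smul_mem c hX

theorem ad_lie_comp (X Y : V) : LieAlgebra.ad ℝ V ⁅X, Y⁆
    = LieAlgebra.ad ℝ V X ∘ₗ LieAlgebra.ad ℝ V Y - LieAlgebra.ad ℝ V Y ∘ₗ LieAlgebra.ad ℝ V X := by
  ext Z
  simp

/-- The bilinear form `(X, Y) ↦ tr (ad X ∘ ad Y ∘ S)`. -/
noncomputable def traceWith (S : V →ₗ[ℝ] V) : LinearMap.BilinForm ℝ V :=
  LinearMap.mk₂ ℝ (fun X Y => LinearMap.trace ℝ V
      (LieAlgebra.ad ℝ V X ∘ₗ LieAlgebra.ad ℝ V Y ∘ₗ S))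
    (fun X X' Y => by simp [LinearMap.add_comp])
    (fun c X Y => by simp [LinearMap.smul_comp])
    (fun X Y Y' => by simp [LinearMap.add_comp, LinearMap.comp_add])
    (fun c X Y => by simp [LinearMap.smul_comp, LinearMap.comp_smul])

theorem traceWith_apply (S : V →ₗ[ℝ] V) (X Y : V) : traceWith S X Y = LinearMap.trace ℝ V
      (LieAlgebra.ad ℝ V X ∘ₗ LieAlgebra.ad ℝ V Y ∘ₗ S) := rfl

/-- Expanding the commutators leaves terms that cancel by cyclicity of the trace, because `S`
commutes with `ad K`. -/
theorem traceWith_lie {S : V →ₗ[ℝ] V} {K : V}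
    (hS : S ∘ₗ LieAlgebra.ad ℝ V K = LieAlgebra.ad ℝ V K ∘ₗ S) (X Y : V) :
    traceWith S ⁅K, X⁆ Y + traceWith S X ⁅K, Y⁆ = 0 := by
  simp only [traceWith_apply, ad_lie_comp, LinearMap.sub_comp, LinearMap.comp_sub, map_sub]
  have h1 : LinearMap.trace ℝ V ((LieAlgebra.ad ℝ V K ∘ₗ LieAlgebra.ad ℝ V X) ∘ₗ
      LieAlgebra.ad ℝ V Y ∘ₗ S) = LinearMap.trace ℝ V (LieAlgebra.ad ℝ V X ∘ₗ
      (LieAlgebra.ad ℝ V Y ∘ₗ LieAlgebra.ad ℝ V K) ∘ₗ S) := by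
    rw [LinearMap.comp_assoc, LinearMap.trace_comp_comm', LinearMap.comp_assoc,
      LinearMap.comp_assoc, hS, LinearMap.comp_assoc]
  rw [h1]
  simp only [LinearMap.comp_assoc]
  ring

/-- The trace form of `𝔨` in its adjoint representation, as a form on the whole Lie algebra. -/
noncomputable def IsCartanDecomposition.traceK (hC : IsCartanDecomposition 𝔨) :
    LinearMap.BilinForm ℝ V := traceWith hC.projK

theorem IsCartanDecomposition.traceK_apply (hC : IsCartanDecomposition 𝔨) (X Y : V) :
    hC.traceK X Y = LinearMap.trace ℝ V
      (LieAlgebra.ad ℝ V X ∘ₗ LieAlgebra.ad ℝ V Y ∘ₗ hC.projK) := rfl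

theorem IsCartanDecomposition.projK_ad (hC : IsCartanDecomposition 𝔨) {K : V} (hK : K ∈ 𝔨) :
    hC.projK ∘ₗ LieAlgebra.ad ℝ V K = LieAlgebra.ad ℝ V K ∘ₗ hC.projK :=
  LinearMap.ext fun X => hC.projK_lie hK X

theorem IsCartanDecomposition.traceK_symm (hC : IsCartanDecomposition 𝔨) {X Y : V} (hX : X ∈ 𝔨) :
    hC.traceK X Y = hC.traceK Y X := by
  rw [traceK_apply, traceK_apply, LinearMap.trace_comp_comm', LinearMap.comp_assoc,
    hC.projK_ad hX]

theorem IsCartanDecomposition.traceK_lie (hC : IsCartanDecomposition 𝔨) {K X Y : V} (hK : K ∈ 𝔨) :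
    hC.traceK ⁅K, X⁆ Y + hC.traceK X ⁅K, Y⁆ = 0 :=
  traceWith_lie (hC.projK_ad hK) X Y

/-- The operator `ad X ∘ ad Y ∘ projK` takes values in the ideal, so its trace is that of its
restriction, which is the product of the intrinsic adjoint operators. -/
theorem IsIdealList.killing_eq_traceK (h : IsIdealList 𝔨 r s 𝔣) (hC : IsCartanDecomposition 𝔨)
    (i : Fin (r + s)) (X Y : 𝔣 i) : killingForm ℝ (𝔣 i) X Y = hC.traceK X Y := by
  have hmem : ∀ Z, (LieAlgebra.ad ℝ V X ∘ₗ LieAlgebra.ad ℝ V Y ∘ₗ hC.projK) Z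
      ∈ (𝔣 i).toSubmodule := by
    intro Z
    refine h.lie_mem i (h.le i X.2) ?_
    change ⁅(Y : V), hC.projK Z⁆ ∈ 𝔣 i
    rw [← lie_skew]
    exact (𝔣 i).neg_mem (h.lie_mem i (hC.projK_mem Z) Y.2)
  rw [hC.traceK_apply, ← LinearMap.trace_restrict_eq_of_forall_mem (𝔣 i).toSubmodule _ hmem
    (fun Z _ => hmem Z), LieModule.traceForm_apply_apply]
  refine congrArg (LinearMap.trace ℝ (𝔣 i)) (LinearMap.ext fun Z => Subtype.ext ?_)
  change ⁅(X : V), ⁅(Y : V), (Z : V)⁆⁆ = ⁅(X : V), ⁅(Y : V), hC.projK (Z : V)⁆⁆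
  rw [hC.projK_k (h.le i Z.2)]

/-- Schur's lemma on the ideal shows that a constant as in the definition of `kappa` exists, so the
value chosen there has the defining property. -/
theorem IsIdealList.trace_k (h : IsIdealList 𝔨 r s 𝔣) (hC : IsCartanDecomposition 𝔨)
    (hS : LieAlgebra.IsSimple ℝ V) (hp : ∃ X, X ∉ 𝔨) (i : Fin (r + s)) {X Y : V} (hX : X ∈ 𝔣 i)
    (hY : Y ∈ 𝔣 i) : hC.traceK X Y = kappa (𝔣 i) * killingForm ℝ V X Y := by
  have hne : ∃ X ∈ (𝔣 i).toSubmodule, X ≠ 0 := by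
    rcases h.cases i with h1 | ⟨-, h1⟩
    · obtain ⟨A, hA, B, hB, h0⟩ := exists_ne_zero_of_simple h1.2.2
      exact ⟨_, (𝔣 i).lie_mem hA hB, h0⟩
    · exact h1
  obtain ⟨c, hc⟩ := schur_form (W := (𝔣 i).toSubmodule) (q := -killingForm ℝ V) (f := hC.traceK)
    (𝔨 := 𝔨) hne (fun U h1 h2 h3 => h.irreducible hC hS hp i h1 h2 h3)
    (fun K hK X hX => h.lie_mem i hK hX)
    (fun X _ Y _ => by simp only [LinearMap.neg_apply, killing_symm X Y])
    (fun X hX h0 => by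
      simp only [LinearMap.neg_apply, neg_pos]
      exact hC.neg X (h.le i hX) h0)
    (fun K _ X _ Y _ => by
      have := killing_lie_skew K X Y
      simp only [LinearMap.neg_apply]
      linarith)
    (fun X hX Y _ => hC.traceK_symm (h.le i hX))
    (fun K hK X _ Y _ => hC.traceK_lie hK)
  have hex : ∃ c : ℝ, ∀ X Y : 𝔣 i,
      killingForm ℝ (𝔣 i) X Y = c * killingForm ℝ V (X : V) (Y : V) := by
    refine ⟨-c, fun X Y => ?_⟩
    rw [h.killing_eq_traceK hC, hc X X.2 Y Y.2]
    simp
  have := Classical.epsilon_spec hex ⟨X, hX⟩ ⟨Y, hY⟩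
  rw [h.killing_eq_traceK hC] at this
  exact this

theorem IsCartanDecomposition.traceK_add (hC : IsCartanDecomposition 𝔨) (X Y : V) :
    hC.traceK X Y + LinearMap.trace ℝ V
      (LieAlgebra.ad ℝ V X ∘ₗ LieAlgebra.ad ℝ V Y ∘ₗ hC.projP) = killingForm ℝ V X Y := by
  rw [hC.traceK_apply, ← map_add, LieModule.traceForm_apply_apply]
  congr 1
  ext Z
  simp only [LinearMap.add_apply, LinearMap.comp_apply, ← map_add]
  rw [add_comm, hC.projP_add_projK]
  rfl

/-- Splitting the trace defining `B` over `𝔨` and `𝔭` gives `(1 - κ) B(X, X) = -∑ⱼ B(⁅X, bⱼ⁆, ⁅X,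
bⱼ⁆)` over an orthonormal basis of `𝔭`. The sum is positive for an `X` acting nontrivially on `𝔭`,
and `B(X, X) < 0`. -/
theorem IsIdealList.kappa_lt (h : IsIdealList 𝔨 r s 𝔣) (hC : IsCartanDecomposition 𝔨)
    (hS : LieAlgebra.IsSimple ℝ V) (hp : ∃ X, X ∉ 𝔨) (i : Fin (r + s)) : kappa (𝔣 i) < 1 := by
  obtain ⟨X, hX, P₀, hP₀, hne⟩ : ∃ X ∈ 𝔣 i, ∃ P ∈ killingCompl 𝔨, ⁅P, X⁆ ≠ 0 := by
    by_contra! h0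
    have hz : ∀ X ∈ (𝔣 i).toSubmodule, X = 0 := fun X hX =>
      hC.eq_zero_of_trivial_on_p hS hp (fun X hX => h.le i hX) (fun K hK X hX => h.lie_mem i hK hX)
        h0 hX
    rcases h.cases i with h1 | ⟨-, X, hX, h1⟩
    · obtain ⟨A, hA, B, hB, h0⟩ := exists_ne_zero_of_simple h1.2.2
      exact h0 (hz _ ((𝔣 i).lie_mem hA hB))
    · exact h1 (hz X hX)
  have hXk := h.le i hX
  have hX0 : X ≠ 0 := by
    rintro rfl
    exact hne (lie_zero P₀)
  obtain ⟨b, hbW, -, hbs, hb⟩ := exists_trace_comp_proj (W := killingCompl 𝔨) (q := killingForm ℝ V)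
    (fun X _ Y _ => killing_symm X Y) hC.pos (P := hC.projP) hC.projP_mem (fun X Y hY => by
      conv_rhs => rw [← hC.projP_add_projK X, map_add, LinearMap.add_apply,
        killing_k_p (hC.projK_mem X) hY, add_zero])
  have h1 := hC.traceK_add X X
  rw [h.trace_k hC hS hp i hX hX, ← LinearMap.comp_assoc, hb] at h1
  have h2 : ∀ j, killingForm ℝ V ((LieAlgebra.ad ℝ V X ∘ₗ LieAlgebra.ad ℝ V X) (b j)) (b j)
      = -killingForm ℝ V ⁅X, b j⁆ ⁅X, b j⁆ := fun j => by
    have := killing_lie_skew X ⁅X, b j⁆ (b j)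
    simp only [LinearMap.comp_apply, LieAlgebra.ad_apply]
    linarith
  have hnn : ∀ j, 0 ≤ killingForm ℝ V ⁅X, b j⁆ ⁅X, b j⁆ := by
    intro j
    rcases eq_or_ne ⁅X, b j⁆ 0 with h0 | h0
    · rw [h0]; simp
    · exact (hC.pos _ (hC.lie_k_p X hXk _ (hbW j)) h0).le
  have hpos : 0 < ∑ j, killingForm ℝ V ⁅X, b j⁆ ⁅X, b j⁆ := by
    refine lt_of_le_of_ne (Finset.sum_nonneg fun j _ => hnn j) fun h0 => hne ?_
    have hz := (Finset.sum_eq_zero_iff_of_nonneg fun j _ => hnn j).1 h0.symm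
    have hzero : ∀ j, ⁅X, b j⁆ = 0 := by
      intro j
      by_contra hj
      exact (hC.pos _ (hC.lie_k_p X hXk _ (hbW j)) hj).ne' (hz j (Finset.mem_univ j))
    rw [← lie_skew, hbs P₀ hP₀, lie_sum]
    simp [hzero]
  simp only [h2, Finset.sum_neg_distrib] at h1
  have h3 := hC.neg X hXk hX0
  nlinarith

theorem IsIdealList.idealData (h : IsIdealList 𝔨 r s 𝔣) (hC : IsCartanDecomposition 𝔨)
    (hS : LieAlgebra.IsSimple ℝ V) (hp : ∃ X, X ∉ 𝔨) :
    IdealData hC 𝔣 (fun i => kappa (𝔣 i)) where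
  ne_top := hp
  simple := hS
  le i X hX := h.le i hX
  ne_bot i := by
    rcases h.cases i with h1 | ⟨-, h1⟩
    · obtain ⟨A, hA, B, hB, h0⟩ := exists_ne_zero_of_simple h1.2.2
      exact ⟨_, (𝔣 i).lie_mem hA hB, h0⟩
    · exact h1
  lie_mem i K hK X hX := h.lie_mem i hK hX
  lie_eq_zero i j hij X hX Y hY := h.lie_eq_zero hij hX hY
  orth i j hij X hX Y hY := h.orth hij hX hY
  simple_or i j hij := by
    rcases h.cases_ne hij with ⟨h1, -, -⟩ | ⟨h1, -⟩ | ⟨h1, -⟩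
    · exact Or.inl h1.2.2
    · exact Or.inl h1.2.2
    · exact Or.inr h1.2.2
  span := h.span_eq hC
  irreducible i U h1 h2 h3 := h.irreducible hC hS hp i h1 h2 h3
  trace_k i X hX Y hY := h.trace_k hC hS hp i hX hY
  kappa_lt i := h.kappa_lt hC hS hp i

end Construction
end IdealData
-- Ricci curvature of a left-invariant metric as a trace
section RicciTrace

variable {V : Type*} [LieRing V] [LieAlgebra ℝ V] [FiniteDimensional ℝ V]

theorem trace_ad_eq_zero (hS : LieAlgebra.IsSimple ℝ V) (W : V) :
    LinearMap.trace ℝ V (LieAlgebra.ad ℝ V W) = 0 := by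
  have hlie : ∀ Z X : V, LinearMap.trace ℝ V (LieAlgebra.ad ℝ V ⁅Z, X⁆) = 0 := fun Z X => by
    rw [ad_lie_comp, map_sub, LinearMap.trace_comp_comm', sub_self]
  have hne : ∃ Z X : V, ⁅Z, X⁆ ≠ 0 := by
    by_contra! h
    exact hS.non_abelian ⟨h⟩
  obtain ⟨Z, X, h0⟩ := hne
  exact eq_univ_of_simple hS
    (W := LinearMap.ker (LinearMap.trace ℝ V ∘ₗ (LieAlgebra.ad ℝ V : V →ₗ[ℝ] Module.End ℝ V)))
    (fun Z X _ => hlie Z X) ⟨_, hlie Z X, h0⟩ W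

theorem trace_eq_zero_of_skew (g : Metric V) {S : V →ₗ[ℝ] V}
    (h : ∀ X Y, g.form (S X) Y + g.form X (S Y) = 0) : LinearMap.trace ℝ V S = 0 := by
  obtain ⟨b, -, -, -, hb⟩ := exists_trace_comp_proj (W := (⊤ : Submodule ℝ V)) (q := g.form)
    (fun X _ Y _ => g.symm X Y) (fun X _ => g.pos X) (P := LinearMap.id)
    (fun _ => Submodule.mem_top) (fun _ _ _ => rfl)
  rw [← LinearMap.comp_id S, hb]
  refine Finset.sum_eq_zero fun i _ => ?_
  have := h (b i) (b i)
  rw [g.symm (b i)] at this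
  linarith

/-- On a unimodular Lie algebra, `Ric(Y, Z)` is minus the trace of `∇Y ∘ ∇Z`. -/
theorem ricci_eq_trace (hS : LieAlgebra.IsSimple ℝ V) (g : Metric V) (Y Z : V) :
    ricci g Y Z
      = -LinearMap.trace ℝ V ((leviCivita g).flip Y ∘ₗ (leviCivita g).flip Z) := by
  -- Torsion-freeness splits `∇_W` as `∇W + ad W`. Since `∇_W` is skew and `ad W` is traceless, `∇W`
  -- is traceless; this removes the first term of the curvature, and the other two combine.
  have hD : ∀ W, leviCivita g W = (leviCivita g).flip W + LieAlgebra.ad ℝ V W := fun W => by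
    ext X
    have := leviCivita_torsion g W X
    simp only [LinearMap.add_apply, LinearMap.flip_apply, LieAlgebra.ad_apply]
    rw [← this]
    abel
  have h0 : ∀ W, LinearMap.trace ℝ V ((leviCivita g).flip W) = 0 := fun W => by
    have h1 := trace_eq_zero_of_skew g (leviCivita_metric g W)
    rwa [hD, map_add, trace_ad_eq_zero hS, add_zero] at h1
  have h1 : LinearMap.trace ℝ V ((leviCivita g).flip Z ∘ₗ LieAlgebra.ad ℝ V Y)
      = LinearMap.trace ℝ V (LieAlgebra.ad ℝ V Y ∘ₗ (leviCivita g).flip Z) :=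
    LinearMap.trace_comp_comm' _ _
  rw [ricci, curvature, map_add, map_sub, h0, h1]
  conv_lhs => rw [hD Y]
  rw [LinearMap.add_comp, map_add]
  ring

theorem ricci_symm (hS : LieAlgebra.IsSimple ℝ V) (g : Metric V) (Y Z : V) :
    ricci g Y Z = ricci g Z Y := by
  rw [ricci_eq_trace hS, ricci_eq_trace hS, LinearMap.trace_comp_comm']

theorem leviCivita_eq (g : Metric V) {X Y W : V}
    (h : ∀ Z, 2 * g.form W Z = g.form ⁅X, Y⁆ Z - g.form ⁅Y, Z⁆ X + g.form ⁅Z, X⁆ Y) :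
    leviCivita g X Y = W := by
  rw [← sub_eq_zero]
  refine g.nondegenerate.1 _ fun Z => ?_
  have h1 := koszul g X Y Z
  have h2 := h Z
  rw [map_sub, LinearMap.sub_apply]
  linarith

end RicciTrace

/-! ### Projections to the ideals of `𝔨` -/

section Projections

variable {V : Type*} [LieRing V] [LieAlgebra ℝ V] [FiniteDimensional ℝ V]
  {𝔨 : LieSubalgebra ℝ V} {hC : IsCartanDecomposition 𝔨} {m : ℕ}
  {𝔣 : Fin m → LieSubalgebra ℝ V} {κ : Fin m → ℝ}

theorem IdealData.isCompl (h : IdealData hC 𝔣 κ) (i : Fin m) :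
    IsCompl (𝔣 i).toSubmodule ((killingForm ℝ V).orthogonal (𝔣 i).toSubmodule) :=
  exists_add_orthogonal killing_symm fun X hX h0 => (hC.neg X (h.le i X hX) h0).ne

/-- The orthogonal projection to the `i`-th ideal. -/
noncomputable def IdealData.proj (h : IdealData hC 𝔣 κ) (i : Fin m) : V →ₗ[ℝ] V :=
  Submodule.projection _ _ (h.isCompl i)

variable (h : IdealData hC 𝔣 κ)

theorem IdealData.proj_mem (i : Fin m) (X : V) : h.proj i X ∈ 𝔣 i :=
  Submodule.projection_apply_mem (h.isCompl i) X

theorem IdealData.proj_self {i : Fin m} {X : V} (hX : X ∈ 𝔣 i) : h.proj i X = X :=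
  Submodule.projection_apply_of_mem_left (h.isCompl i) hX

theorem IdealData.proj_eq_zero {i : Fin m} {X : V}
    (hX : ∀ Y ∈ 𝔣 i, killingForm ℝ V Y X = 0) : h.proj i X = 0 :=
  (Submodule.projection_apply_eq_zero_iff (h.isCompl i)).2 hX

theorem IdealData.proj_p (i : Fin m) {X : V} (hX : X ∈ killingCompl 𝔨) : h.proj i X = 0 :=
  h.proj_eq_zero fun Y hY => killing_k_p (h.le i Y hY) hX

theorem IdealData.proj_ne {i j : Fin m} (hij : i ≠ j) {X : V} (hX : X ∈ 𝔣 j) : h.proj i X = 0 :=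
  h.proj_eq_zero fun Y hY => h.orth i j hij Y hY X hX

theorem IdealData.killing_proj {i : Fin m} (X : V) {Y : V} (hY : Y ∈ 𝔣 i) :
    killingForm ℝ V (h.proj i X) Y = killingForm ℝ V X Y := by
  have h1 := Submodule.projection_add_projection_eq_self (h.isCompl i) X
  have h2 : killingForm ℝ V Y (Submodule.projection _ _ (h.isCompl i).symm X) = 0 :=
    Submodule.projection_apply_mem (h.isCompl i).symm X Y hY
  conv_rhs => rw [← h1, map_add, LinearMap.add_apply, killing_symm _ Y, killing_symm _ Y, h2,
    add_zero, killing_symm]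
  rfl

/-- Linear maps that vanish on every ideal vanish on `𝔨`. -/
theorem IdealData.eqOn_k (h : IdealData hC 𝔣 κ) {W : Type*} [AddCommGroup W] [Module ℝ W] {S T : V →ₗ[ℝ] W}
    (hST : ∀ i, ∀ X ∈ 𝔣 i, S X = T X) {X : V} (hX : X ∈ 𝔨) : S X = T X :=
  Submodule.iSup_induction (fun i => (𝔣 i).toSubmodule) (motive := fun X => S X = T X) (h.span hX)
    hST (by simp) fun X Y h1 h2 => by rw [map_add, map_add, h1, h2]

theorem IsCartanDecomposition.eq_of_eqOn (hC : IsCartanDecomposition 𝔨) {W : Type*}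
    [AddCommGroup W] [Module ℝ W] {S T : V →ₗ[ℝ] W}
    (hp : ∀ X ∈ killingCompl 𝔨, S X = T X) (hk : ∀ X ∈ 𝔨, S X = T X) : S = T := by
  ext X
  rw [← hC.projP_add_projK X, map_add, map_add, hp _ (hC.projP_mem X), hk _ (hC.projK_mem X)]

theorem IdealData.eq_of_eqOn (h : IdealData hC 𝔣 κ) {W : Type*} [AddCommGroup W] [Module ℝ W] {S T : V →ₗ[ℝ] W}
    (hp : ∀ X ∈ killingCompl 𝔨, S X = T X) (hk : ∀ i, ∀ X ∈ 𝔣 i, S X = T X) : S = T :=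
  hC.eq_of_eqOn hp fun _ hX => h.eqOn_k hk hX

theorem IdealData.sum_proj_self (c : Fin m → ℝ) {i : Fin m} {X : V} (hX : X ∈ 𝔣 i) :
    (∑ j, c j • h.proj j) X = c i • X := by
  rw [LinearMap.sum_apply, Finset.sum_eq_single i]
  · rw [LinearMap.smul_apply, h.proj_self hX]
  · intro j _ hj
    rw [LinearMap.smul_apply, h.proj_ne hj hX, smul_zero]
  · exact fun hi => absurd (Finset.mem_univ i) hi

theorem IdealData.sum_proj_p (c : Fin m → ℝ) {X : V} (hX : X ∈ killingCompl 𝔨) :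
    (∑ j, c j • h.proj j) X = 0 := by
  rw [LinearMap.sum_apply]
  exact Finset.sum_eq_zero fun j _ => by rw [LinearMap.smul_apply, h.proj_p j hX, smul_zero]

theorem IdealData.sum_proj_mem (c : Fin m → ℝ) (X : V) : (∑ j, c j • h.proj j) X ∈ 𝔨 := by
  rw [LinearMap.sum_apply]
  exact Submodule.sum_mem 𝔨.toSubmodule fun j _ => 𝔨.smul_mem _ (h.le j _ (h.proj_mem j X))

theorem IdealData.sum_proj_lie (c : Fin m → ℝ) {K : V} (hK : K ∈ 𝔨) (X : V) :
    (∑ j, c j • h.proj j) ⁅K, X⁆ = ⁅K, (∑ j, c j • h.proj j) X⁆ := by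
  refine DFunLike.congr_fun (f := (∑ j, c j • h.proj j) ∘ₗ LieAlgebra.ad ℝ V K)
    (g := LieAlgebra.ad ℝ V K ∘ₗ (∑ j, c j • h.proj j)) (h.eq_of_eqOn ?_ ?_) X
  · intro X hX
    simp only [LinearMap.comp_apply, LieAlgebra.ad_apply]
    rw [h.sum_proj_p c hX, h.sum_proj_p c (hC.lie_k_p K hK X hX), lie_zero]
  · intro i X hX
    simp only [LinearMap.comp_apply, LieAlgebra.ad_apply]
    rw [h.sum_proj_self c hX, h.sum_proj_self c (h.lie_mem i K hK X hX), lie_smul]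

/-- An operator exchanging `𝔭` and `𝔨` has trace zero. -/
theorem IsCartanDecomposition.trace_eq_zero_of_swap (hC : IsCartanDecomposition 𝔨) {S : V →ₗ[ℝ] V}
    (hp : ∀ X ∈ killingCompl 𝔨, S X ∈ 𝔨) (hk : ∀ X ∈ 𝔨, S X ∈ killingCompl 𝔨) :
    LinearMap.trace ℝ V S = 0 := by
  have h1 : S = (S ∘ₗ hC.projP) ∘ₗ hC.projP + (S ∘ₗ hC.projK) ∘ₗ hC.projK := by
    refine hC.eq_of_eqOn (fun X hX => ?_) (fun X hX => ?_)
    · simp [hC.projP_p hX, hC.projK_p hX]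
    · simp [hC.projP_k hX, hC.projK_k hX]
  have h2 : hC.projP ∘ₗ S ∘ₗ hC.projP = 0 :=
    LinearMap.ext fun X => hC.projP_k (hp _ (hC.projP_mem X))
  have h3 : hC.projK ∘ₗ S ∘ₗ hC.projK = 0 :=
    LinearMap.ext fun X => hC.projK_p (hk _ (hC.projK_mem X))
  rw [h1, map_add, LinearMap.trace_comp_comm', h2, LinearMap.trace_comp_comm', h3]
  simp

end Projections
-- Connection and Ricci curvature of a diagonal metric
section DiagonalMetric

variable {V : Type*} [LieRing V] [LieAlgebra ℝ V] [FiniteDimensional ℝ V]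
  {𝔨 : LieSubalgebra ℝ V} {hC : IsCartanDecomposition 𝔨} {m : ℕ}
  {𝔣 : Fin m → LieSubalgebra ℝ V} {κ : Fin m → ℝ}

/-- The metric is `β B` on `𝔭` and `-αᵢ B` on the `i`-th ideal, and these subspaces are
orthogonal. -/
structure IsDiagonalMetric (𝔨 : LieSubalgebra ℝ V) (𝔣 : Fin m → LieSubalgebra ℝ V) (β : ℝ)
    (α : Fin m → ℝ) (g : Metric V) : Prop where
  on_p : ∀ X ∈ killingCompl 𝔨, ∀ Y ∈ killingCompl 𝔨, g.form X Y = β * killingForm ℝ V X Y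
  on_k : ∀ i, ∀ X ∈ 𝔨, ∀ Y ∈ 𝔣 i, g.form X Y = -α i * killingForm ℝ V X Y
  p_k : ∀ X ∈ killingCompl 𝔨, ∀ Y ∈ 𝔨, g.form X Y = 0

/-- The form is invariant under the adjoint action of `𝔨`. -/
def IsLieInvariant (𝔨 : LieSubalgebra ℝ V) (f : LinearMap.BilinForm ℝ V) : Prop :=
  ∀ K ∈ 𝔨, ∀ X Y, f ⁅K, X⁆ Y + f X ⁅K, Y⁆ = 0

/-- By invariance the last two Koszul terms are `g(Z, ⁅Y, X⁆)` and `g(Z, ⁅X, Y⁆)`, which cancel. No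
orthogonality of `𝔨` and `𝔭` enters, so the formula also serves for metrics with a mixed term. -/
theorem IsLieInvariant.koszul_k {g : Metric V} (hinv : IsLieInvariant 𝔨 g.form) {X Y : V}
    (hX : X ∈ 𝔨) (hY : Y ∈ 𝔨) (Z : V) :
    g.form ⁅X, Y⁆ Z - g.form ⁅Y, Z⁆ X + g.form ⁅Z, X⁆ Y = g.form ⁅X, Y⁆ Z := by
  have h1 := hinv Y hY Z X
  have h2 := hinv X hX Z Y
  rw [g.symm Z, ← lie_skew Y X, map_neg, LinearMap.neg_apply] at h1
  rw [g.symm Z] at h2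
  rw [← lie_skew Z X, map_neg, LinearMap.neg_apply]
  linarith

theorem IsLieInvariant.leviCivita_k {g : Metric V} (hinv : IsLieInvariant 𝔨 g.form) {X Y : V}
    (hX : X ∈ 𝔨) (hY : Y ∈ 𝔨) : leviCivita g X Y = (1 / 2 : ℝ) • ⁅X, Y⁆ := by
  refine leviCivita_eq g fun Z => ?_
  rw [hinv.koszul_k hX hY, map_smul, LinearMap.smul_apply, smul_eq_mul]
  ring

/-- Invariance of a diagonal metric. -/
theorem IsDiagonalMetric.invariant {g : Metric V} {β : ℝ} {α : Fin m → ℝ}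
    (hg : IsDiagonalMetric 𝔨 𝔣 β α g) (h : IdealData hC 𝔣 κ) : IsLieInvariant 𝔨 g.form := by
  intro K hK X Y
  have hX : ∀ X, (∀ Y, g.form ⁅K, X⁆ Y + g.form X ⁅K, Y⁆ = 0) ↔
      g.form ⁅K, X⁆ = -(g.form X ∘ₗ LieAlgebra.ad ℝ V K) := fun X => by
    rw [LinearMap.ext_iff]
    exact forall_congr' fun Y => by
      rw [LinearMap.neg_apply, LinearMap.comp_apply, LieAlgebra.ad_apply, eq_neg_iff_add_eq_zero]
  revert Y
  rw [hX]
  refine DFunLike.congr_fun (f := g.form ∘ₗ LieAlgebra.ad ℝ V K)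
    (g := -((LinearMap.lcomp ℝ ℝ (LieAlgebra.ad ℝ V K)) ∘ₗ g.form))
    (h.eq_of_eqOn (fun X hX' => (hX X).1 fun Y => ?_) (fun i X hX' => (hX X).1 fun Y => ?_)) X
  · rw [← hC.projP_add_projK Y]
    simp only [map_add, lie_add, hg.p_k _ hX' _ (𝔨.lie_mem hK (hC.projK_mem Y)),
      hg.p_k _ (hC.lie_k_p K hK X hX') _ (hC.projK_mem Y),
      hg.on_p _ hX' _ (hC.lie_k_p K hK _ (hC.projP_mem Y)),
      hg.on_p _ (hC.lie_k_p K hK X hX') _ (hC.projP_mem Y)]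
    have := killing_lie_skew K X (hC.projP Y)
    linear_combination β * this
  · rw [← hC.projP_add_projK Y]
    have hXk := h.le i X hX'
    have hKX := h.lie_mem i K hK X hX'
    simp only [map_add, lie_add]
    rw [g.symm _ (hC.projP Y), g.symm _ (hC.projK Y), g.symm X, g.symm X,
      hg.p_k _ (hC.projP_mem Y) _ (h.le i _ hKX),
      hg.p_k _ (hC.lie_k_p K hK _ (hC.projP_mem Y)) _ hXk,
      hg.on_k i _ (hC.projK_mem Y) _ hKX, hg.on_k i _ (𝔨.lie_mem hK (hC.projK_mem Y)) _ hX']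
    have := killing_lie_skew K (hC.projK Y) X
    linear_combination -α i * this

section Connection

variable {g : Metric V} {β : ℝ} {α : Fin m → ℝ}

/-- Only `Z ∈ 𝔭` contributes to the Koszul formula. Cyclicity of `B(⁅X, Y⁆, Z)` gives the three
terms the coefficients `β`, `-β` and `-αᵢ`. -/
theorem IsDiagonalMetric.leviCivita_p_k (hg : IsDiagonalMetric 𝔨 𝔣 β α g)
    (h : IdealData hC 𝔣 κ) (hβ : β ≠ 0) {i : Fin m} {X Y : V} (hX : X ∈ killingCompl 𝔨)
    (hY : Y ∈ 𝔣 i) : leviCivita g X Y = -(α i / β / 2) • ⁅X, Y⁆ := by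
  refine leviCivita_eq g fun Z => ?_
  have hYk := h.le i Y hY
  have hXY := hC.lie_p_k hX hYk
  rw [map_smul, LinearMap.smul_apply, smul_eq_mul]
  have key : ∀ Z, (Z ∈ killingCompl 𝔨 ∨ Z ∈ 𝔨) → 2 * (-(α i / β / 2) * g.form ⁅X, Y⁆ Z)
      = g.form ⁅X, Y⁆ Z - g.form ⁅Y, Z⁆ X + g.form ⁅Z, X⁆ Y := by
    rintro Z (hZ | hZ)
    · rw [hg.on_p _ hXY _ hZ, hg.on_p _ (hC.lie_k_p Y hYk Z hZ) _ hX,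
        hg.on_k i _ (hC.lie_p_p Z hZ X hX) _ hY, killing_symm _ X, ← killing_lie, killing_lie Z,
        killing_symm Z]
      field_simp
      ring
    · rw [hg.p_k _ hXY _ hZ, g.symm _ X, hg.p_k _ hX _ (𝔨.lie_mem hYk hZ),
        hg.p_k _ (hC.lie_k_p Z hZ X hX) _ hYk]
      ring
  have h1 := key _ (Or.inl (hC.projP_mem Z))
  have h2 := key _ (Or.inr (hC.projK_mem Z))
  rw [← hC.projP_add_projK Z]
  simp only [lie_add, add_lie, map_add, LinearMap.add_apply]
  linear_combination h1 + h2

theorem IsDiagonalMetric.leviCivita_p_p (hg : IsDiagonalMetric 𝔨 𝔣 β α g)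
    (h : IdealData hC 𝔣 κ) {X Y : V} (hX : X ∈ killingCompl 𝔨)
    (hY : Y ∈ killingCompl 𝔨) : leviCivita g X Y = (1 / 2 : ℝ) • ⁅X, Y⁆ := by
  refine leviCivita_eq g fun Z => ?_
  have hXY := hC.lie_p_p X hX Y hY
  rw [map_smul, LinearMap.smul_apply, smul_eq_mul]
  have key : ∀ Z, (Z ∈ killingCompl 𝔨 ∨ Z ∈ 𝔨) → 2 * (1 / 2 * g.form ⁅X, Y⁆ Z)
      = g.form ⁅X, Y⁆ Z - g.form ⁅Y, Z⁆ X + g.form ⁅Z, X⁆ Y := by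
    rintro Z (hZ | hZ)
    · rw [g.symm ⁅Y, Z⁆, g.symm ⁅Z, X⁆, hg.p_k _ hX _ (hC.lie_p_p Y hY Z hZ),
        hg.p_k _ hY _ (hC.lie_p_p Z hZ X hX)]
      ring
    · have := (hg.invariant h) Z hZ X Y
      rw [← lie_skew Y Z, map_neg, LinearMap.neg_apply, g.symm _ X]
      linarith
  have h1 := key _ (Or.inl (hC.projP_mem Z))
  have h2 := key _ (Or.inr (hC.projK_mem Z))
  rw [← hC.projP_add_projK Z]
  simp only [lie_add, add_lie, map_add, LinearMap.add_apply]
  linear_combination h1 + h2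

theorem IsDiagonalMetric.flip_k (hg : IsDiagonalMetric 𝔨 𝔣 β α g) (h : IdealData hC 𝔣 κ)
    (hβ : β ≠ 0) {i : Fin m} {Y : V} (hY : Y ∈ 𝔣 i) :
    (leviCivita g).flip Y = (α i / β / 2) • (LieAlgebra.ad ℝ V Y ∘ₗ hC.projP)
      - (1 / 2 : ℝ) • (LieAlgebra.ad ℝ V Y ∘ₗ hC.projK) := by
  refine hC.eq_of_eqOn (fun X hX => ?_) (fun X hX => ?_)
  · simp only [LinearMap.flip_apply, LinearMap.sub_apply, LinearMap.smul_apply,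
      LinearMap.comp_apply, LieAlgebra.ad_apply, hC.projP_p hX, hC.projK_p hX]
    rw [hg.leviCivita_p_k h hβ hX hY, ← lie_skew X Y, lie_zero]
    module
  · simp only [LinearMap.flip_apply, LinearMap.sub_apply, LinearMap.smul_apply,
      LinearMap.comp_apply, LieAlgebra.ad_apply, hC.projP_k hX, hC.projK_k hX]
    rw [(hg.invariant h).leviCivita_k hX (h.le i Y hY), ← lie_skew X Y, lie_zero]
    module

theorem IsDiagonalMetric.flip_p (hg : IsDiagonalMetric 𝔨 𝔣 β α g) (h : IdealData hC 𝔣 κ)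
    (hβ : β ≠ 0) {Y : V} (hY : Y ∈ killingCompl 𝔨) :
    (leviCivita g).flip Y = -((1 / 2 : ℝ) • (LieAlgebra.ad ℝ V Y ∘ₗ hC.projP)
      + LieAlgebra.ad ℝ V Y ∘ₗ ∑ i, (1 + α i / β / 2) • h.proj i) := by
  refine h.eq_of_eqOn (fun X hX => ?_) (fun i X hX => ?_)
  · simp only [LinearMap.flip_apply, LinearMap.neg_apply, LinearMap.add_apply,
      LinearMap.smul_apply, LinearMap.comp_apply, LieAlgebra.ad_apply, hC.projP_p hX]
    rw [h.sum_proj_p _ hX, hg.leviCivita_p_p h hX hY, ← lie_skew X Y, lie_zero]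
    module
  · simp only [LinearMap.flip_apply, LinearMap.neg_apply, LinearMap.add_apply,
      LinearMap.smul_apply, LinearMap.comp_apply, LieAlgebra.ad_apply, hC.projP_k (h.le i X hX)]
    have h1 := leviCivita_torsion g X Y
    rw [hg.leviCivita_p_k h hβ hY hX, sub_eq_iff_eq_add, ← lie_skew X Y] at h1
    rw [h.sum_proj_self _ hX, h1, lie_smul, lie_zero]
    module

end Connection

section Ricci

variable {g : Metric V} {β : ℝ} {α : Fin m → ℝ}

/-- Both `∇Y` and `∇Z` preserve `𝔭` and `𝔨`, where they are multiples of `ad Y` and `ad Z`: by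
`αᵢ/2β` and `αⱼ/2β` on `𝔭`, and by `-1/2` on `𝔨`. -/
theorem IsDiagonalMetric.ricci_k (hg : IsDiagonalMetric 𝔨 𝔣 β α g) (h : IdealData hC 𝔣 κ)
    (hβ : β ≠ 0) {i j : Fin m} {Y Z : V} (hY : Y ∈ 𝔣 i) (hZ : Z ∈ 𝔣 j) :
    ricci g Y Z = -(1 / 4) * (hC.traceK Y Z
      + (α i / β) * (α j / β) * (killingForm ℝ V Y Z - hC.traceK Y Z)) := by
  have hZk := h.le j Z hZ
  have hcomp : (leviCivita g).flip Y ∘ₗ (leviCivita g).flip Z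
      = (α i / β / 2 * (α j / β / 2)) •
          (LieAlgebra.ad ℝ V Y ∘ₗ LieAlgebra.ad ℝ V Z ∘ₗ hC.projP)
        + (1 / 4 : ℝ) • (LieAlgebra.ad ℝ V Y ∘ₗ LieAlgebra.ad ℝ V Z ∘ₗ hC.projK) := by
    rw [hg.flip_k h hβ hY, hg.flip_k h hβ hZ]
    refine hC.eq_of_eqOn (fun X hX => ?_) (fun X hX => ?_)
    · simp only [LinearMap.add_apply, LinearMap.sub_apply, LinearMap.smul_apply,
        LinearMap.comp_apply, LieAlgebra.ad_apply, hC.projP_p hX, hC.projK_p hX, lie_zero,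
        smul_zero, sub_zero, map_smul, hC.projP_p (hC.lie_k_p Z hZk X hX),
        hC.projK_p (hC.lie_k_p Z hZk X hX), add_zero]
      module
    · simp only [LinearMap.add_apply, LinearMap.sub_apply, LinearMap.smul_apply,
        LinearMap.comp_apply, LieAlgebra.ad_apply, hC.projP_k hX, hC.projK_k hX, lie_zero,
        smul_zero, zero_sub, map_smul, map_neg, hC.projP_k (𝔨.lie_mem hZk hX),
        hC.projK_k (𝔨.lie_mem hZk hX), zero_add]
      module
  have h1 := hC.traceK_add Y Z
  rw [ricci_eq_trace h.simple, hcomp, map_add, map_smul, map_smul, ← hC.traceK_apply, smul_eq_mul,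
    smul_eq_mul]
  linear_combination (-(α i / β / 2 * (α j / β / 2))) * h1

theorem IsDiagonalMetric.ricci_k_self (hg : IsDiagonalMetric 𝔨 𝔣 β α g) (h : IdealData hC 𝔣 κ)
    (hβ : β ≠ 0) {i : Fin m} {Y Z : V} (hY : Y ∈ 𝔣 i) (hZ : Z ∈ 𝔣 i) :
    ricci g Y Z = -(1 / 4) * (κ i + (α i / β) ^ 2 * (1 - κ i)) * killingForm ℝ V Y Z := by
  rw [hg.ricci_k h hβ hY hZ, hC.traceK_apply, h.trace_k i Y hY Z hZ]
  ring

theorem IsDiagonalMetric.ricci_k_ne (hg : IsDiagonalMetric 𝔨 𝔣 β α g) (h : IdealData hC 𝔣 κ)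
    (hβ : β ≠ 0) {i j : Fin m} (hij : i ≠ j) {Y Z : V} (hY : Y ∈ 𝔣 i) (hZ : Z ∈ 𝔣 j) :
    ricci g Y Z = 0 := by
  have h0 : LieAlgebra.ad ℝ V Y ∘ₗ LieAlgebra.ad ℝ V Z ∘ₗ hC.projK = 0 := by
    ext X
    simp only [LinearMap.comp_apply, LieAlgebra.ad_apply, LinearMap.zero_apply]
    refine h.lie_eq_zero i j hij Y hY _ ?_
    rw [← lie_skew]
    exact (𝔣 j).neg_mem (h.lie_mem j _ (hC.projK_mem X) Z hZ)
  rw [hg.ricci_k h hβ hY hZ, hC.traceK_apply, h0, h.orth i j hij Y hY Z hZ]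
  simp

theorem IsDiagonalMetric.ricci_p_k (hg : IsDiagonalMetric 𝔨 𝔣 β α g) (h : IdealData hC 𝔣 κ)
    (hβ : β ≠ 0) {i : Fin m} {Y Z : V} (hY : Y ∈ killingCompl 𝔨) (hZ : Z ∈ 𝔣 i) :
    ricci g Y Z = 0 := by
  have hZk := h.le i Z hZ
  rw [ricci_eq_trace h.simple, hg.flip_p h hβ hY, hg.flip_k h hβ hZ, neg_eq_zero]
  refine hC.trace_eq_zero_of_swap (fun X hX => ?_) (fun X hX => ?_)
  · have hZX := hC.lie_k_p Z hZk X hX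
    simp only [LinearMap.comp_apply, LinearMap.sub_apply, LinearMap.smul_apply, LinearMap.neg_apply,
      LinearMap.add_apply, LieAlgebra.ad_apply, hC.projP_p hX, hC.projK_p hX, lie_zero, smul_zero,
      sub_zero, map_smul, hC.projP_p hZX, h.sum_proj_p _ hZX, add_zero]
    exact 𝔨.smul_mem _ (𝔨.neg_mem (𝔨.smul_mem _ (hC.lie_p_p Y hY _ hZX)))
  · have hZX := 𝔨.lie_mem hZk hX
    simp only [LinearMap.comp_apply, LinearMap.sub_apply, LinearMap.smul_apply, LinearMap.neg_apply,
      LinearMap.add_apply, LieAlgebra.ad_apply, hC.projP_k hX, hC.projK_k hX, lie_zero, smul_zero,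
      zero_sub, map_smul, map_neg, hC.projP_k hZX, zero_add]
    exact Submodule.neg_mem _ (Submodule.smul_mem _ _ (Submodule.neg_mem _
      (hC.lie_p_k hY (h.sum_proj_mem _ _))))

/-- For `Y, Z ∈ 𝔭` the operators `∇Y` and `∇Z` exchange `𝔭` and `𝔨`. On each summand their product
has one factor `1/2` and one factor carrying the weights `1 + αᵢ/2β`. -/
theorem IsDiagonalMetric.ricci_p_trace (hg : IsDiagonalMetric 𝔨 𝔣 β α g) (h : IdealData hC 𝔣 κ)
    (hβ : β ≠ 0) {Y Z : V} (hY : Y ∈ killingCompl 𝔨) (hZ : Z ∈ killingCompl 𝔨) :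
    ricci g Y Z = -(1 / 2) * (traceWith (∑ i, (1 + α i / β / 2) • h.proj i) Y Z
      + traceWith (∑ i, (1 + α i / β / 2) • h.proj i) Z Y) := by
  rw [ricci_eq_trace h.simple, hg.flip_p h hβ hY, hg.flip_p h hβ hZ]
  set S := ∑ i, (1 + α i / β / 2) • h.proj i with hS
  have hSp : ∀ X ∈ killingCompl 𝔨, S X = 0 := fun X hX => h.sum_proj_p _ hX
  have hSk : ∀ X, S X ∈ 𝔨 := h.sum_proj_mem _
  have hcomp : (-((1 / 2 : ℝ) • (LieAlgebra.ad ℝ V Y ∘ₗ hC.projP) + LieAlgebra.ad ℝ V Y ∘ₗ S)) ∘ₗ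
      (-((1 / 2 : ℝ) • (LieAlgebra.ad ℝ V Z ∘ₗ hC.projP) + LieAlgebra.ad ℝ V Z ∘ₗ S))
      = (1 / 2 : ℝ) • ((LieAlgebra.ad ℝ V Y ∘ₗ S) ∘ₗ LieAlgebra.ad ℝ V Z ∘ₗ hC.projP)
        + (1 / 2 : ℝ) • (LieAlgebra.ad ℝ V Y ∘ₗ LieAlgebra.ad ℝ V Z ∘ₗ S) := by
    refine hC.eq_of_eqOn (fun X hX => ?_) (fun X hX => ?_)
    · have hZX := hC.lie_p_p Z hZ X hX
      simp only [LinearMap.comp_apply, LinearMap.smul_apply, LinearMap.neg_apply,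
        LinearMap.add_apply, LieAlgebra.ad_apply, hC.projP_p hX, hSp X hX, lie_zero, smul_zero,
        add_zero, map_smul, map_neg, hC.projP_k hZX, zero_add]
      module
    · have hZX := hC.lie_p_k hZ (hSk X)
      simp only [LinearMap.comp_apply, LinearMap.smul_apply, LinearMap.neg_apply,
        LinearMap.add_apply, LieAlgebra.ad_apply, hC.projP_k hX, smul_zero,
        zero_add, map_neg, hC.projP_p hZX, hSp _ hZX, add_zero, neg_neg, map_zero]
  have h1 : LinearMap.trace ℝ V ((LieAlgebra.ad ℝ V Y ∘ₗ S) ∘ₗ LieAlgebra.ad ℝ V Z ∘ₗ hC.projP)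
      = traceWith S Z Y := by
    rw [LinearMap.trace_comp_comm', traceWith_apply]
    congr 1
    ext X
    simp only [LinearMap.comp_apply, hC.projP_p (hC.lie_p_k hY (hSk X)), LieAlgebra.ad_apply]
  rw [hcomp, map_add, map_smul, map_smul, h1, ← traceWith_apply, smul_eq_mul, smul_eq_mul]
  ring

/-- Over orthonormal bases `x` of the ideal and `b` of `𝔭`, the double sum of `B(⁅x c, b a⁆, ⁅x c, b
a⁆)` is evaluated in two orders. Summing over `c` first gives the left-hand side; summing over `a`
first gives `1 - κ i` for each of the `dᵢ` vectors `x c`. -/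
theorem IdealData.traceWith_proj_sum (h : IdealData hC 𝔣 κ) {n : ℕ} {b : Fin n → V}
    (hbt : ∀ T : V →ₗ[ℝ] V, LinearMap.trace ℝ V (T ∘ₗ hC.projP)
      = ∑ a, killingForm ℝ V (T (b a)) (b a)) (i : Fin m) :
    ∑ a, traceWith (h.proj i) (b a) (b a) = Module.finrank ℝ (𝔣 i) * (1 - κ i) := by
  obtain ⟨x, hxf, hxq, -, hx⟩ := exists_trace_comp_proj (W := (𝔣 i).toSubmodule)
    (q := -killingForm ℝ V) (fun X _ Y _ => by simp only [LinearMap.neg_apply, killing_symm X Y])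
    (fun X hX h0 => by
      simp only [LinearMap.neg_apply, neg_pos]
      exact hC.neg X (h.le i X hX) h0) (P := h.proj i) (h.proj_mem i)
    (fun X Y hY => by simp only [LinearMap.neg_apply, h.killing_proj X hY])
  have h1 : ∀ X Z : V, killingForm ℝ V ⁅Z, ⁅Z, X⁆⁆ X = -killingForm ℝ V ⁅X, Z⁆ ⁅X, Z⁆ := by
    intro X Z
    have := killing_lie_skew Z ⁅Z, X⁆ X
    rw [← lie_skew X Z]
    simp only [map_neg, LinearMap.neg_apply]
    linarith
  calc ∑ a, traceWith (h.proj i) (b a) (b a)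
      = ∑ a, ∑ c, killingForm ℝ V ⁅x c, b a⁆ ⁅x c, b a⁆ := by
        refine Finset.sum_congr rfl fun a _ => ?_
        rw [traceWith_apply, ← LinearMap.comp_assoc, hx]
        refine Finset.sum_congr rfl fun c _ => ?_
        simp only [LinearMap.neg_apply, LinearMap.comp_apply, LieAlgebra.ad_apply]
        rw [h1, neg_neg]
    _ = ∑ c, ∑ a, killingForm ℝ V ⁅x c, b a⁆ ⁅x c, b a⁆ := Finset.sum_comm
    _ = ∑ c : Fin (Module.finrank ℝ (𝔣 i).toSubmodule), (1 - κ i) := by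
        refine Finset.sum_congr rfl fun c _ => ?_
        have h2 := hC.traceK_add (x c) (x c)
        rw [hC.traceK_apply, h.trace_k i _ (hxf c) _ (hxf c), ← LinearMap.comp_assoc, hbt] at h2
        have h3 := hxq c c
        simp only [LinearMap.neg_apply, if_true] at h3
        have h4 : ∀ a, killingForm ℝ V
            ((LieAlgebra.ad ℝ V (x c) ∘ₗ LieAlgebra.ad ℝ V (x c)) (b a)) (b a)
            = -killingForm ℝ V ⁅x c, b a⁆ ⁅x c, b a⁆ := fun a => by
          have := killing_lie_skew (x c) ⁅x c, b a⁆ (b a)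
          simp only [LinearMap.comp_apply, LieAlgebra.ad_apply]
          linarith
        simp only [h4, Finset.sum_neg_distrib] at h2
        have h5 : killingForm ℝ V (x c) (x c) = -1 := by linarith
        rw [h5] at h2
        linarith
    _ = Module.finrank ℝ (𝔣 i) * (1 - κ i) := by
        rw [Finset.sum_const, Finset.card_univ, Fintype.card_fin, nsmul_eq_mul]
        rfl

theorem IdealData.exists_p (h : IdealData hC 𝔣 κ) : ∃ X ∈ killingCompl 𝔨, X ≠ 0 := by
  obtain ⟨X, hX⟩ := h.ne_top
  obtain ⟨P, hP, K, hK, rfl⟩ := hC.exists_add X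
  refine ⟨P, hP, ?_⟩
  rintro rfl
  exact hX (by rwa [zero_add])

theorem IdealData.finrank_p_pos (h : IdealData hC 𝔣 κ) :
    0 < Module.finrank ℝ (killingCompl 𝔨) := by
  obtain ⟨X, hX, h0⟩ := h.exists_p
  have : Nontrivial (killingCompl 𝔨) := ⟨⟨X, hX⟩, 0, fun h => h0 (congrArg Subtype.val h)⟩
  exact Module.finrank_pos

/-- The symmetrised trace form is `𝔨`-invariant, so Schur's lemma makes it `c B` on `𝔭`. Summing
over an orthonormal basis of `𝔭` determines `c n` from `traceWith_proj_sum`. -/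
theorem IsDiagonalMetric.ricci_p (hg : IsDiagonalMetric 𝔨 𝔣 β α g) (h : IdealData hC 𝔣 κ)
    (hβ : β ≠ 0) {Y Z : V} (hY : Y ∈ killingCompl 𝔨) (hZ : Z ∈ killingCompl 𝔨) :
    ricci g Y Z = -((∑ i, (1 + α i / β / 2) * (Module.finrank ℝ (𝔣 i) * (1 - κ i)))
      / Module.finrank ℝ (killingCompl 𝔨)) * killingForm ℝ V Y Z := by
  set S := ∑ i, (1 + α i / β / 2) • h.proj i with hS
  have hSlie : ∀ K ∈ 𝔨, S ∘ₗ LieAlgebra.ad ℝ V K = LieAlgebra.ad ℝ V K ∘ₗ S := fun K hK =>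
    LinearMap.ext fun X => h.sum_proj_lie _ hK X
  obtain ⟨c, hc⟩ := schur_form (W := killingCompl 𝔨) (𝔨 := 𝔨) (q := killingForm ℝ V)
    (f := traceWith S + (traceWith S).flip) h.exists_p
    (fun U h1 h2 h3 => hC.irreducible_p h.simple h1 h2 h3) hC.lie_k_p
    (fun X _ Y _ => killing_symm X Y) hC.pos (fun K _ X _ Y _ => killing_lie_skew K X Y)
    (fun X _ Y _ => by simp only [LinearMap.add_apply, LinearMap.BilinForm.flip_apply]; ring)
    (fun K hK X _ Y _ => by
      have h1 := traceWith_lie (hSlie K hK) X Y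
      have h2 := traceWith_lie (hSlie K hK) Y X
      simp only [LinearMap.add_apply, LinearMap.BilinForm.flip_apply]
      linarith)
  obtain ⟨b, hbp, hbq, -, hbt⟩ := exists_trace_comp_proj (W := killingCompl 𝔨)
    (q := killingForm ℝ V) (fun X _ Y _ => killing_symm X Y) hC.pos (P := hC.projP) hC.projP_mem
    (fun X Y hY => by
      conv_rhs => rw [← hC.projP_add_projK X, map_add, LinearMap.add_apply,
        killing_k_p (hC.projK_mem X) hY, add_zero])
  have hsum : ∑ a, traceWith S (b a) (b a)
      = ∑ i, (1 + α i / β / 2) * (Module.finrank ℝ (𝔣 i) * (1 - κ i)) := by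
    have h1 : ∀ a, traceWith S (b a) (b a)
        = ∑ i, (1 + α i / β / 2) * traceWith (h.proj i) (b a) (b a) := fun a => by
      have h2 : LieAlgebra.ad ℝ V (b a) ∘ₗ LieAlgebra.ad ℝ V (b a) ∘ₗ S = ∑ i, (1 + α i / β / 2) •
          (LieAlgebra.ad ℝ V (b a) ∘ₗ LieAlgebra.ad ℝ V (b a) ∘ₗ h.proj i) :=
        LinearMap.ext fun X => by simp [hS, LinearMap.sum_apply]
      simp only [traceWith_apply, h2, map_sum, map_smul, smul_eq_mul]
    simp only [h1]
    rw [Finset.sum_comm]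
    refine Finset.sum_congr rfl fun i _ => ?_
    rw [← Finset.mul_sum, h.traceWith_proj_sum hbt]
  have hcn : c * Module.finrank ℝ (killingCompl 𝔨)
      = 2 * ∑ i, (1 + α i / β / 2) * (Module.finrank ℝ (𝔣 i) * (1 - κ i)) := by
    have h1 : ∀ a, 2 * traceWith S (b a) (b a) = c := fun a => by
      have := hc _ (hbp a) _ (hbp a)
      rw [hbq] at this
      simp only [LinearMap.add_apply, LinearMap.BilinForm.flip_apply, if_true] at this
      linarith
    rw [← hsum, Finset.mul_sum]
    simp only [h1]
    rw [Finset.sum_const, Finset.card_univ, Fintype.card_fin, nsmul_eq_mul, mul_comm]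
  have hn : (0 : ℝ) < Module.finrank ℝ (killingCompl 𝔨) := by exact_mod_cast h.finrank_p_pos
  have h1 := hc Y hY Z hZ
  simp only [LinearMap.add_apply, LinearMap.BilinForm.flip_apply] at h1
  rw [hg.ricci_p_trace h hβ hY hZ, ← hS, h1]
  have h2 : c = 2 * (∑ i, (1 + α i / β / 2) * (Module.finrank ℝ (𝔣 i) * (1 - κ i)))
      / Module.finrank ℝ (killingCompl 𝔨) := by
    rw [eq_div_iff hn.ne', hcn]
  rw [h2]
  ring

end Ricci
end DiagonalMetric
-- Excluding a mixed term between `𝔨` and `𝔭`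
section OffDiagonal

variable {V : Type*} [LieRing V] [LieAlgebra ℝ V] [FiniteDimensional ℝ V]
  {𝔨 : LieSubalgebra ℝ V}

theorem IsCartanDecomposition.killing_nondegenerate (hC : IsCartanDecomposition 𝔨) :
    (killingForm ℝ V).Nondegenerate := by
  have key : ∀ X, (∀ Y, killingForm ℝ V X Y = 0) → X = 0 := by
    intro X hX
    obtain ⟨P, hP, K, hK, rfl⟩ := hC.exists_add X
    have h1 := hX P
    have h2 := hX K
    rw [map_add, LinearMap.add_apply, killing_k_p hK hP, add_zero] at h1
    rw [map_add, LinearMap.add_apply, killing_p_k hK hP, zero_add] at h2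
    have h3 : P = 0 := by
      by_contra h0
      exact (hC.pos P hP h0).ne' h1
    have h4 : K = 0 := by
      by_contra h0
      exact (hC.neg K hK h0).ne h2
    rw [h3, h4, add_zero]
  exact ⟨key, fun X hX => key X fun Y => by rw [killing_symm]; exact hX Y⟩

/-- Over a basis `b` of `𝔨` orthonormal for `-B` the trace is `∑ⱼ B(⁅X, bⱼ⁆, ⁅X, bⱼ⁆) ≤ 0`, with
equality only when `X` is central in `𝔨`. -/
theorem IsCartanDecomposition.traceK_neg (hC : IsCartanDecomposition 𝔨) {X Y : V} (hX : X ∈ 𝔨)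
    (hY : Y ∈ 𝔨) (hne : ⁅X, Y⁆ ≠ 0) : hC.traceK X X < 0 := by
  obtain ⟨b, hbk, -, hbs, hb⟩ := exists_trace_comp_proj (W := 𝔨.toSubmodule) (q := -killingForm ℝ V)
    (fun X _ Y _ => by simp only [LinearMap.neg_apply, killing_symm X Y])
    (fun X hX h0 => by
      simp only [LinearMap.neg_apply, neg_pos]
      exact hC.neg X hX h0) (P := hC.projK) hC.projK_mem
    (fun X Y hY => by
      conv_rhs => rw [← hC.projP_add_projK X, map_add, LinearMap.neg_apply, LinearMap.add_apply,
        LinearMap.neg_apply, killing_p_k hY (hC.projP_mem X), neg_zero, zero_add])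
  have h2 : ∀ j, (-killingForm ℝ V) ((LieAlgebra.ad ℝ V X ∘ₗ LieAlgebra.ad ℝ V X) (b j)) (b j)
      = killingForm ℝ V ⁅X, b j⁆ ⁅X, b j⁆ := fun j => by
    have := killing_lie_skew X ⁅X, b j⁆ (b j)
    simp only [LinearMap.neg_apply, LinearMap.comp_apply, LieAlgebra.ad_apply]
    linarith
  have hnp : ∀ j, killingForm ℝ V ⁅X, b j⁆ ⁅X, b j⁆ ≤ 0 := by
    intro j
    rcases eq_or_ne ⁅X, b j⁆ 0 with h0 | h0
    · rw [h0]; simp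
    · exact (hC.neg _ (𝔨.lie_mem hX (hbk j)) h0).le
  rw [hC.traceK_apply, ← LinearMap.comp_assoc, hb]
  simp only [h2]
  refine lt_of_le_of_ne (Finset.sum_nonpos fun j _ => hnp j) fun h0 => hne ?_
  have hz := (Finset.sum_eq_zero_iff_of_nonpos fun j _ => hnp j).1 h0
  have hzero : ∀ j, ⁅X, b j⁆ = 0 := by
    intro j
    by_contra hj
    exact (hC.neg _ (𝔨.lie_mem hX (hbk j)) hj).ne (hz j (Finset.mem_univ j))
  rw [hbs Y hY, lie_sum]
  simp [hzero]

/-- An identification `J : 𝔨 → 𝔭` exhibiting the Lie algebra as a complexification of `𝔨`, together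
with the coefficients of an invariant metric. -/
structure IsComplexStructure (hC : IsCartanDecomposition 𝔨) (g : Metric V) (J : V →ₗ[ℝ] V)
    (A C D : ℝ) : Prop where
  mem : ∀ X ∈ 𝔨, J X ∈ killingCompl 𝔨
  surj : ∀ P ∈ killingCompl 𝔨, ∃ X ∈ 𝔨, J X = P
  lie : ∀ X ∈ 𝔨, ∀ Y ∈ 𝔨, ⁅X, J Y⁆ = J ⁅X, Y⁆
  lie' : ∀ X ∈ 𝔨, ∀ Y ∈ 𝔨, ⁅J X, J Y⁆ = -⁅X, Y⁆
  k_k : ∀ X ∈ 𝔨, ∀ Y ∈ 𝔨, g.form X Y = -A * killingForm ℝ V X Y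
  k_p : ∀ X ∈ 𝔨, ∀ Y ∈ 𝔨, g.form X (J Y) = -C * killingForm ℝ V X Y
  p_p : ∀ X ∈ 𝔨, ∀ Y ∈ 𝔨, g.form (J X) (J Y) = -D * killingForm ℝ V X Y

namespace IsComplexStructure

variable {hC : IsCartanDecomposition 𝔨} {g : Metric V} {J : V →ₗ[ℝ] V} {A C D : ℝ}

theorem p_k (h : IsComplexStructure hC g J A C D) {X Y : V} (hX : X ∈ 𝔨) (hY : Y ∈ 𝔨) :
    g.form (J X) Y = -C * killingForm ℝ V X Y := by
  rw [g.symm, h.k_p Y hY X hX, killing_symm]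

theorem lie'' (h : IsComplexStructure hC g J A C D) {X Y : V} (hX : X ∈ 𝔨) (hY : Y ∈ 𝔨) :
    ⁅J X, Y⁆ = J ⁅X, Y⁆ := by
  rw [← lie_skew, h.lie Y hY X hX, ← lie_skew X Y, map_neg]

theorem leviCivita_eq (h : IsComplexStructure hC g J A C D) {X Y W : V}
    (hk : ∀ Z ∈ 𝔨, 2 * g.form W Z = g.form ⁅X, Y⁆ Z - g.form ⁅Y, Z⁆ X + g.form ⁅Z, X⁆ Y)
    (hp : ∀ Z ∈ 𝔨, 2 * g.form W (J Z)
      = g.form ⁅X, Y⁆ (J Z) - g.form ⁅Y, J Z⁆ X + g.form ⁅J Z, X⁆ Y) :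
    leviCivita g X Y = W := by
  refine NatRed.leviCivita_eq g fun Z => ?_
  obtain ⟨P, hP, K, hK, rfl⟩ := hC.exists_add Z
  obtain ⟨Z', hZ', rfl⟩ := h.surj P hP
  have h1 := hk K hK
  have h2 := hp Z' hZ'
  simp only [lie_add, add_lie, map_add, LinearMap.add_apply]
  linear_combination h1 + h2

theorem killing_cyclic (X Y Z : V) : killingForm ℝ V ⁅Z, X⁆ Y = killingForm ℝ V ⁅X, Y⁆ Z := by
  rw [killing_lie, killing_symm]

/-- Testing the Koszul formula on `𝔨` and on `J 𝔨` gives the two linear equations for the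
coefficients `p` and `q`. -/
theorem leviCivita_p_k (h : IsComplexStructure hC g J A C D) {p q : ℝ} (h1 : 2 * (p * A + q * C) = C)
    (h2 : 2 * (p * C + q * D) = -A) {X Y : V} (hX : X ∈ 𝔨) (hY : Y ∈ 𝔨) :
    leviCivita g (J X) Y = p • ⁅X, Y⁆ + q • J ⁅X, Y⁆ := by
  have hXY := 𝔨.lie_mem hX hY
  refine h.leviCivita_eq (fun Z hZ => ?_) (fun Z hZ => ?_)
  · have hYZ := 𝔨.lie_mem hY hZ
    have hZX := 𝔨.lie_mem hZ hX
    simp only [h.lie'' hX hY, h.lie Z hZ X hX, map_add, map_smul, LinearMap.add_apply,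
      LinearMap.smul_apply, smul_eq_mul, h.k_k _ hXY _ hZ, h.p_k hXY hZ, h.k_p _ hYZ _ hX,
      h.p_k hZX hY]
    rw [killing_cyclic X Y Z, killing_cyclic Z X Y, killing_cyclic X Y Z]
    linear_combination (-killingForm ℝ V ⁅X, Y⁆ Z) * h1
  · have hYZ := 𝔨.lie_mem hY hZ
    have hZX := 𝔨.lie_mem hZ hX
    simp only [h.lie'' hX hY, h.lie Y hY Z hZ, h.lie' Z hZ X hX, map_add, map_smul, map_neg,
      LinearMap.neg_apply, LinearMap.add_apply, LinearMap.smul_apply, smul_eq_mul, h.k_k _ hZX _ hY,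
      h.p_p _ hXY _ hZ, h.k_p _ hXY _ hZ, h.p_p _ hYZ _ hX]
    rw [killing_cyclic X Y Z, killing_cyclic Z X Y, killing_cyclic X Y Z]
    linear_combination (-killingForm ℝ V ⁅X, Y⁆ Z) * h2

theorem leviCivita_p_p (h : IsComplexStructure hC g J A C D) {X Y : V} (hX : X ∈ 𝔨) (hY : Y ∈ 𝔨) :
    leviCivita g (J X) (J Y) = -(1 / 2 : ℝ) • ⁅X, Y⁆ := by
  have hXY := 𝔨.lie_mem hX hY
  refine h.leviCivita_eq (fun Z hZ => ?_) (fun Z hZ => ?_)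
  · have hYZ := 𝔨.lie_mem hY hZ
    have hZX := 𝔨.lie_mem hZ hX
    simp only [h.lie' X hX Y hY, h.lie'' hY hZ, h.lie Z hZ X hX, map_neg, map_smul,
      LinearMap.neg_apply, LinearMap.smul_apply, smul_eq_mul, h.k_k _ hXY _ hZ, h.p_p _ hYZ _ hX,
      h.p_p _ hZX _ hY]
    rw [killing_cyclic X Y Z, killing_cyclic Z X Y, killing_cyclic X Y Z]
    ring
  · have hYZ := 𝔨.lie_mem hY hZ
    have hZX := 𝔨.lie_mem hZ hX
    simp only [h.lie' X hX Y hY, h.lie' Y hY Z hZ, h.lie' Z hZ X hX, map_neg, map_smul,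
      LinearMap.neg_apply, LinearMap.smul_apply, smul_eq_mul, h.k_p _ hXY _ hZ, h.k_p _ hYZ _ hX,
      h.k_p _ hZX _ hY]
    rw [killing_cyclic X Y Z, killing_cyclic Z X Y, killing_cyclic X Y Z]
    ring

theorem leviCivita_k_p (h : IsComplexStructure hC g J A C D) {p q : ℝ} (h1 : 2 * (p * A + q * C) = C)
    (h2 : 2 * (p * C + q * D) = -A) {X Y : V} (hX : X ∈ 𝔨) (hY : Y ∈ 𝔨) :
    leviCivita g X (J Y) = -p • ⁅X, Y⁆ + (1 - q) • J ⁅X, Y⁆ := by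
  have h3 := leviCivita_torsion g X (J Y)
  rw [h.leviCivita_p_k h1 h2 hY hX, h.lie X hX Y hY, sub_eq_iff_eq_add, ← lie_skew Y X,
    map_neg] at h3
  rw [h3]
  module

/-- `∇(JW)` maps `𝔭` into `𝔨` and `∇Y` preserves `𝔨`, so the `𝔭`-block of the product vanishes. The
`𝔨`-block has coefficient `-p/2 + (1 - q)p`. -/
theorem ricci_eq (h : IsComplexStructure hC g J A C D) (hS : LieAlgebra.IsSimple ℝ V)
    (hinv : IsLieInvariant 𝔨 g.form) {p q : ℝ} (h1 : 2 * (p * A + q * C) = C)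
    (h2 : 2 * (p * C + q * D) = -A) {Y W : V} (hY : Y ∈ 𝔨) (hW : W ∈ 𝔨) :
    ricci g Y (J W) = -(p * (1 / 2 - q)) * hC.traceK Y W := by
  set S := (leviCivita g).flip Y ∘ₗ (leviCivita g).flip (J W) with hSdef
  have e1 : S = (S ∘ₗ hC.projP) ∘ₗ hC.projP + (S ∘ₗ hC.projK) ∘ₗ hC.projK := by
    refine hC.eq_of_eqOn (fun X hX => ?_) (fun X hX => ?_)
    · simp [hC.projP_p hX, hC.projK_p hX]
    · simp [hC.projP_k hX, hC.projK_k hX]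
  have e2 : hC.projP ∘ₗ S ∘ₗ hC.projP = 0 := by
    refine LinearMap.ext fun X => hC.projP_k ?_
    obtain ⟨X', hX', hX⟩ := h.surj _ (hC.projP_mem X)
    have hmem := 𝔨.lie_mem hX' hW
    have : S (J X') = (-(1 / 2 : ℝ)) • (1 / 2 : ℝ) • ⁅⁅X', W⁆, Y⁆ := by
      simp only [hSdef, LinearMap.comp_apply, LinearMap.flip_apply]
      rw [h.leviCivita_p_p hX' hW, map_smul, LinearMap.smul_apply, hinv.leviCivita_k hmem hY]
    rw [LinearMap.comp_apply, ← hX, this]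
    exact 𝔨.smul_mem _ (𝔨.smul_mem _ (𝔨.lie_mem hmem hY))
  have e3 : hC.projK ∘ₗ S ∘ₗ hC.projK
      = (p * (1 / 2 - q)) • (LieAlgebra.ad ℝ V Y ∘ₗ LieAlgebra.ad ℝ V W ∘ₗ hC.projK) := by
    refine LinearMap.ext fun X => ?_
    have hX := hC.projK_mem X
    simp only [LinearMap.comp_apply, LinearMap.smul_apply, LieAlgebra.ad_apply]
    set X' := hC.projK X
    have hmem := 𝔨.lie_mem hX hW
    have hmem' := 𝔨.lie_mem hmem hY
    simp only [hSdef, LinearMap.comp_apply, LinearMap.flip_apply]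
    rw [h.leviCivita_k_p h1 h2 hX hW, map_add, map_smul, map_smul, LinearMap.add_apply,
      LinearMap.smul_apply, LinearMap.smul_apply, hinv.leviCivita_k hmem hY,
      h.leviCivita_p_k h1 h2 hmem hY, map_add, map_smul, map_smul, map_smul, map_add, map_smul,
      map_smul, hC.projK_k hmem', hC.projK_p (h.mem _ hmem'), ← lie_skew Y, ← lie_skew W X',
      neg_lie, neg_neg]
    module
  rw [ricci_eq_trace hS, ← hSdef, e1, map_add, LinearMap.trace_comp_comm', e2,
    LinearMap.trace_comp_comm', e3, map_smul, map_zero, hC.traceK_apply, smul_eq_mul]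
  ring

theorem exists_lie_ne_zero (h : IsComplexStructure hC g J A C D) (hS : LieAlgebra.IsSimple ℝ V) :
    ∃ X ∈ 𝔨, ∃ Y ∈ 𝔨, ⁅X, Y⁆ ≠ 0 := by
  by_contra! h0
  refine hS.non_abelian ⟨fun X Y => ?_⟩
  obtain ⟨P, hP, K, hK, rfl⟩ := hC.exists_add X
  obtain ⟨P', hP', K', hK', rfl⟩ := hC.exists_add Y
  obtain ⟨Z, hZ, rfl⟩ := h.surj P hP
  obtain ⟨Z', hZ', rfl⟩ := h.surj P' hP'
  simp only [add_lie, lie_add, h.lie' Z hZ Z' hZ', h.lie'' hZ hK', h.lie K hK Z' hZ',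
    h0 Z hZ Z' hZ', h0 Z hZ K' hK', h0 K hK Z' hZ', h0 K hK K' hK', map_zero, neg_zero, add_zero]

theorem exists_ricci_ne_zero (h : IsComplexStructure hC g J A C D) (hS : LieAlgebra.IsSimple ℝ V)
    (hinv : IsLieInvariant 𝔨 g.form) (hCpos : 0 < C) :
    ∃ Y ∈ 𝔨, ∃ P ∈ killingCompl 𝔨, ricci g Y P ≠ 0 := by
  obtain ⟨X, hX, Y, hY, hXY⟩ := h.exists_lie_ne_zero hS
  have hX0 : X ≠ 0 := by
    rintro rfl
    exact hXY (zero_lie Y)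
  have hB := hC.neg X hX hX0
  have hA : 0 < A := by
    have := g.pos X hX0
    rw [h.k_k X hX X hX] at this
    nlinarith
  have hΔ : 0 < A * D - C ^ 2 := by
    -- Positivity of `g` on this vector, whose square is `-A B(X, X)(AD - C²)`, is the determinant
    -- criterion.
    have hv : A • J X - C • X ≠ 0 := by
      intro h0
      have h3 : C • X = 0 := by
        refine (Submodule.disjoint_def.1 hC.isCompl.disjoint) _ ?_ (𝔨.smul_mem C hX)
        rw [← sub_eq_zero.1 h0]
        exact Submodule.smul_mem _ _ (h.mem X hX)
      exact hX0 ((smul_eq_zero.1 h3).resolve_left hCpos.ne')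
    have h3 := g.pos _ hv
    simp only [map_sub, map_smul, LinearMap.sub_apply, LinearMap.smul_apply, smul_eq_mul,
      h.k_k X hX X hX, h.p_k hX hX, h.k_p X hX X hX, h.p_p X hX X hX] at h3
    have h4 : 0 < (-(A * killingForm ℝ V X X)) * (A * D - C ^ 2) := by linarith
    exact (pos_iff_pos_of_mul_pos h4).1 (by nlinarith)
  have hD : 0 < D := by
    by_contra hD
    nlinarith [sq_nonneg C]
  refine ⟨X, hX, J X, h.mem X hX, ?_⟩
  -- Cramer's rule for the two equations in `p` and `q`. Positivity of `A`, `C`, `D` and the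
  -- determinant makes `p` and `1/2 - q` positive.
  rw [h.ricci_eq hS hinv (p := C * (A + D) / (2 * (A * D - C ^ 2)))
    (q := -(A ^ 2 + C ^ 2) / (2 * (A * D - C ^ 2))) (by field_simp; ring) (by field_simp; ring)
    hX hX]
  have h5 := hC.traceK_neg hX hY hXY
  have h6 : 0 < C * (A + D) / (2 * (A * D - C ^ 2)) := by positivity
  have h7 : 0 < 1 / 2 - -(A ^ 2 + C ^ 2) / (2 * (A * D - C ^ 2)) := by
    rw [neg_div, sub_neg_eq_add]
    positivity
  exact mul_ne_zero (neg_ne_zero.2 (mul_pos h6 h7).ne') h5.ne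

end IsComplexStructure

/-- Dualising the mixed term with `B` gives an intertwiner `J₀ : 𝔨 → 𝔭`, onto by irreducibility of
`𝔭` and injective by simplicity. So `𝔨` is irreducible too, and Schur's lemma fixes all forms on `𝔨`
up to scalars. A multiple of `J₀` with `B(JX, JY) = -B(X, Y)` is the required `J`. -/
theorem IsLieInvariant.exists_isComplexStructure {g : Metric V} (hinv : IsLieInvariant 𝔨 g.form)
    (hC : IsCartanDecomposition 𝔨) (hS : LieAlgebra.IsSimple ℝ V) (hp : ∃ X, X ∉ 𝔨)
    (hne : ∃ X ∈ 𝔨, ∃ P ∈ killingCompl 𝔨, g.form X P ≠ 0) :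
    ∃ J A C D, IsComplexStructure hC g J A C D ∧ 0 < C := by
  let J₀ : V →ₗ[ℝ] V :=
    (LinearMap.BilinForm.toDual (killingForm ℝ V) hC.killing_nondegenerate).symm.toLinearMap ∘ₗ
      g.form.compl₁₂ hC.projK hC.projP
  have hJ₀ : ∀ X Y, killingForm ℝ V (J₀ X) Y = g.form (hC.projK X) (hC.projP Y) := fun X Y => by
    rw [← LinearMap.BilinForm.toDual_def hC.killing_nondegenerate]
    simp only [J₀, LinearMap.comp_apply, LinearEquiv.coe_coe, LinearEquiv.apply_symm_apply,
      LinearMap.compl₁₂_apply]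
  have hext : ∀ X Y, (∀ Z, killingForm ℝ V X Z = killingForm ℝ V Y Z) → X = Y := fun X Y hXY => by
    rw [← sub_eq_zero]
    exact hC.killing_nondegenerate.1 _ fun Z => by
      rw [map_sub, LinearMap.sub_apply, hXY, sub_self]
  have hmem : ∀ X, J₀ X ∈ killingCompl 𝔨 := fun X Y hY => by
    have : killingForm ℝ V Y (J₀ X) = 0 := by
      rw [killing_symm, hJ₀, hC.projP_k hY, map_zero]
    exact this
  have hlie : ∀ K ∈ 𝔨, ∀ X, J₀ ⁅K, X⁆ = ⁅K, J₀ X⁆ := fun K hK X => hext _ _ fun Z => by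
    have h1 := killing_lie_skew K (J₀ X) Z
    have h2 := hinv K hK (hC.projK X) (hC.projP Z)
    rw [hJ₀, hC.projP_lie hK] at h1
    rw [hJ₀, hC.projK_lie hK]
    linarith
  have hgJ : ∀ X ∈ 𝔨, ∀ P ∈ killingCompl 𝔨, killingForm ℝ V (J₀ X) P = g.form X P :=
    fun X hX P hP => by rw [hJ₀, hC.projK_k hX, hC.projP_p hP]
  obtain ⟨X₀, hX₀, P₀, hP₀, hne₀⟩ := hne
  have hJX₀ : J₀ X₀ ≠ 0 := by
    intro h0
    apply hne₀
    rw [← hgJ X₀ hX₀ P₀ hP₀, h0, map_zero, LinearMap.zero_apply]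
  have himg : ∀ U ≤ 𝔨.toSubmodule, (∀ K ∈ 𝔨, ∀ X ∈ U, ⁅K, X⁆ ∈ U) → (∃ X ∈ U, J₀ X ≠ 0) →
      killingCompl 𝔨 ≤ U.map J₀ := by
    intro U _ hst ⟨X, hX, h0⟩
    refine hC.irreducible_p hS ?_ ?_ ⟨J₀ X, ⟨X, hX, rfl⟩, h0⟩
    · rintro _ ⟨Y, -, rfl⟩
      exact hmem Y
    · rintro K hK _ ⟨Y, hY, rfl⟩
      exact ⟨⁅K, Y⁆, hst K hK Y hY, hlie K hK Y⟩
  have hsurj : ∀ P ∈ killingCompl 𝔨, ∃ X ∈ 𝔨, J₀ X = P := fun P hP =>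
    himg 𝔨.toSubmodule le_rfl (fun K hK X hX => 𝔨.lie_mem hK hX) ⟨X₀, hX₀, hJX₀⟩ hP
  -- If `J₀ Y = 0`, then `⁅Y, J₀ Z⁆ = J₀ ⁅Y, Z⁆ = -⁅Z, J₀ Y⁆ = 0`, so the kernel acts trivially on
  -- `𝔭 = J₀ 𝔨`.
  have hinj : ∀ X ∈ 𝔨, J₀ X = 0 → X = 0 := by
    intro X hX h0
    refine hC.eq_zero_of_trivial_on_p hS hp (W := 𝔨.toSubmodule ⊓ LinearMap.ker J₀) inf_le_left
      ?_ ?_ ⟨hX, h0⟩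
    · rintro K hK Y ⟨hY, hY0⟩
      refine ⟨𝔨.lie_mem hK hY, ?_⟩
      change J₀ Y = 0 at hY0
      change J₀ ⁅K, Y⁆ = 0
      rw [hlie K hK, hY0, lie_zero]
    · rintro Y ⟨hY, hY0⟩ P hP
      change J₀ Y = 0 at hY0
      obtain ⟨Z, hZ, rfl⟩ := hsurj P hP
      rw [← lie_skew, ← hlie Y hY, ← lie_skew, map_neg, hlie Z hZ, hY0, lie_zero, neg_zero,
        neg_zero]
  have hX₀0 : X₀ ≠ 0 := fun h => hJX₀ (by rw [h, map_zero])
  have hirr : ∀ U ≤ 𝔨.toSubmodule, (∀ K ∈ 𝔨, ∀ X ∈ U, ⁅K, X⁆ ∈ U) → (∃ X ∈ U, X ≠ 0) →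
      𝔨.toSubmodule ≤ U := by
    intro U hU hst ⟨X, hX, h0⟩ Y hY
    obtain ⟨Z, hZ, hZY⟩ := himg U hU hst ⟨X, hX, fun h => h0 (hinj X (hU hX) h)⟩ (hmem Y)
    have : Y - Z = 0 := hinj _ (𝔨.sub_mem hY (hU hZ)) (by rw [map_sub, hZY, sub_self])
    rwa [sub_eq_zero.1 this]
  have schur_k : ∀ f : LinearMap.BilinForm ℝ V, (∀ X ∈ 𝔨, ∀ Y ∈ 𝔨, f X Y = f Y X) →
      (∀ K ∈ 𝔨, ∀ X ∈ 𝔨, ∀ Y ∈ 𝔨, f ⁅K, X⁆ Y + f X ⁅K, Y⁆ = 0) →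
      ∃ c, ∀ X ∈ 𝔨, ∀ Y ∈ 𝔨, f X Y = -c * killingForm ℝ V X Y := by
    intro f hfs hf
    obtain ⟨c, hc⟩ := schur_form (W := 𝔨.toSubmodule) (𝔨 := 𝔨) (q := -killingForm ℝ V) (f := f)
      ⟨X₀, hX₀, hX₀0⟩ hirr (fun K hK X hX => 𝔨.lie_mem hK hX)
      (fun X _ Y _ => by simp only [LinearMap.neg_apply, killing_symm X Y])
      (fun X hX h0 => by
        simp only [LinearMap.neg_apply, neg_pos]
        exact hC.neg X hX h0)
      (fun K _ X _ Y _ => by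
        have := killing_lie_skew K X Y
        simp only [LinearMap.neg_apply]
        linarith) hfs hf
    exact ⟨c, fun X hX Y hY => by rw [hc X hX Y hY, LinearMap.neg_apply, LinearMap.neg_apply,
      neg_mul, mul_neg]⟩
  obtain ⟨A, hA⟩ := schur_k g.form (fun X _ Y _ => g.symm X Y) (fun K hK X _ Y _ => hinv K hK X Y)
  obtain ⟨l, hl⟩ := schur_k ((killingForm ℝ V).compl₁₂ J₀ J₀)
    (fun X _ Y _ => killing_symm _ _) (fun K hK X _ Y _ => by
      simp only [LinearMap.compl₁₂_apply, hlie K hK]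
      exact killing_lie_skew K _ _)
  obtain ⟨d, hd⟩ := schur_k (g.form.compl₁₂ J₀ J₀)
    (fun X _ Y _ => g.symm _ _) (fun K hK X _ Y _ => by
      simp only [LinearMap.compl₁₂_apply, hlie K hK]
      exact hinv K hK _ _)
  simp only [LinearMap.compl₁₂_apply] at hl hd
  have hlpos : 0 < l := by
    have h1 := hC.pos _ (hmem X₀) hJX₀
    rw [hl X₀ hX₀ X₀ hX₀] at h1
    have h2 := hC.neg X₀ hX₀ hX₀0
    nlinarith
  -- Since `B(J₀ X, J₀ Y) = -l B(X, Y)`, this is the scale at which `⁅JX, JY⁆ = -⁅X, Y⁆`.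
  obtain ⟨t, ht, htl⟩ : ∃ t : ℝ, 0 < t ∧ t * t * l = 1 :=
    ⟨(√l)⁻¹, by positivity, by
      have := Real.mul_self_sqrt hlpos.le
      have h0 : √l ≠ 0 := (Real.sqrt_pos.2 hlpos).ne'
      field_simp
      rw [Real.sq_sqrt hlpos.le]⟩
  have hlt : l * t * t = 1 := by linarith
  refine ⟨t • J₀, A, l * t, t * t * d, ⟨?_, ?_, ?_, ?_, hA, ?_, ?_⟩, by positivity⟩
  · exact fun X _ => Submodule.smul_mem _ t (hmem X)
  · intro P hP
    obtain ⟨X, hX, rfl⟩ := hsurj P hP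
    refine ⟨t⁻¹ • X, 𝔨.smul_mem _ hX, ?_⟩
    rw [LinearMap.smul_apply, map_smul, smul_smul, mul_inv_cancel₀ ht.ne', one_smul]
  · intro X hX Y _
    rw [LinearMap.smul_apply, LinearMap.smul_apply, lie_smul, hlie X hX]
  · intro X hX Y hY
    refine hext _ _ fun Z => ?_
    have hk : ⁅(t • J₀) X, (t • J₀) Y⁆ ∈ 𝔨 := hC.lie_p_p _ (Submodule.smul_mem _ t (hmem X)) _
      (Submodule.smul_mem _ t (hmem Y))
    have hk' : -⁅X, Y⁆ ∈ 𝔨 := 𝔨.neg_mem (𝔨.lie_mem hX hY)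
    have hKZ := hC.projK_mem Z
    rw [← hC.projP_add_projK Z, map_add, map_add, killing_k_p hk (hC.projP_mem Z),
      killing_k_p hk' (hC.projP_mem Z), zero_add, zero_add]
    set Z' := hC.projK Z
    simp only [LinearMap.smul_apply, smul_lie, lie_smul, map_smul, smul_eq_mul, map_neg,
      LinearMap.neg_apply]
    rw [killing_lie, ← lie_skew (J₀ Y) Z', ← hlie Z' hKZ, map_neg, hl X hX _ (𝔨.lie_mem hKZ hY),
      killing_lie X Y, ← lie_skew Y Z', map_neg]
    linear_combination (killingForm ℝ V X ⁅Z', Y⁆) * htl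
  · intro X hX Y hY
    rw [LinearMap.smul_apply, map_smul, ← hgJ X hX _ (hmem Y), hl X hX Y hY, smul_eq_mul]
    ring
  · intro X hX Y hY
    simp only [LinearMap.smul_apply, map_smul, smul_eq_mul, hd X hX Y hY]
    ring

/-- An invariant metric whose Ricci curvature has no mixed part makes `𝔨` and `𝔭` orthogonal. -/
theorem IsLieInvariant.orthogonal_of_ricci {g : Metric V} (hinv : IsLieInvariant 𝔨 g.form)
    (hC : IsCartanDecomposition 𝔨) (hS : LieAlgebra.IsSimple ℝ V) (hp : ∃ X, X ∉ 𝔨)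
    (hric : ∀ X ∈ 𝔨, ∀ P ∈ killingCompl 𝔨, ricci g X P = 0) {P X : V} (hP : P ∈ killingCompl 𝔨)
    (hX : X ∈ 𝔨) : g.form P X = 0 := by
  by_contra h0
  obtain ⟨J, A, C, D, hJ, hCpos⟩ := hinv.exists_isComplexStructure hC hS hp
    ⟨X, hX, P, hP, by rwa [g.symm]⟩
  obtain ⟨Y, hY, P', hP', hne⟩ := hJ.exists_ricci_ne_zero hS hinv hCpos
  exact hne (hric Y hY P' hP')

end OffDiagonal

/-! ### Invariant metrics without mixed term are diagonal -/

section Diagonalise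

variable {V : Type*} [LieRing V] [LieAlgebra ℝ V] [FiniteDimensional ℝ V]
  {𝔨 : LieSubalgebra ℝ V} {hC : IsCartanDecomposition 𝔨} {m : ℕ}
  {𝔣 : Fin m → LieSubalgebra ℝ V} {κ : Fin m → ℝ}

/-- Invariance moves a bracket of `𝔩` onto `Y`, where it vanishes, and `𝔩` is spanned by brackets.
-/
theorem IsLieInvariant.eq_zero_of_simple {f : LinearMap.BilinForm ℝ V} {𝔩 : LieSubalgebra ℝ V}
    (hf : IsLieInvariant 𝔩 f) (hl : LieAlgebra.IsSimple ℝ 𝔩) {Y : V}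
    (hc : ∀ X ∈ 𝔩, ⁅X, Y⁆ = 0) {X : V} (hX : X ∈ 𝔩) : f X Y = 0 := by
  have := mem_span_lie_of_simple hl hX
  clear hX
  induction this using Submodule.span_induction with
  | mem x hx =>
    obtain ⟨A, hA, B, hB, rfl⟩ := hx
    have := hf A hA B Y
    rwa [hc A hA, map_zero, add_zero] at this
  | zero => simp
  | add x y _ _ h1 h2 => rw [map_add, LinearMap.add_apply, h1, h2, add_zero]
  | smul a x _ h1 => rw [map_smul, LinearMap.smul_apply, h1, smul_zero]

/-- Schur's lemma gives one scalar on `𝔭` and one on each ideal. Two different ideals commute and at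
least one is simple, which forces orthogonality even when their modules might be isomorphic. -/
theorem IsLieInvariant.exists_isDiagonalMetric {g : Metric V} (hinv : IsLieInvariant 𝔨 g.form)
    (h : IdealData hC 𝔣 κ) (horth : ∀ P ∈ killingCompl 𝔨, ∀ X ∈ 𝔨, g.form P X = 0) :
    ∃ β α, IsDiagonalMetric 𝔨 𝔣 β α g ∧ 0 < β ∧ ∀ i, 0 < α i := by
  obtain ⟨β, hβ⟩ := schur_form (W := killingCompl 𝔨) (𝔨 := 𝔨) (q := killingForm ℝ V) (f := g.form)
    h.exists_p (fun U h1 h2 h3 => hC.irreducible_p h.simple h1 h2 h3) hC.lie_k_p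
    (fun X _ Y _ => killing_symm X Y) hC.pos (fun K _ X _ Y _ => killing_lie_skew K X Y)
    (fun X _ Y _ => g.symm X Y) (fun K hK X _ Y _ => hinv K hK X Y)
  have hα : ∀ i, ∃ α, ∀ X ∈ 𝔣 i, ∀ Y ∈ 𝔣 i, g.form X Y = -α * killingForm ℝ V X Y := by
    intro i
    obtain ⟨c, hc⟩ := schur_form (W := (𝔣 i).toSubmodule) (q := -killingForm ℝ V) (f := g.form)
      (𝔨 := 𝔨) (h.ne_bot i) (h.irreducible i) (h.lie_mem i)
      (fun X _ Y _ => by simp only [LinearMap.neg_apply, killing_symm X Y])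
      (fun X hX h0 => by
        simp only [LinearMap.neg_apply, neg_pos]
        exact hC.neg X (h.le i X hX) h0)
      (fun K _ X _ Y _ => by
        have := killing_lie_skew K X Y
        simp only [LinearMap.neg_apply]
        linarith)
      (fun X _ Y _ => g.symm X Y) (fun K hK X _ Y _ => hinv K hK X Y)
    exact ⟨c, fun X hX Y hY => by rw [hc X hX Y hY, LinearMap.neg_apply, LinearMap.neg_apply,
      neg_mul, mul_neg]⟩
  choose α hα using hα
  have hcross : ∀ i j, i ≠ j → ∀ X ∈ 𝔣 i, ∀ Y ∈ 𝔣 j, g.form X Y = 0 := by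
    have key : ∀ i j, i ≠ j → LieAlgebra.IsSimple ℝ (𝔣 i) → ∀ X ∈ 𝔣 i, ∀ Y ∈ 𝔣 j,
        g.form X Y = 0 := fun i j hij hi X hX Y hY =>
      IsLieInvariant.eq_zero_of_simple (𝔩 := 𝔣 i) (fun K hK => hinv K (h.le i K hK)) hi
        (fun X hX => h.lie_eq_zero i j hij X hX Y hY) hX
    intro i j hij X hX Y hY
    rcases h.simple_or i j hij with hs | hs
    · exact key i j hij hs X hX Y hY
    · rw [g.symm]
      exact key j i hij.symm hs Y hY X hX
  refine ⟨β, α, ⟨hβ, fun i X hX Y hY => ?_, horth⟩, ?_, fun i => ?_⟩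
  · refine h.eqOn_k (S := g.form.flip Y) (T := (-α i) • (killingForm ℝ V).flip Y) ?_ hX
    intro j X hX
    change g.form X Y = -α i * killingForm ℝ V X Y
    rcases eq_or_ne j i with rfl | hji
    · exact hα j X hX Y hY
    · rw [hcross j i hji X hX Y hY, h.orth j i hji X hX Y hY, mul_zero]
  · obtain ⟨X, hX, h0⟩ := h.exists_p
    have h1 := g.pos X h0
    have h2 := hC.pos X hX h0
    rw [hβ X hX X hX] at h1
    exact (pos_iff_pos_of_mul_pos h1).2 h2
  · obtain ⟨X, hX, h0⟩ := h.ne_bot i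
    have h1 := g.pos X h0
    have h2 := hC.neg X (h.le i X hX) h0
    rw [hα i X hX X hX] at h1
    nlinarith

end Diagonalise
-- The Cartan involution and polar factors of automorphisms
section CartanInvolution

variable {V : Type*} [LieRing V] [LieAlgebra ℝ V] [FiniteDimensional ℝ V]
  {𝔨 : LieSubalgebra ℝ V} (hC : IsCartanDecomposition 𝔨)

theorem IsCartanDecomposition.Q_symm (X Y : V) : hC.Q X Y = hC.Q Y X := by
  rw [hC.Q_apply, hC.Q_apply, killing_symm, killing_symm (hC.projK X)]

theorem IsCartanDecomposition.Q_pos (X : V) (hX : X ≠ 0) : 0 < hC.Q X X := by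
  have h1 : 0 ≤ killingForm ℝ V (hC.projP X) (hC.projP X) := by
    rcases eq_or_ne (hC.projP X) 0 with h0 | h0
    · rw [h0]; simp
    · exact (hC.pos _ (hC.projP_mem X) h0).le
  rw [hC.Q_apply]
  rcases eq_or_ne (hC.projK X) 0 with h0 | h0
  · have h2 : hC.projP X ≠ 0 := fun h => hX (by
      rw [← hC.projP_add_projK X, h, h0, add_zero])
    rw [h0]
    simpa using hC.pos _ (hC.projP_mem X) h2
  · have := hC.neg _ (hC.projK_mem X) h0
    linarith

/-- The Cartan involution. -/
noncomputable def IsCartanDecomposition.theta : V →ₗ[ℝ] V := hC.projK - hC.projP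

theorem IsCartanDecomposition.theta_k {X : V} (hX : X ∈ 𝔨) : hC.theta X = X := by
  rw [theta, LinearMap.sub_apply, hC.projK_k hX, hC.projP_k hX, sub_zero]

theorem IsCartanDecomposition.theta_p {X : V} (hX : X ∈ killingCompl 𝔨) : hC.theta X = -X := by
  rw [theta, LinearMap.sub_apply, hC.projK_p hX, hC.projP_p hX, zero_sub]

theorem IsCartanDecomposition.mem_of_theta {X : V} (hX : hC.theta X = X) : X ∈ 𝔨 := by
  have h1 : hC.projK X - hC.projP X = hC.projP X + hC.projK X := by
    rw [hC.projP_add_projK]; exact hX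
  have h2 : hC.projP X = 0 := by
    have h3 : (2 : ℝ) • hC.projP X = 0 := by
      have := sub_eq_zero.2 h1
      calc (2 : ℝ) • hC.projP X
          = -(hC.projK X - hC.projP X - (hC.projP X + hC.projK X)) := by module
        _ = 0 := by rw [this, neg_zero]
    exact (smul_eq_zero.1 h3).resolve_left two_ne_zero
  rw [← hC.projP_add_projK X, h2, zero_add]
  exact hC.projK_mem X

theorem IsCartanDecomposition.theta_theta (X : V) : hC.theta (hC.theta X) = X := by
  conv_lhs => rw [← hC.projP_add_projK X, map_add, map_add, hC.theta_p (hC.projP_mem X),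
    hC.theta_k (hC.projK_mem X), map_neg, hC.theta_p (hC.projP_mem X),
    hC.theta_k (hC.projK_mem X), neg_neg, hC.projP_add_projK]

theorem IsCartanDecomposition.theta_lie (X Y : V) :
    hC.theta ⁅X, Y⁆ = ⁅hC.theta X, hC.theta Y⁆ := by
  obtain ⟨P, hP, K, hK, rfl⟩ := hC.exists_add X
  obtain ⟨P', hP', K', hK', rfl⟩ := hC.exists_add Y
  simp only [map_add, hC.theta_p hP, hC.theta_k hK, hC.theta_p hP', hC.theta_k hK', add_lie,
    lie_add, hC.theta_k (hC.lie_p_p P hP P' hP'), hC.theta_k (𝔨.lie_mem hK hK'),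
    hC.theta_p (hC.lie_k_p K hK P' hP'), hC.theta_p (hC.lie_p_k hP hK'), neg_lie, lie_neg]
  abel

theorem IsCartanDecomposition.killing_theta (X Y : V) :
    killingForm ℝ V (hC.theta X) Y = -hC.Q X Y := by
  have h1 := killing_k_p (hC.projK_mem X) (hC.projP_mem Y)
  have h2 := killing_p_k (hC.projK_mem Y) (hC.projP_mem X)
  rw [hC.Q_apply]
  conv_lhs => rw [← hC.projP_add_projK Y]
  rw [theta, LinearMap.sub_apply, map_sub, LinearMap.sub_apply, map_add, map_add, h1, h2]
  ring

/-- The orthogonal polar factor of an automorphism is an automorphism that preserves `𝔨`. -/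
theorem IsCartanDecomposition.exists_polarFactor (e : V ≃ₗ⁅ℝ⁆ V) :
    ∃ u : V ≃ₗ⁅ℝ⁆ V, IsPolarFactor hC.Q (e : V →ₗ[ℝ] V) (u : V →ₗ[ℝ] V) ∧
      (∀ X ∈ 𝔨, u X ∈ 𝔨) ∧ ∀ X ∈ 𝔨, u.symm X ∈ 𝔨 := by
  obtain ⟨U, hU, hUl⟩ := exists_polarFactor_lie (q := hC.Q) hC.Q_symm hC.Q_pos
    (A := (e : V →ₗ[ℝ] V)) e.injective (fun X Y => e.map_lie X Y)
    -- Because `Q(X, Y) = -B(θX, Y)` and `e` preserves `B`, the operator `θ e⁻¹ θ e` is `eᵀe` for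
    -- `Q`; it is visibly an automorphism.
    (H := hC.theta ∘ₗ (e.symm : V →ₗ[ℝ] V) ∘ₗ hC.theta ∘ₗ (e : V →ₗ[ℝ] V))
    (fun X Y => by
      change hC.theta (e.symm (hC.theta (e ⁅X, Y⁆)))
        = ⁅hC.theta (e.symm (hC.theta (e X))), hC.theta (e.symm (hC.theta (e Y)))⁆
      rw [LieEquiv.map_lie, hC.theta_lie, LieEquiv.map_lie, hC.theta_lie])
    (fun X Y => by
      change hC.Q (hC.theta (e.symm (hC.theta (e X)))) Y = hC.Q (e X) (e Y)
      rw [← neg_inj, ← hC.killing_theta, ← hC.killing_theta, hC.theta_theta,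
        ← LieAlgebra.killingForm_of_equiv_apply e, LieEquiv.apply_symm_apply])
  have hinj : Function.Injective U := by
    rw [injective_iff_map_eq_zero]
    intro X hX
    by_contra h0
    have := hC.Q_pos X h0
    rw [← hU.isometry, hX] at this
    simp at this
  let u : V ≃ₗ⁅ℝ⁆ V :=
    { LinearEquiv.ofInjectiveEndo U hinj with map_lie' := fun {X Y} => hUl X Y }
  have hu : ∀ X, u X = U X := fun X => rfl
  -- `u` preserves both `Q` and `B`, hence commutes with `θ` and preserves its fixed space `𝔨`.
  have hθ : ∀ X, hC.theta (u X) = u (hC.theta X) := by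
    intro X
    rw [← sub_eq_zero]
    refine hC.killing_nondegenerate.1 _ fun Y => ?_
    obtain ⟨Y, rfl⟩ : ∃ Z, u Z = Y := u.surjective Y
    rw [map_sub, LinearMap.sub_apply, hC.killing_theta, LieAlgebra.killingForm_of_equiv_apply,
      hC.killing_theta, hu, hu, hU.isometry, sub_self]
  refine ⟨u, hU, fun X hX => hC.mem_of_theta ?_, fun X hX => hC.mem_of_theta ?_⟩
  · rw [hθ, hC.theta_k hX]
  · apply u.injective
    change u _ = u _
    rw [← hθ, LieEquiv.apply_symm_apply, hC.theta_k hX]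

end CartanInvolution

/-! ### Automorphisms preserving `𝔨` -/

section Automorphisms

variable {V : Type*} [LieRing V] [LieAlgebra ℝ V] {𝔨 𝔩 : LieSubalgebra ℝ V}

theorem isSimple_of_lieEquiv {L L' : Type*} [LieRing L] [LieAlgebra ℝ L] [LieRing L']
    [LieAlgebra ℝ L'] (e : L ≃ₗ⁅ℝ⁆ L') (h : LieAlgebra.IsSimple ℝ L) : LieAlgebra.IsSimple ℝ L' := by
  refine ⟨fun I => ?_, fun hab => h.non_abelian ⟨fun X Y => e.injective ?_⟩⟩
  · rw [or_iff_not_imp_left]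
    intro hI
    obtain ⟨x, hx, hx0⟩ := Submodule.exists_mem_ne_zero_of_ne_bot
      (p := I.toSubmodule) (fun h => hI ((LieSubmodule.toSubmodule_eq_bot _).1 h))
    have key := eq_univ_of_simple h (W := I.toSubmodule.comap (e : L →ₗ[ℝ] L')) (fun Z X hX => by
      change e ⁅Z, X⁆ ∈ I
      rw [LieEquiv.map_lie]
      exact I.lie_mem hX) ⟨e.symm x, by
        change e (e.symm x) ∈ I
        rwa [LieEquiv.apply_symm_apply], fun h0 => hx0 (by
          rw [← e.apply_symm_apply x, h0, map_zero])⟩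
    rw [eq_top_iff]
    intro y _
    rw [← e.apply_symm_apply y]
    exact key (e.symm y)
  · change e ⁅X, Y⁆ = e 0
    rw [LieEquiv.map_lie, map_zero]
    exact hab.trivial _ _

theorem map_derivedSubmodule {e : V ≃ₗ⁅ℝ⁆ V} (he : ∀ X ∈ 𝔨, e X ∈ 𝔨) {X : V}
    (hX : X ∈ derivedSubmodule 𝔨) : e X ∈ derivedSubmodule 𝔨 := by
  rw [derivedSubmodule] at hX
  induction hX using Submodule.span_induction with
  | mem x hx =>
    obtain ⟨A, hA, B, hB, rfl⟩ := hx
    rw [LieEquiv.map_lie]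
    exact lie_mem_derivedSubmodule (he A hA) (he B hB)
  | zero => rw [map_zero]; exact Submodule.zero_mem _
  | add x y _ _ h1 h2 => rw [map_add]; exact Submodule.add_mem _ h1 h2
  | smul a x _ h1 => rw [map_smul]; exact Submodule.smul_mem _ a h1

/-- An automorphism preserving `𝔨` maps simple ideals of `[𝔨, 𝔨]` to simple ideals. -/
theorem IsSimpleIdealOfDerived.map (h : IsSimpleIdealOfDerived 𝔨 𝔩) {e : V ≃ₗ⁅ℝ⁆ V}
    (he : ∀ X ∈ 𝔨, e X ∈ 𝔨) (he' : ∀ X ∈ 𝔨, e.symm X ∈ 𝔨) :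
    IsSimpleIdealOfDerived 𝔨 (𝔩.map (e : V →ₗ⁅ℝ⁆ V)) := by
  refine ⟨?_, ?_, ?_⟩
  · rintro _ ⟨X, hX, rfl⟩
    exact map_derivedSubmodule he (h.1 hX)
  · rintro X hX _ ⟨Y, hY, rfl⟩
    refine ⟨⁅e.symm X, Y⁆, h.2.1 _ (map_derivedSubmodule he' hX) Y hY, ?_⟩
    change e ⁅e.symm X, Y⁆ = ⁅X, e Y⁆
    rw [LieEquiv.map_lie, LieEquiv.apply_symm_apply]
  · exact isSimple_of_lieEquiv (e.lieSubalgebraMap 𝔩) h.2.2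

/-- An automorphism preserving `𝔨` preserves `𝔭`. -/
theorem map_mem_killingCompl [FiniteDimensional ℝ V] {e : V ≃ₗ⁅ℝ⁆ V}
    (he' : ∀ X ∈ 𝔨, e.symm X ∈ 𝔨) {X : V}
    (hX : X ∈ killingCompl 𝔨) : e X ∈ killingCompl 𝔨 := by
  rw [mem_killingCompl] at hX ⊢
  intro Y hY
  rw [← e.apply_symm_apply Y, LieAlgebra.killingForm_of_equiv_apply]
  exact hX _ (he' Y hY)

theorem IsCartanDecomposition.projP_map [FiniteDimensional ℝ V] (hC : IsCartanDecomposition 𝔨)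
    {e : V ≃ₗ⁅ℝ⁆ V} (he : ∀ X ∈ 𝔨, e X ∈ 𝔨) (he' : ∀ X ∈ 𝔨, e.symm X ∈ 𝔨) (X : V) :
    hC.projP (e X) = e (hC.projP X) := by
  conv_lhs => rw [← hC.projP_add_projK X, map_add, map_add,
    hC.projP_p (map_mem_killingCompl he' (hC.projP_mem X)), hC.projP_k (he _ (hC.projK_mem X)),
    add_zero]

theorem IsCartanDecomposition.projK_map [FiniteDimensional ℝ V] (hC : IsCartanDecomposition 𝔨)
    {e : V ≃ₗ⁅ℝ⁆ V} (he : ∀ X ∈ 𝔨, e X ∈ 𝔨) (he' : ∀ X ∈ 𝔨, e.symm X ∈ 𝔨) (X : V) :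
    hC.projK (e X) = e (hC.projK X) := by
  conv_lhs => rw [← hC.projP_add_projK X, map_add, map_add,
    hC.projK_p (map_mem_killingCompl he' (hC.projP_mem X)), hC.projK_k (he _ (hC.projK_mem X)),
    zero_add]

theorem IsCartanDecomposition.Q_map [FiniteDimensional ℝ V] (hC : IsCartanDecomposition 𝔨)
    {e : V ≃ₗ⁅ℝ⁆ V} (he : ∀ X ∈ 𝔨, e X ∈ 𝔨) (he' : ∀ X ∈ 𝔨, e.symm X ∈ 𝔨) (X Y : V) :
    hC.Q (e X) (e Y) = hC.Q X Y := by
  simp only [hC.Q_apply, hC.projP_map he he', hC.projK_map he he',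
    LieAlgebra.killingForm_of_equiv_apply]

end Automorphisms
-- `Ad K` preserves each ideal
section AdIdeals

variable {E : Type*} [NormedAddCommGroup E] [NormedSpace ℝ E] [FiniteDimensional ℝ E]
  [CompleteSpace E]
  {G : Type*} [TopologicalSpace G] [ChartedSpace E G] [Group G] [LieGroup 𝓘(ℝ, E) ∞ G]
  {K : Subgroup G} {𝔨 : LieSubalgebra ℝ (GroupLieAlgebra 𝓘(ℝ, E) G)}

theorem AdEquiv_mem (h𝔨 : IsLieAlgebraOf K 𝔨) {k : G} (hk : k ∈ K)
    {X : GroupLieAlgebra 𝓘(ℝ, E) G} (hX : X ∈ 𝔨) : AdEquiv k X ∈ 𝔨 :=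
  (h𝔨 _).2 (isTangentTo_Ad hk ((h𝔨 X).1 hX))

theorem AdEquiv_symm_mem (h𝔨 : IsLieAlgebraOf K 𝔨) {k : G} (hk : k ∈ K)
    {X : GroupLieAlgebra 𝓘(ℝ, E) G} (hX : X ∈ 𝔨) : (AdEquiv k).symm X ∈ 𝔨 :=
  (h𝔨 _).2 (isTangentTo_Ad (K.inv_mem hk) ((h𝔨 X).1 hX))

theorem isClosed_maps_to (W W' : Submodule ℝ E) :
    IsClosed {U : E →L[ℝ] E | ∀ X ∈ W, U X ∈ W'} := by
  simp only [Set.ofPred_forall]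
  refine isClosed_iInter fun X => isClosed_iInter fun _ => ?_
  exact W'.closed_of_finiteDimensional.preimage (by fun_prop : Continuous fun U : E →L[ℝ] E => U X)

/-- The adjoint action of `K` preserves each simple ideal of `[𝔨, 𝔨]` and the centre of `𝔨`. -/
theorem IsIdealList.Ad_mem [ConnectedSpace G] (h𝔨 : IsLieAlgebraOf K 𝔨)
    (hC : IsCartanDecomposition 𝔨) {r s : ℕ}
    {𝔣 : Fin (r + s) → LieSubalgebra ℝ (GroupLieAlgebra 𝓘(ℝ, E) G)} (h𝔣 : IsIdealList 𝔨 r s 𝔣)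
    {k : G} (hk : k ∈ K) (i : Fin (r + s)) {X : GroupLieAlgebra 𝓘(ℝ, E) G} (hX : X ∈ 𝔣 i) :
    AdEquiv k X ∈ 𝔣 i := by
  rcases h𝔣.cases i with hs | ⟨hc, -⟩
  swap
  · rw [hc] at hX ⊢
    refine ⟨AdEquiv_mem h𝔨 hk hX.1, fun Y hY => ?_⟩
    rw [← (AdEquiv k).apply_symm_apply Y, ← LieEquiv.map_lie,
      hX.2 _ (AdEquiv_symm_mem h𝔨 hk hY), map_zero]
  let W : Fin (r + s) → Submodule ℝ E := fun j => (𝔣 j).toSubmodule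
  let q : LinearMap.BilinForm ℝ E := hC.Q
  -- Operators that preserve the given ideal, against those that send it into another summand.
  let C : Set (E →L[ℝ] E) := {U | ∀ X ∈ W i, U X ∈ W i}
  let C' : Set (E →L[ℝ] E) := ⋃ j : {j // j ≠ i}, {U | ∀ X ∈ W i, U X ∈ W j}
  have hq : ∀ X, X ≠ 0 → 0 < q X X := hC.Q_pos
  obtain ⟨A, hA, B, hB, hAB⟩ := exists_ne_zero_of_simple hs.2.2
  have hABi := (𝔣 i).lie_mem hA hB
  have hmem : (adE (E := E) k : E →L[ℝ] E) ∈ C := by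
    refine polarFactor_mem_of_connected (E := E) (q := q) hC.Q_symm hq (S := G)
      (Φ := fun x => adE (E := E) x) continuous_adE (fun x => (AdEquiv x).bijective)
      (C := C) (C' := C') (isClosed_maps_to _ _)
      (isClosed_iUnion_of_finite fun j => isClosed_maps_to _ _) ?_ ?_ (x₀ := 1)
      (U₀ := ContinuousLinearMap.id ℝ E) (fun X hX => hX) ?_ (x := k) ?_
    -- A nonzero element of the ideal would be mapped into two `B`-orthogonal summands of `𝔨`, hence
    -- to `0`, which an isometry does not allow.
    · intro U h1 h2 hU
      obtain ⟨⟨j, hj⟩, h2⟩ := Set.mem_iUnion.1 h2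
      have h3 := h1 _ hABi
      have h4 := h2 _ hABi
      have h5 := h𝔣.orth hj h4 h3
      have h6 : U (⁅A, B⁆ : GroupLieAlgebra 𝓘(ℝ, E) G) = (0 : E) := by
        by_contra h0
        exact (hC.neg _ (h𝔣.le i h3) h0).ne h5
      refine ((hq _ hAB).trans_eq (hU _ _).symm).ne' ?_
      refine (congrArg (fun Z : E => q Z Z) h6).trans ?_
      simp
    -- The polar factor of `Ad x` is an automorphism preserving `𝔨`, so it permutes the simple
    -- ideals.
    · intro x
      obtain ⟨u, hu, huk, huk'⟩ := hC.exists_polarFactor (AdEquiv (E := E) x)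
      let U : E →ₗ[ℝ] E := (u : GroupLieAlgebra 𝓘(ℝ, E) G →ₗ[ℝ] GroupLieAlgebra 𝓘(ℝ, E) G)
      refine ⟨LinearMap.toContinuousLinearMap U, ?_, hu⟩
      obtain ⟨j, hj⟩ := (h𝔣.simple _).1 (hs.map huk huk')
      have hUm : ∀ X ∈ W i, U X ∈ W (Fin.castAdd s j) := fun X hX => by
        change u X ∈ 𝔣 (Fin.castAdd s j)
        rw [hj]
        exact ⟨X, hX, rfl⟩
      by_cases hji : Fin.castAdd s j = i
      · refine Or.inl ?_
        rw [hji] at hUm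
        exact hUm
      · exact Or.inr (Set.mem_iUnion.2 ⟨⟨_, hji⟩, hUm⟩)
    · rw [adE_one]
      exact ⟨fun _ _ => rfl, fun _ _ => rfl, fun X => by
        rcases eq_or_ne X 0 with rfl | h0
        · simp
        · exact (hq X h0).le⟩
    -- For `k ∈ K` the map `Ad k` preserves `𝔨` and `B`, hence `Q`, so it is its own polar factor.
    · refine ⟨fun X Y => ?_, fun _ _ => rfl, fun X => ?_⟩
      · exact hC.Q_map (e := AdEquiv k) (fun X hX => AdEquiv_mem h𝔨 hk hX)
          (fun X hX => AdEquiv_symm_mem h𝔨 hk hX) X Y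
      · rcases eq_or_ne (adE (E := E) k X) 0 with h0 | h0
        · change 0 ≤ q (adE (E := E) k X) (adE (E := E) k X)
          rw [h0]
          simp
        · exact (hq _ h0).le
  exact hmem X hX

end AdIdeals
-- The metric with prescribed coefficients and its reductive complement
section DiagonalConstruction

variable {V : Type*} [LieRing V] [LieAlgebra ℝ V] [FiniteDimensional ℝ V]
  {𝔨 : LieSubalgebra ℝ V} {hC : IsCartanDecomposition 𝔨} {m : ℕ}
  {𝔣 : Fin m → LieSubalgebra ℝ V} {κ : Fin m → ℝ} (h : IdealData hC 𝔣 κ)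

theorem IdealData.killing_proj_self (i : Fin m) (X Y : V) :
    killingForm ℝ V X (h.proj i Y) = killingForm ℝ V (h.proj i X) (h.proj i Y) :=
  (h.killing_proj X (h.proj_mem i Y)).symm

theorem IdealData.killing_sum_proj (c : Fin m → ℝ) (X Y : V) :
    killingForm ℝ V X ((∑ j, c j • h.proj j) Y)
      = ∑ j, c j * killingForm ℝ V (h.proj j X) (h.proj j Y) := by
  simp only [LinearMap.sum_apply, LinearMap.smul_apply, map_sum, map_smul, smul_eq_mul,
    h.killing_proj_self _ X Y]

theorem IdealData.killing_sum_proj_comm (c : Fin m → ℝ) (X Y : V) :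
    killingForm ℝ V ((∑ j, c j • h.proj j) X) Y
      = killingForm ℝ V X ((∑ j, c j • h.proj j) Y) := by
  rw [killing_symm, h.killing_sum_proj, h.killing_sum_proj]
  exact Finset.sum_congr rfl fun j _ => by rw [killing_symm]

theorem IsCartanDecomposition.killing_projP (hC : IsCartanDecomposition 𝔨) (X Y : V) :
    killingForm ℝ V X (hC.projP Y) = killingForm ℝ V (hC.projP X) (hC.projP Y) := by
  conv_lhs => rw [← hC.projP_add_projK X, map_add, LinearMap.add_apply,
    killing_k_p (hC.projK_mem X) (hC.projP_mem Y), add_zero]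

/-- The operator that is `1` on `𝔭` and `-aᵢ` on the `i`-th ideal: the first component of the
reductive complement. -/
noncomputable def IdealData.fstMap (a : Fin m → ℝ) : V →ₗ[ℝ] V :=
  hC.projP - ∑ j, a j • h.proj j

/-- The operator that is `0` on `𝔭` and `-(1 + aᵢ)` on the `i`-th ideal: the second component of
the reductive complement. -/
noncomputable def IdealData.sndMap (a : Fin m → ℝ) : V →ₗ[ℝ] V :=
  ∑ j, (-(1 + a j)) • h.proj j

theorem IdealData.fstMap_p (a : Fin m → ℝ) {X : V} (hX : X ∈ killingCompl 𝔨) :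
    h.fstMap a X = X := by
  rw [fstMap, LinearMap.sub_apply, hC.projP_p hX, h.sum_proj_p a hX, sub_zero]

theorem IdealData.fstMap_self (a : Fin m → ℝ) {i : Fin m} {X : V} (hX : X ∈ 𝔣 i) :
    h.fstMap a X = -a i • X := by
  rw [fstMap, LinearMap.sub_apply, hC.projP_k (h.le i X hX), h.sum_proj_self a hX, zero_sub,
    neg_smul]

theorem IdealData.fstMap_k (a : Fin m → ℝ) {X : V} (hX : X ∈ 𝔨) : h.fstMap a X ∈ 𝔨 := by
  rw [fstMap, LinearMap.sub_apply, hC.projP_k hX, zero_sub]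
  exact 𝔨.neg_mem (h.sum_proj_mem a X)

theorem IdealData.sndMap_mem (a : Fin m → ℝ) (X : V) : h.sndMap a X ∈ 𝔨 :=
  h.sum_proj_mem _ X

theorem IdealData.fstMap_sub_sndMap (a : Fin m → ℝ) (X : V) :
    h.fstMap a X - h.sndMap a X = X := by
  refine DFunLike.congr_fun (f := h.fstMap a - h.sndMap a) (g := LinearMap.id)
    (h.eq_of_eqOn (fun X hX => ?_) (fun i X hX => ?_)) X
  · rw [LinearMap.sub_apply, h.fstMap_p a hX, sndMap, h.sum_proj_p _ hX, sub_zero,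
      LinearMap.id_apply]
  · rw [LinearMap.sub_apply, h.fstMap_self a hX, sndMap, h.sum_proj_self _ hX, LinearMap.id_apply]
    module

/-- The inner product `Q|_𝔭 + ∑ᵢ aᵢ Q|_𝔨ᵢ`. -/
noncomputable def IdealData.metric (a : Fin m → ℝ) (ha : ∀ i, 0 < a i) : Metric V where
  form := (killingForm ℝ V).compl₁₂ LinearMap.id (h.fstMap a)
  symm X Y := by
    simp only [LinearMap.compl₁₂_apply, LinearMap.id_apply, fstMap, LinearMap.sub_apply, map_sub,
      hC.killing_projP X Y, hC.killing_projP Y X]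
    rw [killing_symm (hC.projP X), ← h.killing_sum_proj_comm, killing_symm _ Y]
  pos X hX := by
    simp only [LinearMap.compl₁₂_apply, LinearMap.id_apply, fstMap, LinearMap.sub_apply, map_sub,
      hC.killing_projP X X, h.killing_sum_proj a X X]
    have h1 : 0 ≤ killingForm ℝ V (hC.projP X) (hC.projP X) := by
      rcases eq_or_ne (hC.projP X) 0 with h0 | h0
      · rw [h0]; simp
      · exact (hC.pos _ (hC.projP_mem X) h0).le
    have h2 : ∀ j, a j * killingForm ℝ V (h.proj j X) (h.proj j X) ≤ 0 := by
      intro j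
      rcases eq_or_ne (h.proj j X) 0 with h0 | h0
      · rw [h0]; simp
      · exact (mul_neg_of_pos_of_neg (ha j) (hC.neg _ (h.le j _ (h.proj_mem j X)) h0)).le
    have h3 := Finset.sum_nonpos fun j (_ : j ∈ Finset.univ) => h2 j
    by_cases h4 : ∃ j, h.proj j X ≠ 0
    · obtain ⟨j, hj⟩ := h4
      have h5 : ∑ j, a j * killingForm ℝ V (h.proj j X) (h.proj j X) < 0 :=
        Finset.sum_neg' (fun j _ => h2 j) ⟨j, Finset.mem_univ j,
          mul_neg_of_pos_of_neg (ha j) (hC.neg _ (h.le j _ (h.proj_mem j X)) hj)⟩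
      linarith
    · push Not at h4
      have h5 : hC.projP X ≠ 0 := by
        intro h0
        apply hX
        rw [← h.fstMap_sub_sndMap a X, fstMap, sndMap]
        simp [h0, h4]
      have := hC.pos _ (hC.projP_mem X) h5
      linarith

theorem IdealData.metric_apply (a : Fin m → ℝ) (ha : ∀ i, 0 < a i) (X Y : V) :
    (h.metric a ha).form X Y = killingForm ℝ V X (h.fstMap a Y) := rfl

theorem IdealData.metric_isDiagonal (a : Fin m → ℝ) (ha : ∀ i, 0 < a i) :
    IsDiagonalMetric 𝔨 𝔣 1 a (h.metric a ha) where
  on_p X _ Y hY := by rw [h.metric_apply, h.fstMap_p a hY, one_mul]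
  on_k i X _ Y hY := by rw [h.metric_apply, h.fstMap_self a hY, map_smul, smul_eq_mul]
  p_k X hX Y hY := by rw [h.metric_apply, killing_p_k (h.fstMap_k a hY) hX]

/-- The torsion-like tensor of the reductive complement is skew with respect to the metric. -/
theorem IdealData.metric_skew (a : Fin m → ℝ) (ha : ∀ i, 0 < a i) (X Y Z : V) :
    (h.metric a ha).form (⁅h.fstMap a X, h.fstMap a Y⁆ - ⁅h.sndMap a X, h.sndMap a Y⁆) Z
      + (h.metric a ha).form Y
        (⁅h.fstMap a X, h.fstMap a Z⁆ - ⁅h.sndMap a X, h.sndMap a Z⁆) = 0 := by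
  -- By `hφ`, the complement `{(φX, ψX)}`, with `φ` and `ψ` the two component maps, is orthogonal to
  -- `Δ𝔨` for the bi-invariant form `B ⊕ -B(R·, ·)` on `𝔤 × 𝔨`. Its weights `aᵢ/(1 + aᵢ)` are chosen
  -- so that this form restricts to the metric, and skewness follows from bi-invariance.
  set R : V →ₗ[ℝ] V := ∑ j, (a j / (1 + a j)) • h.proj j with hR
  have hφ : ∀ K ∈ 𝔨, ∀ X, killingForm ℝ V K (h.fstMap a X)
      = killingForm ℝ V K (R (h.sndMap a X)) := by
    intro K hK X
    refine DFunLike.congr_fun (f := killingForm ℝ V K ∘ₗ h.fstMap a)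
      (g := killingForm ℝ V K ∘ₗ R ∘ₗ h.sndMap a)
      (h.eq_of_eqOn (fun X hX => ?_) (fun i X hX => ?_)) X
    · simp only [LinearMap.comp_apply]
      rw [h.fstMap_p a hX, killing_k_p hK hX, sndMap, h.sum_proj_p _ hX, map_zero, map_zero]
    · simp only [LinearMap.comp_apply]
      have h1 : 1 + a i ≠ 0 := by have := ha i; positivity
      rw [h.fstMap_self a hX, sndMap, h.sum_proj_self _ hX, map_smul R, hR, h.sum_proj_self _ hX,
        smul_smul]
      congr 2
      field_simp
  rw [(h.metric a ha).symm Y]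
  simp only [h.metric_apply, map_sub, LinearMap.sub_apply]
  have hk : ∀ Y, ⁅h.sndMap a X, h.sndMap a Y⁆ ∈ 𝔨 := fun Y =>
    𝔨.lie_mem (h.sndMap_mem a X) (h.sndMap_mem a Y)
  rw [hφ _ (hk Y), hφ _ (hk Z)]
  have h1 := killing_lie_skew (h.fstMap a X) (h.fstMap a Y) (h.fstMap a Z)
  have h2 := killing_lie_skew (h.sndMap a X) (h.sndMap a Y) (R (h.sndMap a Z))
  have h3 : R ⁅h.sndMap a X, h.sndMap a Z⁆ = ⁅h.sndMap a X, R (h.sndMap a Z)⁆ :=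
    h.sum_proj_lie _ (h.sndMap_mem a X) _
  have h4 : killingForm ℝ V (R (h.sndMap a Y)) ⁅h.sndMap a X, h.sndMap a Z⁆
      = killingForm ℝ V (h.sndMap a Y) (R ⁅h.sndMap a X, h.sndMap a Z⁆) :=
    h.killing_sum_proj_comm _ _ _
  rw [killing_symm (h.fstMap a Y)] at h1
  rw [h3] at h4
  rw [killing_symm _ (R (h.sndMap a Y)), h4]
  linarith

theorem IdealData.fstMap_map {e : V ≃ₗ⁅ℝ⁆ V} (he : ∀ X ∈ 𝔨, e.symm X ∈ 𝔨)
    (hef : ∀ i, ∀ X ∈ 𝔣 i, e X ∈ 𝔣 i) (a : Fin m → ℝ) (X : V) :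
    h.fstMap a (e X) = e (h.fstMap a X) := by
  refine DFunLike.congr_fun (f := h.fstMap a ∘ₗ (e : V →ₗ[ℝ] V))
    (g := (e : V →ₗ[ℝ] V) ∘ₗ h.fstMap a) (h.eq_of_eqOn (fun X hX => ?_) (fun i X hX => ?_)) X
  · change h.fstMap a (e X) = e (h.fstMap a X)
    rw [h.fstMap_p a hX, h.fstMap_p a (map_mem_killingCompl he hX)]
  · change h.fstMap a (e X) = e (h.fstMap a X)
    rw [h.fstMap_self a hX, h.fstMap_self a (hef i X hX), map_smul]

theorem IdealData.sndMap_map {e : V ≃ₗ⁅ℝ⁆ V} (he : ∀ X ∈ 𝔨, e.symm X ∈ 𝔨)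
    (hef : ∀ i, ∀ X ∈ 𝔣 i, e X ∈ 𝔣 i) (a : Fin m → ℝ) (X : V) :
    h.sndMap a (e X) = e (h.sndMap a X) := by
  have h1 := h.fstMap_sub_sndMap a X
  have h2 := h.fstMap_sub_sndMap a (e X)
  rw [h.fstMap_map he hef] at h2
  have h3 := congrArg e h1
  rw [map_sub] at h3
  exact sub_right_injective (h2.trans h3.symm)

theorem IdealData.metric_map {e : V ≃ₗ⁅ℝ⁆ V} (he : ∀ X ∈ 𝔨, e.symm X ∈ 𝔨)
    (hef : ∀ i, ∀ X ∈ 𝔣 i, e X ∈ 𝔣 i) (a : Fin m → ℝ) (ha : ∀ i, 0 < a i) (X Y : V) :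
    (h.metric a ha).form (e X) (e Y) = (h.metric a ha).form X Y := by
  rw [h.metric_apply, h.metric_apply, h.fstMap_map he hef, LieAlgebra.killingForm_of_equiv_apply]

end DiagonalConstruction
-- Natural reductivity of the constructed metric
section NaturallyReductive

variable {E : Type*} [NormedAddCommGroup E] [NormedSpace ℝ E] [FiniteDimensional ℝ E]
  [CompleteSpace E]
  {G : Type*} [TopologicalSpace G] [ChartedSpace E G] [Group G] [LieGroup 𝓘(ℝ, E) ∞ G]
  {K : Subgroup G} {𝔨 : LieSubalgebra ℝ (GroupLieAlgebra 𝓘(ℝ, E) G)}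
  {hC : IsCartanDecomposition 𝔨} {m : ℕ}
  {𝔣 : Fin m → LieSubalgebra ℝ (GroupLieAlgebra 𝓘(ℝ, E) G)} {κ : Fin m → ℝ}

/-- The component maps satisfy `φ - ψ = id`, so the parameter `X` of `(φX, ψX)` is exactly the
tangent vector it represents; invariance under `K` holds because `Ad k` preserves every summand. -/
theorem IdealData.isNaturallyReductiveFor (h : IdealData hC 𝔣 κ) (h𝔨 : IsLieAlgebraOf K 𝔨)
    (hAd : ∀ k ∈ K, ∀ i, ∀ X ∈ 𝔣 i, AdEquiv k X ∈ 𝔣 i) (a : Fin m → ℝ) (ha : ∀ i, 0 < a i) :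
    IsNaturallyReductiveFor K 𝔨 (LinearMap.range ((h.fstMap a).prod (h.sndMap a)))
      (h.metric a ha) where
  isometric k hk X Y := h.metric_map (e := AdEquiv k) (fun X hX => AdEquiv_symm_mem h𝔨 hk hX)
    (hAd k hk) a ha X Y
  disjoint := by
    rw [eq_bot_iff]
    rintro u ⟨⟨Y, -, hY⟩, ⟨X, hX⟩⟩
    have h1 : h.fstMap a X = u.1 := congrArg Prod.fst hX
    have h2 : h.sndMap a X = u.2 := congrArg Prod.snd hX
    have h3 : Y = u.1 := congrArg Prod.fst hY
    have h4 : Y = u.2 := congrArg Prod.snd hY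
    have h5 := h.fstMap_sub_sndMap a X
    rw [h1, h2, ← h3, ← h4, sub_self] at h5
    rw [← hX, ← h5, map_zero]
    exact Submodule.zero_mem _
  codisjoint := by
    refine le_antisymm (sup_le ?_ ?_) ?_
    · rintro _ ⟨Y, hY, rfl⟩
      exact ⟨Submodule.mem_top, hY⟩
    · rintro _ ⟨X, rfl⟩
      exact ⟨Submodule.mem_top, h.sndMap_mem a X⟩
    · rintro ⟨Z, Y⟩ ⟨-, hY⟩
      have h1 := h.fstMap_sub_sndMap a (Z - Y)
      refine Submodule.mem_sup.2 ⟨(Y - h.sndMap a (Z - Y), Y - h.sndMap a (Z - Y)),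
        ⟨_, 𝔨.sub_mem hY (h.sndMap_mem a (Z - Y)), rfl⟩, _, ⟨Z - Y, rfl⟩, ?_⟩
      refine Prod.ext ?_ ?_
      · change Y - h.sndMap a (Z - Y) + h.fstMap a (Z - Y) = Z
        rw [sub_add_eq_add_sub, add_sub_assoc, h1, add_sub_cancel]
      · change Y - h.sndMap a (Z - Y) + h.sndMap a (Z - Y) = Y
        rw [sub_add_cancel]
  invariant := by
    rintro k hk _ ⟨X, rfl⟩
    refine ⟨AdEquiv k X, Prod.ext ?_ ?_⟩
    · exact h.fstMap_map (e := AdEquiv k) (fun X hX => AdEquiv_symm_mem h𝔨 hk hX) (hAd k hk) a X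
    · exact h.sndMap_map (e := AdEquiv k) (fun X hX => AdEquiv_symm_mem h𝔨 hk hX) (hAd k hk) a X
  reductive := by
    -- Subtracting the two coordinates kills `Δ𝔨`, and `φ - ψ = id` then reads off the parameter of
    -- the `𝔪`-component of a bracket.
    have key : ∀ X Y A : GroupLieAlgebra 𝓘(ℝ, E) G,
        ⁅(h.fstMap a).prod (h.sndMap a) X, (h.fstMap a).prod (h.sndMap a) Y⁆
          - (h.fstMap a).prod (h.sndMap a) A ∈ isotropyAlgebra 𝔨 →
        A = ⁅h.fstMap a X, h.fstMap a Y⁆ - ⁅h.sndMap a X, h.sndMap a Y⁆ := by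
      rintro X Y A ⟨Z, -, hZ⟩
      have h1 : Z = ⁅h.fstMap a X, h.fstMap a Y⁆ - h.fstMap a A := congrArg Prod.fst hZ
      have h2 : Z = ⁅h.sndMap a X, h.sndMap a Y⁆ - h.sndMap a A := congrArg Prod.snd hZ
      rw [h1] at h2
      conv_lhs => rw [← h.fstMap_sub_sndMap a A]
      rw [sub_eq_sub_iff_add_eq_add] at h2 ⊢
      rw [add_comm, h2]
    rintro _ ⟨X, rfl⟩ _ ⟨Y, rfl⟩ _ ⟨Z, rfl⟩ _ ⟨A, rfl⟩ _ ⟨B, rfl⟩ hA hB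
    change (h.metric a ha).form (h.fstMap a A - h.sndMap a A) (h.fstMap a Z - h.sndMap a Z)
      + (h.metric a ha).form (h.fstMap a Y - h.sndMap a Y) (h.fstMap a B - h.sndMap a B) = 0
    simp only [h.fstMap_sub_sndMap]
    rw [key X Y A hA, key X Z B hB]
    exact h.metric_skew a ha X Y Z

end NaturallyReductive

/-! ### The prescribed Ricci equations -/

section Prescribed

variable {V : Type*} [LieRing V] [LieAlgebra ℝ V] [FiniteDimensional ℝ V]
  {𝔨 : LieSubalgebra ℝ V} {hC : IsCartanDecomposition 𝔨} {m : ℕ}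
  {𝔣 : Fin m → LieSubalgebra ℝ V} {κ : Fin m → ℝ}

theorem IsCartanDecomposition.Q_p (hC : IsCartanDecomposition 𝔨) {X Y : V}
    (hX : X ∈ killingCompl 𝔨) (hY : Y ∈ killingCompl 𝔨) : hC.Q X Y = killingForm ℝ V X Y := by
  rw [hC.Q_apply, hC.projP_p hX, hC.projP_p hY, hC.projK_p hX, map_zero, LinearMap.zero_apply,
    sub_zero]

theorem IsCartanDecomposition.Q_k (hC : IsCartanDecomposition 𝔨) {X Y : V}
    (hX : X ∈ 𝔨) (hY : Y ∈ 𝔨) : hC.Q X Y = -killingForm ℝ V X Y := by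
  rw [hC.Q_apply, hC.projK_k hX, hC.projK_k hY, hC.projP_k hX, map_zero, LinearMap.zero_apply,
    zero_sub]

/-- Bilinear forms that agree on all pairs of summands are equal. -/
theorem IdealData.form_ext (h : IdealData hC 𝔣 κ) {f f' : LinearMap.BilinForm ℝ V}
    (hpp : ∀ X ∈ killingCompl 𝔨, ∀ Y ∈ killingCompl 𝔨, f X Y = f' X Y)
    (hpk : ∀ X ∈ killingCompl 𝔨, ∀ i, ∀ Y ∈ 𝔣 i, f X Y = f' X Y)
    (hkp : ∀ i, ∀ X ∈ 𝔣 i, ∀ Y ∈ killingCompl 𝔨, f X Y = f' X Y)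
    (hkk : ∀ i j, ∀ X ∈ 𝔣 i, ∀ Y ∈ 𝔣 j, f X Y = f' X Y) : f = f' :=
  h.eq_of_eqOn (fun X hX => h.eq_of_eqOn (hpp X hX) (hpk X hX))
    fun i X hX => h.eq_of_eqOn (hkp i X hX) fun j => hkk i j X hX

/-- The Ricci curvature is a bilinear form. -/
theorem exists_ricci_form (hS : LieAlgebra.IsSimple ℝ V) (g : Metric V) :
    ∃ f : LinearMap.BilinForm ℝ V, ∀ X Y, f X Y = ricci g X Y := by
  refine ⟨LinearMap.mk₂ ℝ (ricci g) ?_ ?_ ?_ ?_, fun X Y => rfl⟩ <;>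
  · intros
    simp only [ricci_eq_trace hS, map_add, map_smul, LinearMap.add_comp, LinearMap.comp_add,
      LinearMap.smul_comp, LinearMap.comp_smul, smul_eq_mul]
    ring

variable {Tp : ℝ} {Tk : Fin m → ℝ} {T : LinearMap.BilinForm ℝ V} {g g' : Metric V} {β β' : ℝ}
  {α α' : Fin m → ℝ}

/-- Both forms are multiples of `B` on each summand and have no cross terms, so evaluation at one
nonzero vector per summand loses nothing. -/
theorem IsDiagonalMetric.ricci_eq_iff (hg : IsDiagonalMetric 𝔨 𝔣 β α g) (h : IdealData hC 𝔣 κ)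
    (hβ : β ≠ 0) (hT : IsDiagonalForm hC 𝔣 Tp Tk T) :
    (∀ X Y, ricci g X Y = T X Y) ↔
      (∀ i, 4 * Tk i = κ i + (α i / β) ^ 2 * (1 - κ i)) ∧
      Tp = (∑ i, (1 + α i / β / 2) * (Module.finrank ℝ (𝔣 i) * (1 - κ i)))
        / Module.finrank ℝ (killingCompl 𝔨) := by
  constructor
  · intro hric
    refine ⟨fun i => ?_, ?_⟩
    · obtain ⟨X, hX, h0⟩ := h.ne_bot i
      have hXk := h.le i X hX
      have h1 := hric X X
      rw [hg.ricci_k_self h hβ hX hX, hT.on_k i X hX X hX, hC.Q_k hXk hXk] at h1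
      have h2 := (hC.neg X hXk h0).ne
      have h3 : (4 * Tk i) * killingForm ℝ V X X
          = (κ i + (α i / β) ^ 2 * (1 - κ i)) * killingForm ℝ V X X := by linarith
      exact mul_right_cancel₀ h2 h3
    · obtain ⟨X, hX, h0⟩ := h.exists_p
      have h1 := hric X X
      rw [hg.ricci_p h hβ hX hX, hT.on_p X hX X hX, hC.Q_p hX hX] at h1
      exact (neg_injective (mul_right_cancel₀ (hC.pos X hX h0).ne' h1)).symm
  · rintro ⟨hk, hp⟩
    obtain ⟨f, hf⟩ := exists_ricci_form h.simple g
    have : f = T := by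
      refine h.form_ext ?_ ?_ ?_ ?_
      · intro X hX Y hY
        rw [hf, hg.ricci_p h hβ hX hY, hT.on_p X hX Y hY, hC.Q_p hX hY, hp]
      · intro X hX i Y hY
        rw [hf, hg.ricci_p_k h hβ hX hY, (hT.p_k X hX i Y hY).1]
      · intro i X hX Y hY
        rw [hf, ricci_symm h.simple, hg.ricci_p_k h hβ hY hX, (hT.p_k Y hY i X hX).2]
      · intro i j X hX Y hY
        rcases eq_or_ne i j with rfl | hij
        · rw [hf, hg.ricci_k_self h hβ hX hY, hT.on_k i X hX Y hY,
            hC.Q_k (h.le i X hX) (h.le i Y hY)]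
          linear_combination (1 / 4 * killingForm ℝ V X Y) * hk i
        · rw [hf, hg.ricci_k_ne h hβ hij hX hY, hT.k_k i j hij X hX Y hY]
    intro X Y
    rw [← hf, this]

theorem IsDiagonalForm.apply_k_p (hT : IsDiagonalForm hC 𝔣 Tp Tk T) (h : IdealData hC 𝔣 κ) {X P : V}
    (hX : X ∈ 𝔨) (hP : P ∈ killingCompl 𝔨) : T X P = 0 :=
  h.eqOn_k (S := LinearMap.flip T P) (T := 0) (fun i Y hY => (hT.p_k P hP i Y hY).2) hX

/-- An invariant metric with the prescribed Ricci curvature is diagonal. -/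
theorem IsLieInvariant.exists_of_ricci_eq (hinv : IsLieInvariant 𝔨 g.form) (h : IdealData hC 𝔣 κ)
    (hT : IsDiagonalForm hC 𝔣 Tp Tk T) (hric : ∀ X Y, ricci g X Y = T X Y) :
    ∃ β α, IsDiagonalMetric 𝔨 𝔣 β α g ∧ 0 < β ∧ (∀ i, 0 < α i) ∧
      (∀ i, 4 * Tk i = κ i + (α i / β) ^ 2 * (1 - κ i)) ∧
      Tp = (∑ i, (1 + α i / β / 2) * (Module.finrank ℝ (𝔣 i) * (1 - κ i)))
        / Module.finrank ℝ (killingCompl 𝔨) := by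
  obtain ⟨β, α, hg, hβ, hα⟩ := hinv.exists_isDiagonalMetric h fun P hP X hX =>
    hinv.orthogonal_of_ricci hC h.simple h.ne_top
      (fun X hX P hP => by rw [hric, hT.apply_k_p h hX hP]) hP hX
  exact ⟨β, α, hg, hβ, hα, (hg.ricci_eq_iff h hβ.ne' hT).1 hric⟩

theorem IsDiagonalMetric.form_eq_smul (hg : IsDiagonalMetric 𝔨 𝔣 β α g)
    (hg' : IsDiagonalMetric 𝔨 𝔣 β' α' g') (h : IdealData hC 𝔣 κ) {c : ℝ} (hβ : β' = c * β)
    (hα : ∀ i, α' i = c * α i) : g'.form = c • g.form := by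
  refine h.form_ext ?_ ?_ ?_ ?_
  · intro X hX Y hY
    rw [LinearMap.smul_apply, LinearMap.smul_apply, smul_eq_mul, hg.on_p X hX Y hY,
      hg'.on_p X hX Y hY, hβ, mul_assoc]
  · intro X hX i Y hY
    rw [LinearMap.smul_apply, LinearMap.smul_apply, smul_eq_mul, hg.p_k X hX Y (h.le i Y hY),
      hg'.p_k X hX Y (h.le i Y hY), mul_zero]
  · intro i X hX Y hY
    rw [LinearMap.smul_apply, LinearMap.smul_apply, smul_eq_mul, g.symm, g'.symm,
      hg.p_k Y hY X (h.le i X hX), hg'.p_k Y hY X (h.le i X hX), mul_zero]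
  · intro i j X hX Y hY
    rw [LinearMap.smul_apply, LinearMap.smul_apply, smul_eq_mul, hg.on_k j X (h.le i X hX) Y hY,
      hg'.on_k j X (h.le i X hX) Y hY, hα]
    ring

/-- The centre of `𝔨` has vanishing Killing form. -/
theorem IsIdealList.kappa_centre {r s : ℕ} {𝔣 : Fin (r + s) → LieSubalgebra ℝ V}
    (h𝔣 : IsIdealList 𝔨 r s 𝔣) (h : IdealData hC 𝔣 fun i => kappa (𝔣 i)) (j : Fin s) :
    kappa (𝔣 (Fin.natAdd r j)) = 0 := by
  obtain ⟨X, hX, h0⟩ := h.ne_bot (Fin.natAdd r j)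
  have h1 := h.trace_k _ X hX X hX
  have hc := (h𝔣.centre j X).1 hX
  have h2 : LieAlgebra.ad ℝ V X ∘ₗ LieAlgebra.ad ℝ V X ∘ₗ hC.projK = 0 := by
    ext Z
    simp only [LinearMap.comp_apply, LieAlgebra.ad_apply, LinearMap.zero_apply,
      hc.2 _ (hC.projK_mem Z), lie_zero]
  rw [h2, map_zero] at h1
  exact (mul_eq_zero.1 h1.symm).resolve_right (hC.neg X hc.1 h0).ne

/-- The equation for `T i` makes the radicand the square of `a i * (1 - κ i)`, which is positive, so
the root equals it. -/
theorem sum_ricci_coeff_eq {d κ a T : Fin m → ℝ} (n : ℝ) (ha : ∀ i, 0 < a i) (hκ : ∀ i, κ i < 1)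
    (hT : ∀ i, 4 * T i = κ i + a i ^ 2 * (1 - κ i)) :
    (∑ i, (1 + a i / 2) * (d i * (1 - κ i))) / n
      = ∑ i, (2 * d i * (1 - κ i) + d i * √((4 * T i - κ i) * (1 - κ i))) / (2 * n) := by
  rw [Finset.sum_div]
  refine Finset.sum_congr rfl fun i _ => ?_
  have h1 : (4 * T i - κ i) * (1 - κ i) = (a i * (1 - κ i)) ^ 2 := by
    rw [hT]; ring
  rw [h1, Real.sqrt_sq (mul_pos (ha i) (sub_pos.2 (hκ i))).le]
  rcases eq_or_ne n 0 with rfl | hn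
  · simp
  · field_simp

end Prescribed
end NatRed

/-! ### The main theorem -/

open NatRed in
theorem mainTheorem1
    {E : Type*} [NormedAddCommGroup E] [NormedSpace ℝ E] [FiniteDimensional ℝ E] [CompleteSpace E]
    {G : Type*} [TopologicalSpace G] [T2Space G] [SecondCountableTopology G]
    [ChartedSpace E G] [Group G] [LieGroup 𝓘(ℝ, E) ∞ G]
    [ConnectedSpace G] [NoncompactSpace G]
    (hG : LieAlgebra.IsSimple ℝ (GroupLieAlgebra 𝓘(ℝ, E) G))
    (K : Subgroup G) (hK : Maximal (fun H : Subgroup G => IsCompact (H : Set G)) K)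
    (𝔨 : LieSubalgebra ℝ (GroupLieAlgebra 𝓘(ℝ, E) G)) (h𝔨 : IsLieAlgebraOf K 𝔨)
    (hC : IsCartanDecomposition 𝔨)
    (r s : ℕ) (𝔣 : Fin (r + s) → LieSubalgebra ℝ (GroupLieAlgebra 𝓘(ℝ, E) G))
    (h𝔣 : IsIdealList 𝔨 r s 𝔣)
    (Tp : ℝ) (hTp : 0 < Tp) (Tk : Fin (r + s) → ℝ) (hTk : ∀ i, 0 < Tk i)
    (T : LinearMap.BilinForm ℝ (GroupLieAlgebra 𝓘(ℝ, E) G)) (hT : IsDiagonalForm hC 𝔣 Tp Tk T) :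
    ((∃ g ∈ naturallyReductiveMetrics K 𝔨, ∀ X Y, ricci g X Y = T X Y) ↔
      (∀ i : Fin r, 0 < 4 * Tk (Fin.castAdd s i) - kappa (𝔣 (Fin.castAdd s i))) ∧
      Tp = ∑ i : Fin (r + s),
        (2 * (Module.finrank ℝ (𝔣 i) : ℝ) * (1 - kappa (𝔣 i)) +
          (Module.finrank ℝ (𝔣 i) : ℝ) * √((4 * Tk i - kappa (𝔣 i)) * (1 - kappa (𝔣 i)))) /
        (2 * (Module.finrank ℝ (killingCompl 𝔨) : ℝ))) ∧
    (∀ g ∈ naturallyReductiveMetrics K 𝔨, ∀ g' ∈ naturallyReductiveMetrics K 𝔨,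
      (∀ X Y, ricci g X Y = T X Y) → (∀ X Y, ricci g' X Y = T X Y) →
      ∃ c : ℝ, 0 < c ∧ g'.form = c • g.form) := by
  have h := h𝔣.idealData hC hG (ne_top_of_isLieAlgebraOf hK.prop h𝔨)
  have hinv : ∀ g ∈ naturallyReductiveMetrics K 𝔨, IsLieInvariant 𝔨 g.form := by
    rintro g ⟨𝔪, hg⟩ X hX Y Z
    exact lie_invariant_of_Ad_invariant hg.isometric ((h𝔨 X).1 hX) Y Z
  refine ⟨⟨?_, ?_⟩, ?_⟩
  · rintro ⟨g, hg, hric⟩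
    obtain ⟨β, α, -, hβ, hα, hk, hp⟩ := (hinv g hg).exists_of_ricci_eq h hT hric
    refine ⟨fun i => ?_, ?_⟩
    · rw [hk, add_sub_cancel_left]
      have h1 := sub_pos.2 (h.kappa_lt (Fin.castAdd s i))
      have h2 := div_pos (hα (Fin.castAdd s i)) hβ
      positivity
    · rw [hp]
      exact sum_ricci_coeff_eq _ (fun i => div_pos (hα i) hβ) h.kappa_lt hk
  · rintro ⟨hpos, hp⟩
    -- On the centre `κ = 0`, so there the inequality is just `T > 0`.
    have hpos' : ∀ i, 0 < 4 * Tk i - kappa (𝔣 i) := by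
      refine Fin.addCases hpos fun j => ?_
      rw [h𝔣.kappa_centre h, sub_zero]
      exact mul_pos four_pos (hTk _)
    have h1 : ∀ i, 0 < 1 - kappa (𝔣 i) := fun i => sub_pos.2 (h.kappa_lt i)
    -- The positive solution `αᵢ/β` of the equation on the `i`-th ideal, with the scale fixed by `β
    -- = 1`.
    let a : Fin (r + s) → ℝ := fun i => √((4 * Tk i - kappa (𝔣 i)) / (1 - kappa (𝔣 i)))
    have ha : ∀ i, 0 < a i := fun i => Real.sqrt_pos.2 (div_pos (hpos' i) (h1 i))
    have hk : ∀ i, 4 * Tk i = kappa (𝔣 i) + a i ^ 2 * (1 - kappa (𝔣 i)) := fun i => by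
      rw [Real.sq_sqrt (div_pos (hpos' i) (h1 i)).le, div_mul_cancel₀ _ (h1 i).ne']
      ring
    refine ⟨h.metric a ha, ⟨_, h.isNaturallyReductiveFor h𝔨
      (fun k hk i X hX => h𝔣.Ad_mem h𝔨 hC hk i hX) a ha⟩, ?_⟩
    rw [(h.metric_isDiagonal a ha).ricci_eq_iff h one_ne_zero hT]
    simp only [div_one]
    exact ⟨hk, hp.trans (sum_ricci_coeff_eq _ ha h.kappa_lt hk).symm⟩
  · intro g hg g' hg' hric hric'
    obtain ⟨β, α, hd, hβ, hα, hk, -⟩ := (hinv g hg).exists_of_ricci_eq h hT hric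
    obtain ⟨β', α', hd', hβ', hα', hk', -⟩ := (hinv g' hg').exists_of_ricci_eq h hT hric'
    refine ⟨β' / β, div_pos hβ' hβ, hd.form_eq_smul hd' h (div_mul_cancel₀ _ hβ.ne').symm
      fun i => ?_⟩
    have h1 : 1 - kappa (𝔣 i) ≠ 0 := (sub_pos.2 (h.kappa_lt i)).ne'
    -- The tensor `T` determines the squares of the ratios because `κ ≠ 1`, and positivity then
    -- determines the ratios; only the common factor `β'/β` remains.
    have h2 : (α' i / β') ^ 2 = (α i / β) ^ 2 := by
      refine mul_right_cancel₀ h1 ?_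
      linarith [hk i, hk' i]
    have h3 : α' i / β' = α i / β :=
      (pow_left_inj₀ (div_pos (hα' i) hβ').le (div_pos (hα i) hβ).le two_ne_zero).1 h2
    rw [div_eq_iff hβ'.ne'] at h3
    rw [h3]
    ring
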